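/- All functions are smooth and all notions are local. Let $\mathcal X\subset\mathbb R^n$ be open, and consider the control-affine system $$\dot x=f(x)+g_1(x)u^1+g_2(x)u^2+g_3(x)u^3,\qquad x\in\mathcal X. \tag{1}$$ For a sufficiently large $N$ let $(x,u_{[0,N-1]})$ denote the state together with the inputs and their time derivatives up to order $N-1$; time derivatives of functions of $x,u,\dot u,\dots$ are taken along (1), and $h_{[\alpha]}$ is the $\alpha$-th time derivative of $h$. For multi-indices, $h_{[0,A]}$ is the tuple of all $h^j_{[\alpha]}$, $0\le\alpha\le a^j$. *Flat output.* A triple $\varphi=(\varphi^1(x),\varphi^2(x),\varphi^3(x))$ is an $x$-flat output of (1) near a point $q_0=(x_0,u_{0,[0,N-1]})$ with multi-index $R=(r^1,r^2,r^3)$ if near $q_0$ there is a smooth parametrization $x=F_x(\varphi_{[0,R-1]})$, $u=F_u(\varphi_{[0,R]})$ and $R$ is the least multi-index for which there is one. Its differential difference is $d_{\mathrm{diff}}(\varphi)=r^1+r^2+r^3-n$. *Static feedback equivalence.* Two systems $\dot s=G(s,w)$ and $\dot z=H(z,v)$ are static feedback equivalent (SFE) near $(s_0,w_0)$ if there are local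 diffeomorphisms $s\mapsto z=\Phi(s)$ and $(s,w)\mapsto(z,v)=(\Phi(s),\Psi(s,w))$ near $s_0$ and $(s_0,w_0)$ that transform the first into the second. *Prolongation.* The $D$-fold prolongation, $D=(d^1,d^2,d^3)$, of a system $\dot x=F(x,u)$ adds the equations $\dot u^i_{[\alpha]}=u^i_{[\alpha+1]}$, $0\le\alpha<d^i$; its state is $(x,u_{[0,D-1]})$ and its input is $u_{[D]}$. *$\varphi$-SFL via minimal prolongations.* The system (1) is $\varphi$-SFL via minimal prolongations near $q_0$ if there are an invertible input transformation $\hat u=\Phi_{\hat u}(x,u)$ near $(x_0,u_0)$ and integers $d^i\ge0$ with $d^1+d^2+d^3=d_{\mathrm{diff}}(\varphi)$ such that the $D$-fold prolongation of (1), written with the inputs $\hat u$, is SFE (near the point given by $q_0$) to three non-empty integrator chains, each driven by its own input, whose top variables are $\varphi^1,\varphi^2,\varphi^3$. *Triangular form.* Let $k^1,k^2,k^3\ge1$, $\delta\ge0$, $p^2\ge k^2$, $r^3\ge p^3$ be integers with $(p^3-k^3)-(p^2-k^2)=\delta$, and put $\bar z_j^{\,l}=(z_j^1,\dots,z_j^l)$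 (empty if $l\le 0$). The general triangular form $GTF_3$ with states $z=(z_1,z_2,z_3)$ of dimensions $k^1,p^2,r^3$ and inputs $\hat u^1,\hat u^2,\hat u^3$ is $$\dot z_1^l=z_1^{l+1}\ (l<k^1),\qquad \dot z_1^{k^1}=\hat u^1,$$ $$\dot z_2^l=z_2^{l+1}\ (l<k^2),\qquad \dot z_2^{k^2+i}=a_2^{k^2+i}+b_{2,1}^{k^2+i}\hat u^1\ (0\le i<p^2-k^2),\qquad \dot z_2^{p^2}=\hat u^2,$$ $$\dot z_3^l=z_3^{l+1}\ (l<k^3),\qquad \dot z_3^{k^3+i}=a_3^{k^3+i}+b_{3,1}^{k^3+i}\hat u^1\ (0\le i<p^3-k^3),$$ $$\dot z_3^{l}=a_3^{l}+b_{3,1}^{l}\hat u^1+b_{3,2}^{l}\hat u^2\ (p^3\le l<r^3),\qquad \dot z_3^{r^3}=\hat u^3.$$ (The equations $\dot z_2^{p^2}=\hat u^2$ and $\dot z_3^{r^3}=\hat u^3$ hold also if $p^2=k^2$ or $r^3=k^3$.) Here $a_2^{k^2+i},b_{2,1}^{k^2+i}$ are smooth functions of $(z_1,\bar z_2^{\,k^2+i+1},\bar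 z_3^{\,k^3+\delta+i+1})$; for $i<p^3-k^3$ the functions $a_3^{k^3+i},b_{3,1}^{k^3+i}$ depend on $(z_1,\bar z_2^{\,k^2-\delta+i+1},\bar z_3^{\,k^3+i+1})$; and for $p^3\le l<r^3$ the functions $a_3^l,b_{3,1}^l,b_{3,2}^l$ depend on $(z_1,z_2,\bar z_3^{\,l+1})$. Moreover, at all points considered, $b_{2,1}^{k^2}\ne0$ (if $k^2<p^2$), $b_{3,1}^{k^3}\neq0$ (if $k^3<r^3$), $$\partial_{z_3^{k^3+i+1}}\bigl(a_3^{k^3+i}+b_{3,1}^{k^3+i}\hat u^1\bigr)\ne0\quad(0\le i\le\delta-1),$$ $$\det\,\partial_{(z_2^{k^2+i+1},\,z_3^{k^3+\delta+i+1})}\begin{pmatrix}a_2^{k^2+i}+b_{2,1}^{k^2+i}\hat u^1\\ a_3^{k^3+\delta+i}+b_{3,1}^{k^3+\delta+i}\hat u^1\end{pmatrix}\ne0\quad(0\le i\le p^2-k^2-1),$$ $$\partial_{z_3^{l+1}}\bigl(a_3^{l}+b_{3,1}^{l}\hat u^1+b_{3,2}^{l}\hat u^2\bigr)\ne0\quad(p^3\le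 l\le r^3-1).$$ **Corollary.** Let $\varphi(x)$ be an $x$-flat output of (1) near $q_0$ with multi-index $R$, and suppose that for every multi-index $A\le R$ the codistribution $\langle \mathrm d\varphi_{[0,A-1]}\rangle\cap\langle\mathrm dx\rangle$ has constant rank near $q_0$. Suppose that near $(x_0,u_0)$ the system (1) is not SFE to $GTF_3$ in such a way that the components of $\varphi$ appear, up to their order, as $(z_1^1,z_2^1,z_3^1)$, but that it is $\varphi$-SFL via minimal prolongations near $q_0$. Then there is an integer $\kappa$ with $1\le\kappa\le d_{\mathrm{diff}}(\varphi)$ such that the system obtained from (1) by a $\kappa$-fold prolongation of each of the three inputs is SFE to $GTF_3$ near the point $(x_0,u_{0,[0,\kappa]})$ given by $q_0$, and, after a rearrangement of its components, $\varphi$ appears there as $(z_1^1,z_2^1,z_3^1)$. -/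

import Mathlib

open scoped ContDiff Topology

noncomputable section

namespace FlatGTF

/-- Values of the three inputs. -/
abbrev U : Type := Fin 3 → ℝ

/-- The control-affine system `ẋ = f(x) + g₁(x)u¹ + g₂(x)u² + g₃(x)u³`. -/
def affineSystem {n : ℕ} (f : (Fin n → ℝ) → (Fin n → ℝ))
    (g : Fin 3 → (Fin n → ℝ) → (Fin n → ℝ)) : (Fin n → ℝ) → U → (Fin n → ℝ) :=
  fun x u => f x + ∑ i, u i • g i x

/-! ### Prolongations -/

/-- The space with coordinates `(x, uⁱ_[0], …, uⁱ_[Dⁱ-1])`, `i = 1, 2, 3`. -/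
abbrev Ext (n : ℕ) (D : Fin 3 → ℕ) : Type :=
  (Fin n → ℝ) × ((i : Fin 3) → Fin (D i) → ℝ)

/-- `uⁱ_[α]`: a coordinate of the extended state for `α < Dⁱ`, the value `wⁱ` otherwise. -/
def inputCoord {n : ℕ} {D : Fin 3 → ℕ} (s : Ext n D) (w : U) (i : Fin 3) (α : ℕ) : ℝ :=
  if h : α < D i then s.2 i ⟨α, h⟩ else w i

/-- The system obtained by prolonging the `i`-th input `Dⁱ`-fold. Its state is
`(x, u_[0,D-1])`, its input is `u_[D]`; an input with `Dⁱ = 0` is not prolonged. -/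
def prolong {n : ℕ} (F : (Fin n → ℝ) → U → (Fin n → ℝ)) (D : Fin 3 → ℕ) :
    Ext n D → U → Ext n D :=
  fun s w => (F s.1 (fun i => inputCoord s w i 0),
    fun i α => inputCoord s w i (α.1 + 1))

/-! ### Time derivatives and flat outputs -/

/-- The extended state-input manifold with coordinates `(x, u_[0,N-1])`. -/
abbrev Jet (n N : ℕ) : Type := Ext n (fun _ => N)

/-- The vector field `f_u = fⁱ(x,u) ∂_{xⁱ} + ∑_{α<N-1} uʲ_[α+1] ∂_{uʲ_[α]}`. -/
def jetField {n : ℕ} (F : (Fin n → ℝ) → U → (Fin n → ℝ)) (N : ℕ) : Jet n N → Jet n N :=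
  fun q => prolong F (fun _ => N) q 0

/-- The `α`-fold Lie derivative of `h` along `f_u`. -/
def timeDeriv {n N : ℕ} (F : (Fin n → ℝ) → U → (Fin n → ℝ)) (h : Jet n N → ℝ) (α : ℕ) :
    Jet n N → ℝ :=
  (fun (k : Jet n N → ℝ) (q : Jet n N) => fderiv ℝ k q (jetField F N q))^[α] h

/-- `φʲ_[α]`, as a function on the extended state-input manifold. -/
def outDeriv {n : ℕ} (F : (Fin n → ℝ) → U → (Fin n → ℝ)) (φ : Fin 3 → (Fin n → ℝ) → ℝ)
    (N : ℕ) (j : Fin 3) (α : ℕ) : Jet n N → ℝ :=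
  timeDeriv F (fun q => φ j q.1) α

/-- The tuple `φ_[0,A-1]`. -/
def outJet {n : ℕ} (F : (Fin n → ℝ) → U → (Fin n → ℝ)) (φ : Fin 3 → (Fin n → ℝ) → ℝ)
    (N : ℕ) (A : Fin 3 → ℕ) (q : Jet n N) : (j : Fin 3) → Fin (A j) → ℝ :=
  fun j α => outDeriv F φ N j α.1 q

/-- Near `q₀` there is a smooth parametrization `x = F_x(y_[0,R-1])`, `u = F_u(y_[0,R])`. -/
def HasFlatParam {n : ℕ} (F : (Fin n → ℝ) → U → (Fin n → ℝ))
    (φ : Fin 3 → (Fin n → ℝ) → ℝ) (N : ℕ) (q₀ : Jet n N) (R : Fin 3 → ℕ) : Prop :=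
  ∃ (Yx : Set ((j : Fin 3) → Fin (R j) → ℝ)) (Yu : Set ((j : Fin 3) → Fin (R j + 1) → ℝ))
    (Fx : ((j : Fin 3) → Fin (R j) → ℝ) → (Fin n → ℝ))
    (Fu : ((j : Fin 3) → Fin (R j + 1) → ℝ) → U),
    IsOpen Yx ∧ IsOpen Yu ∧ ContDiffOn ℝ ∞ Fx Yx ∧ ContDiffOn ℝ ∞ Fu Yu ∧
    ∀ᶠ q in 𝓝 q₀,
      outJet F φ N R q ∈ Yx ∧ outJet F φ N (fun j => R j + 1) q ∈ Yu ∧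
      q.1 = Fx (outJet F φ N R q) ∧
      (fun i => inputCoord q 0 i 0) = Fu (outJet F φ N (fun j => R j + 1) q)

/-- `φ(x)` is an `x`-flat output near `q₀`, and `R` is its multi-index of highest derivative
orders: the least `R` that admits a parametrization. -/
def IsXFlatOutput {n : ℕ} (F : (Fin n → ℝ) → U → (Fin n → ℝ))
    (φ : Fin 3 → (Fin n → ℝ) → ℝ) (N : ℕ) (q₀ : Jet n N) (R : Fin 3 → ℕ) : Prop :=
  HasFlatParam F φ N q₀ R ∧
    ∀ R' : Fin 3 → ℕ, (∀ j, R' j ≤ N) → HasFlatParam F φ N q₀ R' → ∀ j, R j ≤ R' j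

/-- The differential difference `d_diff(φ) = ∑ⱼ rʲ - n`. -/
def diffDifference (n : ℕ) (R : Fin 3 → ℕ) : ℤ := (∑ j, (R j : ℤ)) - n

/-- The codistribution `⟨dφ_[0,A-1]⟩` at `q`. -/
def outCodist {n : ℕ} (F : (Fin n → ℝ) → U → (Fin n → ℝ)) (φ : Fin 3 → (Fin n → ℝ) → ℝ)
    (N : ℕ) (A : Fin 3 → ℕ) (q : Jet n N) : Submodule ℝ (Jet n N →L[ℝ] ℝ) :=
  Submodule.span ℝ {η | ∃ (j : Fin 3) (α : ℕ), α < A j ∧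
    η = fderiv ℝ (outDeriv F φ N j α) q}

/-- The codistribution `⟨dx⟩`. -/
def stateCodist (n N : ℕ) : Submodule ℝ (Jet n N →L[ℝ] ℝ) :=
  Submodule.span ℝ (Set.range fun i : Fin n =>
    (ContinuousLinearMap.proj i : (Fin n → ℝ) →L[ℝ] ℝ).comp
      (ContinuousLinearMap.fst ℝ (Fin n → ℝ) ((i : Fin 3) → Fin N → ℝ)))

/-- The codistributions `⟨dφ_[0,A-1]⟩ ∩ ⟨dx⟩`, `A ≤ R`, have constant rank near `q₀`. -/
def HasConstantRanks {n : ℕ} (F : (Fin n → ℝ) → U → (Fin n → ℝ))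
    (φ : Fin 3 → (Fin n → ℝ) → ℝ) (N : ℕ) (q₀ : Jet n N) (R : Fin 3 → ℕ) : Prop :=
  ∀ A : Fin 3 → ℕ, (∀ j, A j ≤ R j) → ∀ᶠ q in 𝓝 q₀,
    Module.finrank ℝ ↥(outCodist F φ N A q ⊓ stateCodist n N) =
      Module.finrank ℝ ↥(outCodist F φ N A q₀ ⊓ stateCodist n N)

/-! ### Static feedback equivalence -/

/-- A static feedback equivalence, near the state `s₀` and the input `w₀`, from
`ṡ = G(s,w)` to `ż = H(z,v)`: local diffeomorphisms `z = Φ(s)` and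
`(z,v) = (Φ(s), Ψ(s,w))` with `∂ₛΦ(s) G(s,w) = H(z,v)`. -/
structure LocalSFE {S Z : Type} [NormedAddCommGroup S] [NormedSpace ℝ S]
    [NormedAddCommGroup Z] [NormedSpace ℝ Z]
    (G : S → U → S) (s₀ : S) (w₀ : U) (H : Z → U → Z) where
  Φ : OpenPartialHomeomorph S Z
  Ξ : OpenPartialHomeomorph (S × U) (Z × U)
  base_mem : (s₀, w₀) ∈ Ξ.source
  source_sub : ∀ q ∈ Ξ.source, q.1 ∈ Φ.source
  fst_eq : ∀ q ∈ Ξ.source, (Ξ q).1 = Φ q.1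
  smooth_Φ : ContDiffOn ℝ ∞ Φ Φ.source
  smooth_Φ_symm : ContDiffOn ℝ ∞ Φ.symm Φ.target
  smooth_Ξ : ContDiffOn ℝ ∞ Ξ Ξ.source
  smooth_Ξ_symm : ContDiffOn ℝ ∞ Ξ.symm Ξ.target
  dynamics : ∀ q ∈ Ξ.source, fderiv ℝ Φ q.1 (G q.1 q.2) = H (Φ q.1) (Ξ q).2

/-! ### Static feedback linearizability via minimal prolongations -/

/-- Three integrator chains of lengths `κʲ`, the `j`-th one driven by `vʲ`. -/
def brunovsky (κ : Fin 3 → ℕ) :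
    ((j : Fin 3) → Fin (κ j) → ℝ) → U → ((j : Fin 3) → Fin (κ j) → ℝ) :=
  fun z v j i => if h : i.1 + 1 < κ j then z j ⟨i.1 + 1, h⟩ else v j

/-- `ṡ = G(s,w)` is static feedback linearizable near `(s₀,w₀)` with linearizing output
`h`: it is SFE to three non-empty integrator chains whose top variables are `h`. -/
def IsSFLWithOutput {S : Type} [NormedAddCommGroup S] [NormedSpace ℝ S]
    (G : S → U → S) (s₀ : S) (w₀ : U) (h : Fin 3 → S → ℝ) : Prop :=
  ∃ (κ : Fin 3 → ℕ) (hκ : ∀ j, 0 < κ j) (T : LocalSFE G s₀ w₀ (brunovsky κ)),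
    ∀ s ∈ T.Φ.source, ∀ j, T.Φ s j ⟨0, hκ j⟩ = h j s

/-- The system is `φ`-SFL via minimal prolongations near `q₀`. `T` is the input transformation
`(x, û) = (x, Φ_û(x,u))`, and `Dⁱ = 0` for those components of `û` that are not prolonged. The
point at which the prolonged system is considered consists of the values at `q₀` of the time
derivatives of `û`. -/
def IsSFLViaMinimalProlongations {n : ℕ} (F : (Fin n → ℝ) → U → (Fin n → ℝ))
    (φ : Fin 3 → (Fin n → ℝ) → ℝ) (N : ℕ) (q₀ : Jet n N) (R : Fin 3 → ℕ) : Prop :=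
  ∃ (T : OpenPartialHomeomorph ((Fin n → ℝ) × U) ((Fin n → ℝ) × U)) (D : Fin 3 → ℕ),
    (q₀.1, fun i => inputCoord q₀ 0 i 0) ∈ T.source ∧
    (∀ q ∈ T.source, (T q).1 = q.1) ∧
    ContDiffOn ℝ ∞ T T.source ∧ ContDiffOn ℝ ∞ T.symm T.target ∧
    (∑ i, (D i : ℤ)) = diffDifference n R ∧
    (let uhat : Fin 3 → ℕ → ℝ := fun i α =>
        timeDeriv F (fun q : Jet n N => (T (q.1, fun l => inputCoord q 0 l 0)).2 i) α q₀
     IsSFLWithOutput (prolong (fun x v => F x (T.symm (x, v)).2) D)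
        (q₀.1, fun i α => uhat i α.1) (fun i => uhat i (D i))
        (fun j s => φ j s.1))

/-! ### The general triangular form for three inputs -/

/-- The integers of the triangular form. -/
structure GTFShape where
  k1 : ℕ
  k2 : ℕ
  k3 : ℕ
  p2 : ℕ
  p3 : ℕ
  r3 : ℕ
  δ : ℕ
  one_le_k1 : 1 ≤ k1
  one_le_k2 : 1 ≤ k2
  one_le_k3 : 1 ≤ k3
  k2_le_p2 : k2 ≤ p2
  p3_le_r3 : p3 ≤ r3
  p3_sub_k3 : p3 + k2 = k3 + p2 + δ

/-- `z = (z₁, z₂, z₃)` with `k¹`, `p²` and `r³` components. -/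
abbrev GTFShape.State (I : GTFShape) : Type :=
  (Fin I.k1 → ℝ) × (Fin I.p2 → ℝ) × (Fin I.r3 → ℝ)

/-- The coordinate with number `l`, counted from `1`. -/
def coord {m : ℕ} (w : Fin m → ℝ) (l : ℕ) : ℝ :=
  if h : 1 ≤ l ∧ l ≤ m then w ⟨l - 1, by omega⟩ else 0

/-- The unit vector with number `l`, counted from `1`. -/
def unitVec (m l : ℕ) : Fin m → ℝ := fun i => if i.1 + 1 = l then 1 else 0

/-- `∂h/∂z₂^l` at `z`. -/
def GTFShape.pd2 (I : GTFShape) (l : ℕ) (h : I.State → ℝ) (z : I.State) : ℝ :=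
  fderiv ℝ h z (0, unitVec I.p2 l, 0)

/-- `∂h/∂z₃^l` at `z`. -/
def GTFShape.pd3 (I : GTFShape) (l : ℕ) (h : I.State → ℝ) (z : I.State) : ℝ :=
  fderiv ℝ h z (0, 0, unitVec I.r3 l)

/-- On `V`, the function `h` depends only on `z₁`, `z₂^1, …, z₂^{l₂}` and `z₃^1, …, z₃^{l₃}`. -/
def GTFShape.DependsOn (I : GTFShape) (V : Set I.State) (l₂ l₃ : ℤ) (h : I.State → ℝ) : Prop :=
  ∀ z ∈ V, ∀ z' ∈ V, z.1 = z'.1 →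
    (∀ l : ℕ, (l : ℤ) ≤ l₂ → coord z.2.1 l = coord z'.2.1 l) →
    (∀ l : ℕ, (l : ℤ) ≤ l₃ → coord z.2.2 l = coord z'.2.2 l) → h z = h z'

/-- The coefficient functions `a₂^l, b_{2,1}^l, a₃^l, b_{3,1}^l, b_{3,2}^l`. -/
structure GTFCoeff (I : GTFShape) where
  a2 : ℕ → I.State → ℝ
  b21 : ℕ → I.State → ℝ
  a3 : ℕ → I.State → ℝ
  b31 : ℕ → I.State → ℝ
  b32 : ℕ → I.State → ℝ

/-- The triangular dynamics; row `i` below is the equation for the coordinate number `i + 1`. -/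
def gtfField {I : GTFShape} (c : GTFCoeff I) : I.State → U → I.State :=
  fun z v =>
    (fun i => if i.1 + 1 < I.k1 then coord z.1 (i.1 + 2) else v 0,
     fun i =>
      if i.1 + 1 < I.k2 then coord z.2.1 (i.1 + 2)
      else if i.1 + 1 < I.p2 then c.a2 (i.1 + 1) z + c.b21 (i.1 + 1) z * v 0
      else v 1,
     fun i =>
      if i.1 + 1 < I.k3 then coord z.2.2 (i.1 + 2)
      else if i.1 + 1 < I.p3 then c.a3 (i.1 + 1) z + c.b31 (i.1 + 1) z * v 0
      else if i.1 + 1 < I.r3 then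
        c.a3 (i.1 + 1) z + c.b31 (i.1 + 1) z * v 0 + c.b32 (i.1 + 1) z * v 1
      else v 2)

/-- The coefficients are smooth on `V`, have the triangular dependencies there, and satisfy the
regularity conditions at the states in `V` and the state-input pairs in `Ω`. -/
structure IsGTF3 {I : GTFShape} (c : GTFCoeff I) (V : Set I.State) (Ω : Set (I.State × U)) :
    Prop where
  smooth2 : ∀ l, I.k2 ≤ l → l < I.p2 →
    ContDiffOn ℝ ∞ (c.a2 l) V ∧ ContDiffOn ℝ ∞ (c.b21 l) V
  smooth3 : ∀ l, I.k3 ≤ l → l < I.r3 →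
    ContDiffOn ℝ ∞ (c.a3 l) V ∧ ContDiffOn ℝ ∞ (c.b31 l) V
  smooth32 : ∀ l, I.p3 ≤ l → l < I.r3 → ContDiffOn ℝ ∞ (c.b32 l) V
  dep2 : ∀ i : ℕ, I.k2 + i < I.p2 →
    I.DependsOn V (I.k2 + i + 1) (I.k3 + I.δ + i + 1) (c.a2 (I.k2 + i)) ∧
    I.DependsOn V (I.k2 + i + 1) (I.k3 + I.δ + i + 1) (c.b21 (I.k2 + i))
  dep3 : ∀ i : ℕ, I.k3 + i < I.p3 →
    I.DependsOn V (I.k2 - I.δ + i + 1) (I.k3 + i + 1) (c.a3 (I.k3 + i)) ∧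
    I.DependsOn V (I.k2 - I.δ + i + 1) (I.k3 + i + 1) (c.b31 (I.k3 + i))
  dep3' : ∀ l : ℕ, I.p3 ≤ l → l < I.r3 →
    I.DependsOn V I.p2 (l + 1) (c.a3 l) ∧ I.DependsOn V I.p2 (l + 1) (c.b31 l) ∧
    I.DependsOn V I.p2 (l + 1) (c.b32 l)
  b21_ne : I.k2 < I.p2 → ∀ z ∈ V, c.b21 I.k2 z ≠ 0
  b31_ne : I.k3 < I.r3 → ∀ z ∈ V, c.b31 I.k3 z ≠ 0
  reg1 : ∀ i : ℕ, i < I.δ → ∀ q ∈ Ω,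
    I.pd3 (I.k3 + i + 1) (fun z => c.a3 (I.k3 + i) z + c.b31 (I.k3 + i) z * q.2 0) q.1 ≠ 0
  reg2 : ∀ i : ℕ, I.k2 + i < I.p2 → ∀ q ∈ Ω,
    (let h2 : I.State → ℝ := fun z => c.a2 (I.k2 + i) z + c.b21 (I.k2 + i) z * q.2 0
     let h3 : I.State → ℝ := fun z =>
        c.a3 (I.k3 + I.δ + i) z + c.b31 (I.k3 + I.δ + i) z * q.2 0
     Matrix.det !![I.pd2 (I.k2 + i + 1) h2 q.1, I.pd3 (I.k3 + I.δ + i + 1) h2 q.1;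
                   I.pd2 (I.k2 + i + 1) h3 q.1, I.pd3 (I.k3 + I.δ + i + 1) h3 q.1] ≠ 0)
  reg3 : ∀ l : ℕ, I.p3 ≤ l → l < I.r3 → ∀ q ∈ Ω,
    I.pd3 (l + 1) (fun z => c.a3 l z + c.b31 l z * q.2 0 + c.b32 l z * q.2 1) q.1 ≠ 0

/-- `ṡ = G(s,w)` is, near `(s₀,w₀)`, static feedback equivalent to the general triangular form,
and, after a rearrangement `σ` of its components, the output `h` appears there as
`(z₁^1, z₂^1, z₃^1)`. -/
def IsSFEToGTF3 {S : Type} [NormedAddCommGroup S] [NormedSpace ℝ S]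
    (G : S → U → S) (s₀ : S) (w₀ : U) (h : Fin 3 → S → ℝ) : Prop :=
  ∃ (I : GTFShape) (c : GTFCoeff I) (T : LocalSFE G s₀ w₀ (gtfField c))
    (σ : Equiv.Perm (Fin 3)),
    IsGTF3 c T.Φ.target T.Ξ.target ∧
    ∀ s ∈ T.Φ.source,
      coord (T.Φ s).1 1 = h (σ 0) s ∧ coord (T.Φ s).2.1 1 = h (σ 1) s ∧
      coord (T.Φ s).2.2 1 = h (σ 2) s

end FlatGTF

end

open scoped ContDiff Topology

noncomputable section

namespace FlatGTF

open Module Metric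


/-! ### Local diffeomorphisms -/

/-! Write û for the transformed inputs and M = ∂φ_[R]/∂û_[D]. The integrator chains of the
linearization have total length n + ΣD = ΣR and give a flat parametrization, so the minimality of R
forces their lengths to be R (`exists_flatChart`). Hence φ_[0,R-1] is a chart of the states (x,
û_[0,D-1]) and M is invertible. A time differentiation moves the coefficient of the highest input
derivative up by one order, so M also contains leading coefficients of the lower and higher
derivatives of φ.

Two principles restrict D and M. The first is minimality (`FlatChart.minimality`): if k prolonged
inputs occur in only k rows of M, then suitable directions Σ cⁱ ∂/∂ûⁱ_[Dⁱ-1] move only the last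
variable of one chain and leave x fixed, so that an entry of R could be lowered. Therefore some
input is not prolonged, no prolonged column of M is concentrated in one row, and no row vanishes in
two prolonged columns. The second is constancy of ranks (`FlatChart.free_of_rank`,
`FlatChart.symbol_zero_of_rank`): the decisive coefficients that vanish at q₀ vanish near q₀.
Together they provide pivots that are nonzero at the point itself (`FlatChart.exists_triangular`).

Number inputs and outputs by 0, 1, 2, with prolongation numbers 0 = d⁰ ≤ d¹ ≤ d² = κ, and call the
ordered outputs y. The κ-fold prolongation has the coordinates z₁ = y⁰_[0,r⁰-1], z₂ =
(y¹_[0,r¹+e-1], û¹_[d¹+e,κ-1]), z₃ = (y²_[0,r²-1], û⁰_[0,κ-1]), which are n + 3κ in number. The new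
inputs are y⁰_[r⁰], then û¹_[κ] (or y¹_[r¹+e] if d¹ + e = κ), and û⁰_[κ]. The integer e = δ counts
the derivatives of y¹ from order r¹ on that are used as coordinates because û²_[κ] has not entered
them. Where û²_[κ] does enter, in y¹_[r¹+e] and in y²_[r²], it is eliminated by subtracting
multiples of y⁰_[r⁰], and of y¹_[r¹] as well if d¹ = d². The multiples are the functions b, the
remainders the functions a (`TriData.TriangularAt.jetCoordsAt`).

Prolonging all inputs equally often is compatible with an input transformation, since (x, u_[0,κ-1])
and (x, û_[0,κ-1]) determine each other (`InputTransform.eventually_trunc_iff`, `JetLiftAt.hat`); so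
the result holds for the original inputs. All requirements are first expressed through
differentials, which makes them easy to pull back, and are integrated once, on balls
(`isSFEToGTF3_of_coords`). Finally κ ≥ 1, because D = 0 would make (1) itself a triangular form
without coefficients. -/

theorem eq_of_fderiv_eq_zero_on_convex {E : Type*} [NormedAddCommGroup E] [NormedSpace ℝ E]
    {F : Type*} [NormedAddCommGroup F] [NormedSpace ℝ F]
    {A : E → F} {C : Set E} (hC : Convex ℝ C) (hd : ∀ y ∈ C, DifferentiableAt ℝ A y)
    {z z' : E} (hz : z ∈ C) (hz' : z' ∈ C) (h0 : ∀ y ∈ C, fderiv ℝ A y (z' - z) = 0) :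
    A z = A z' := by
  refine (SeparatingDual.eq_iff_forall_dual_eq (R := ℝ)).2 fun g => ?_
  obtain ⟨y, hy, h⟩ := domain_mvt (f := fun x => g (A x)) (f' := fun x => g.comp (fderiv ℝ A x))
    (fun x hx => (g.hasFDerivAt.comp x (hd x hx).hasFDerivAt).hasFDerivWithinAt) hC hz hz'
  have := h0 y (hC.segment_subset hz hz' hy)
  simp [this] at h
  linarith

/-- The inverse function theorem, with the targets of the local inverses at our disposal. -/
theorem exists_openPartialHomeomorph {E F : Type*} [NormedAddCommGroup E] [NormedSpace ℝ E]
    [NormedAddCommGroup F] [NormedSpace ℝ F] [FiniteDimensional ℝ E] [FiniteDimensional ℝ F]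
    (hdim : finrank ℝ E = finrank ℝ F) {f : E → F} {a : E}
    (h : ∀ᶠ p in 𝓝 a, ContDiffAt ℝ ∞ f p ∧ ∀ δ, fderiv ℝ f p δ = 0 → δ = 0)
    {O : Set E} (hO : O ∈ 𝓝 a) :
    ∃ O' ∈ 𝓝 a, O' ⊆ O ∧ ∃ ρ > 0, ∀ W : Set F, IsOpen W → W ⊆ ball (f a) ρ →
      ∃ e : OpenPartialHomeomorph E F, ⇑e = f ∧ e.target = W ∧ e.source = O' ∩ f ⁻¹' W ∧
        ContDiffOn ℝ ∞ f e.source ∧ ContDiffOn ℝ ∞ e.symm e.target := by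
  have : CompleteSpace E := FiniteDimensional.complete ℝ E
  have hequiv : ∀ p, (ContDiffAt ℝ ∞ f p ∧ ∀ δ, fderiv ℝ f p δ = 0 → δ = 0) →
      ∃ g : E ≃L[ℝ] F, HasFDerivAt f (g : E →L[ℝ] F) p := by
    intro p hp
    have hinj : Function.Injective (fderiv ℝ f p : E →ₗ[ℝ] F) := by
      rw [← LinearMap.ker_eq_bot, LinearMap.ker_eq_bot']
      exact hp.2
    refine ⟨((fderiv ℝ f p : E →ₗ[ℝ] F).linearEquivOfInjective hinj
      hdim).toContinuousLinearEquiv, ?_⟩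
    exact (hp.1.differentiableAt (by simp)).hasFDerivAt.congr_fderiv (by ext; rfl)
  obtain ⟨O₁, hO₁, hO₁o, haO₁⟩ := _root_.mem_nhds_iff.1 (Filter.inter_mem h hO)
  have hsm : ∀ p ∈ O₁, _ := fun p hp => (hO₁ hp).1
  obtain ⟨g, hg⟩ := hequiv a (hsm a haO₁)
  set e₀ := ((hsm a haO₁).1.toOpenPartialHomeomorph f hg (by simp)).restrOpen O₁ hO₁o with he₀
  have hcoe : ⇑e₀ = f := by simp [he₀]
  have hsrc : e₀.source ⊆ O₁ := by
    rw [he₀, OpenPartialHomeomorph.restrOpen_source]; exact Set.inter_subset_right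
  have ha : a ∈ e₀.source := by
    rw [he₀, OpenPartialHomeomorph.restrOpen_source]
    exact ⟨ContDiffAt.mem_toOpenPartialHomeomorph_source _ _ _, haO₁⟩
  have hfa : f a ∈ e₀.target := by
    have := e₀.map_source ha
    rwa [hcoe] at this
  obtain ⟨ρ, hρ, hball⟩ := Metric.isOpen_iff.1 e₀.open_target _ hfa
  refine ⟨e₀.source, e₀.open_source.mem_nhds ha, fun p hp => (hO₁ (hsrc hp)).2, ρ, hρ, ?_⟩
  intro W hW hWb
  -- Restricting the inverse instead of the map makes the target exactly W, so that it can be chosen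
  -- convex.
  have hT : (e₀.symm.restrOpen W hW).symm.target = W := by
    simp only [OpenPartialHomeomorph.symm_target, OpenPartialHomeomorph.restrOpen_source,
      OpenPartialHomeomorph.symm_source]
    exact Set.inter_eq_right.2 (hWb.trans hball)
  have hS : (e₀.symm.restrOpen W hW).symm.source = e₀.source ∩ f ⁻¹' W := by
    rw [← hcoe]
    ext p
    simp [OpenPartialHomeomorph.restrOpen]
  have hC : ⇑(e₀.symm.restrOpen W hW).symm = f := by
    rw [← hcoe]
    ext p
    simp [OpenPartialHomeomorph.restrOpen]
  refine ⟨(e₀.symm.restrOpen W hW).symm, hC, hT, hS, ?_, ?_⟩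
  · intro p hp
    rw [hS] at hp
    exact (hsm p (hsrc hp.1)).1.contDiffWithinAt
  · intro z hz
    have hp := (e₀.symm.restrOpen W hW).symm.map_target hz
    rw [hS] at hp
    obtain ⟨g', hg'⟩ := hequiv _ (hsm _ (hsrc hp.1))
    refine (OpenPartialHomeomorph.contDiffAt_symm _ hz (f₀' := g') ?_ ?_).contDiffWithinAt
    · rw [hC]; exact hg'
    · rw [hC]; exact (hsm _ (hsrc hp.1)).1

/-- The coordinate functions `Z` of a state transformation and the new inputs `V`, all regarded as
functions of the state and the input, at the point `p`. -/
structure FeedbackChartAt {S Z : Type} [NormedAddCommGroup S] [NormedSpace ℝ S]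
    [NormedAddCommGroup Z] [NormedSpace ℝ Z] (Zt : S × U → Z) (Vt : S × U → U) (p : S × U) :
    Prop where
  smooth_state : ContDiffAt ℝ ∞ Zt p
  smooth_input : ContDiffAt ℝ ∞ Vt p
  state_indep : ∀ δw : U, fderiv ℝ Zt p (0, δw) = 0
  state_inj : ∀ δs : S, fderiv ℝ Zt p (δs, 0) = 0 → δs = 0
  input_inj : ∀ δw : U, fderiv ℝ Vt p (0, δw) = 0 → δw = 0

/-- The differential of (Zt, Vt) is block triangular: Zt ignores input directions, so its vanishing
kills the state part, and Vt then kills the rest. -/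
theorem FeedbackChartAt.injective {S Z : Type} [NormedAddCommGroup S] [NormedSpace ℝ S]
    [NormedAddCommGroup Z] [NormedSpace ℝ Z] {Zt : S × U → Z} {Vt : S × U → U} {p : S × U}
    (h : FeedbackChartAt Zt Vt p) {δ : S × U} (hZ : fderiv ℝ Zt p δ = 0)
    (hV : fderiv ℝ Vt p δ = 0) : δ = 0 := by
  have hδ : δ = (δ.1, 0) + (0, δ.2) := by simp
  have h1 : δ.1 = 0 := by
    apply h.state_inj
    rw [hδ, map_add, h.state_indep, add_zero] at hZ
    exact hZ
  have h2 : δ.2 = 0 := by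
    apply h.input_inj
    rw [hδ, h1] at hV
    simpa using hV
  exact Prod.ext h1 h2

/-- Charts of the states and of the state-input pairs, with the given coordinate functions and with
balls as targets. -/
structure FeedbackCharts {S Z : Type} [NormedAddCommGroup S] [NormedSpace ℝ S]
    [NormedAddCommGroup Z] [NormedSpace ℝ Z] (Zt : S × U → Z) (Vt : S × U → U) (s₀ : S) (w₀ : U)
    (O : Set (S × U)) where
  Φ : OpenPartialHomeomorph S Z
  Ξ : OpenPartialHomeomorph (S × U) (Z × U)
  r : ℝ
  r_pos : 0 < r
  base_mem : (s₀, w₀) ∈ Ξ.source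
  source_sub : Ξ.source ⊆ O
  fst_mem : ∀ q ∈ Ξ.source, q.1 ∈ Φ.source
  Φ_fst : ∀ q ∈ Ξ.source, Φ q.1 = Zt q
  Ξ_eq : ⇑Ξ = fun q => (Zt q, Vt q)
  smooth_Φ : ContDiffOn ℝ ∞ Φ Φ.source
  smooth_Φ_symm : ContDiffOn ℝ ∞ Φ.symm Φ.target
  smooth_Ξ : ContDiffOn ℝ ∞ Ξ Ξ.source
  smooth_Ξ_symm : ContDiffOn ℝ ∞ Ξ.symm Ξ.target
  Φ_target : Φ.target = ball (Zt (s₀, w₀)) r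
  Ξ_target : Ξ.target = ball (Zt (s₀, w₀)) r ×ˢ ball (Vt (s₀, w₀)) r
  slice_mem : ∀ s ∈ Φ.source, (s, w₀) ∈ O
  Φ_eq : ⇑Φ = fun s => Zt (s, w₀)

/-- The state chart is the slice of Zt at the input w₀. On a product of balls Zt does not depend on
the input, by the mean value theorem, so the slice agrees with Zt there. A common radius makes both
targets balls or products of balls, hence convex. -/
theorem exists_feedbackCharts {S Z : Type} [NormedAddCommGroup S] [NormedSpace ℝ S]
    [NormedAddCommGroup Z] [NormedSpace ℝ Z] [FiniteDimensional ℝ S] [FiniteDimensional ℝ Z]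
    (hdim : finrank ℝ S = finrank ℝ Z) {Zt : S × U → Z} {Vt : S × U → U} {s₀ : S} {w₀ : U}
    (h : ∀ᶠ p in 𝓝 (s₀, w₀), FeedbackChartAt Zt Vt p) {O : Set (S × U)} (hO : O ∈ 𝓝 (s₀, w₀)) :
    Nonempty (FeedbackCharts Zt Vt s₀ w₀ O) := by
  have hcont : Continuous fun s : S => (s, w₀) := by fun_prop
  obtain ⟨ε, hε, hball⟩ := Metric.mem_nhds_iff.1 (Filter.inter_mem h hO)
  rw [← ball_prod_same] at hball
  have hZslice : ∀ p ∈ ball s₀ ε ×ˢ ball w₀ ε, Zt p = Zt (p.1, w₀) := by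
    intro p hp
    refine eq_of_fderiv_eq_zero_on_convex ((convex_ball s₀ ε).prod (convex_ball w₀ ε))
      (fun y hy => (hball hy).1.smooth_state.differentiableAt (by simp)) hp
      ⟨hp.1, mem_ball_self hε⟩ fun y hy => ?_
    have : (p.1, w₀) - p = (0, w₀ - p.2) := by ext <;> simp
    rw [this]
    exact (hball hy).1.state_indep _
  have hfd : ∀ p, FeedbackChartAt Zt Vt p → ∀ δs : S,
      fderiv ℝ (fun s => Zt (s, p.2)) p.1 δs = fderiv ℝ Zt p (δs, 0) := by
    intro p hp δs
    have h1 : HasFDerivAt (fun s : S => (s, p.2)) (ContinuousLinearMap.inl ℝ S U) p.1 :=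
      (hasFDerivAt_id p.1).prodMk (hasFDerivAt_const p.2 p.1)
    have h2 := (hp.smooth_state.differentiableAt (by simp)).hasFDerivAt
    have := (HasFDerivAt.comp (x := p.1) (g := Zt) (f := fun s : S => (s, p.2)) h2 h1).fderiv
    erw [this]; rfl
  have hΦ := exists_openPartialHomeomorph (f := fun s => Zt (s, w₀)) (a := s₀) hdim (O := ball s₀ ε)
    (by
      filter_upwards [hcont.continuousAt.eventually h] with s hs
      refine ⟨hs.smooth_state.comp s (by fun_prop), fun δ hδ => ?_⟩
      rw [hfd (s, w₀) hs] at hδ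
      exact hs.state_inj _ hδ) (ball_mem_nhds _ hε)
  obtain ⟨O₁, hO₁, hO₁s, ρ₁, hρ₁, hΦ⟩ := hΦ
  have hΞ := exists_openPartialHomeomorph (f := fun q => (Zt q, Vt q)) (a := (s₀, w₀))
    (by simp [hdim]) (O := (O₁ ∩ ball s₀ ε) ×ˢ ball w₀ ε)
    (by
      filter_upwards [h] with p hp
      refine ⟨hp.smooth_state.prodMk hp.smooth_input, fun δ hδ => ?_⟩
      rw [DifferentiableAt.fderiv_prodMk (hp.smooth_state.differentiableAt (by simp))
        (hp.smooth_input.differentiableAt (by simp))] at hδ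
      exact hp.injective (congrArg Prod.fst hδ) (congrArg Prod.snd hδ))
    (prod_mem_nhds (Filter.inter_mem hO₁ (ball_mem_nhds _ hε)) (ball_mem_nhds _ hε))
  obtain ⟨O₂, hO₂, hO₂s, ρ₂, hρ₂, hΞ⟩ := hΞ
  set r := min ρ₁ ρ₂ with hr
  have hr0 : 0 < r := lt_min hρ₁ hρ₂
  obtain ⟨Φ, hΦc, hΦt, hΦs, hΦ1, hΦ2⟩ := hΦ (ball (Zt (s₀, w₀)) r) isOpen_ball
    (ball_subset_ball (min_le_left _ _))
  obtain ⟨Ξ, hΞc, hΞt, hΞs, hΞ1, hΞ2⟩ := hΞ (ball (Zt (s₀, w₀)) r ×ˢ ball (Vt (s₀, w₀)) r)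
    (isOpen_ball.prod isOpen_ball) (by
      rw [ball_prod_same]
      exact ball_subset_ball (min_le_right _ _))
  have hbox : Ξ.source ⊆ (O₁ ∩ ball s₀ ε) ×ˢ ball w₀ ε := by
    rw [hΞs]; exact fun q hq => hO₂s hq.1
  have hslice : ∀ q ∈ Ξ.source, Zt (q.1, w₀) = Zt q := fun q hq =>
    (hZslice q ⟨(hbox hq).1.2, (hbox hq).2⟩).symm
  refine ⟨⟨Φ, Ξ, r, hr0, ?_, ?_, ?_, ?_, hΞc, hΦc ▸ hΦ1, hΦ2, hΞc ▸ hΞ1, hΞ2, hΦt, hΞt, ?_, hΦc⟩⟩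
  · rw [hΞs]
    exact ⟨mem_of_mem_nhds hO₂, mem_ball_self hr0, mem_ball_self hr0⟩
  · exact fun q hq => (hball ⟨(hbox hq).1.2, (hbox hq).2⟩).2
  · intro q hq
    rw [hΦs]
    refine ⟨(hbox hq).1.1, ?_⟩
    rw [hΞs] at hq
    simp only [Set.mem_preimage]
    rw [hslice q (by rw [hΞs]; exact hq)]
    exact hq.2.1
  · intro q hq
    rw [hΦc]
    exact hslice q hq
  · intro s hs
    rw [hΦs] at hs
    exact (hball ⟨hO₁s hs.1, mem_ball_self hε⟩).2


namespace FeedbackCharts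

variable {S Z : Type} [NormedAddCommGroup S] [NormedSpace ℝ S] [NormedAddCommGroup Z]
  [NormedSpace ℝ Z] {Zt : S × U → Z} {Vt : S × U → U} {s₀ : S} {w₀ : U} {O : Set (S × U)}
  (C : FeedbackCharts Zt Vt s₀ w₀ O)

theorem symm_mem {q : Z × U} (hq : q ∈ C.Ξ.target) : C.Ξ.symm q ∈ C.Ξ.source :=
  C.Ξ.map_target hq

theorem apply_symm {q : Z × U} (hq : q ∈ C.Ξ.target) :
    Zt (C.Ξ.symm q) = q.1 ∧ Vt (C.Ξ.symm q) = q.2 := by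
  have h := C.Ξ.right_inv hq
  rw [C.Ξ_eq] at h
  exact ⟨congrArg Prod.fst h, congrArg Prod.snd h⟩

theorem symm_smooth {q : Z × U} (hq : q ∈ C.Ξ.target) : ContDiffAt ℝ ∞ C.Ξ.symm q :=
  C.smooth_Ξ_symm.contDiffAt (C.Ξ.open_target.mem_nhds hq)

theorem convex_target : Convex ℝ C.Ξ.target := by
  rw [C.Ξ_target]; exact (convex_ball _ _).prod (convex_ball _ _)

theorem mem_slice {z : Z} (hz : z ∈ C.Φ.target) : (z, Vt (s₀, w₀)) ∈ C.Ξ.target := by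
  rw [C.Ξ_target]
  rw [C.Φ_target] at hz
  exact ⟨hz, mem_ball_self C.r_pos⟩

theorem fst_mem_target {q : Z × U} (hq : q ∈ C.Ξ.target) : q.1 ∈ C.Φ.target := by
  rw [C.Ξ_target] at hq
  rw [C.Φ_target]
  exact hq.1

theorem fderiv_symm {q : Z × U} (hq : q ∈ C.Ξ.target)
    (h : FeedbackChartAt Zt Vt (C.Ξ.symm q)) (ζ : Z × U) :
    fderiv ℝ Zt (C.Ξ.symm q) (fderiv ℝ C.Ξ.symm q ζ) = ζ.1 ∧
      fderiv ℝ Vt (C.Ξ.symm q) (fderiv ℝ C.Ξ.symm q ζ) = ζ.2 := by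
  have hs := ((C.symm_smooth hq).differentiableAt (by simp)).hasFDerivAt
  have hev : ∀ᶠ q' in 𝓝 q, q' ∈ C.Ξ.target := C.Ξ.open_target.mem_nhds hq
  constructor
  · have h1 := (h.smooth_state.differentiableAt (by simp)).hasFDerivAt.comp q hs
    have h2 : HasFDerivAt (Zt ∘ C.Ξ.symm) (ContinuousLinearMap.fst ℝ Z U) q :=
      hasFDerivAt_fst.congr_of_eventuallyEq (hev.mono fun q' hq' => (C.apply_symm hq').1)
    exact DFunLike.congr_fun (h1.unique h2) ζ
  · have h1 := (h.smooth_input.differentiableAt (by simp)).hasFDerivAt.comp q hs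
    have h2 : HasFDerivAt (Vt ∘ C.Ξ.symm) (ContinuousLinearMap.snd ℝ Z U) q :=
      hasFDerivAt_snd.congr_of_eventuallyEq (hev.mono fun q' hq' => (C.apply_symm hq').2)
    exact DFunLike.congr_fun (h1.unique h2) ζ

theorem fderiv_comp_symm {A : S × U → ℝ} {q : Z × U} (hq : q ∈ C.Ξ.target)
    (hA : DifferentiableAt ℝ A (C.Ξ.symm q)) (ζ : Z × U) :
    fderiv ℝ (fun q' => A (C.Ξ.symm q')) q ζ =
      fderiv ℝ A (C.Ξ.symm q) (fderiv ℝ C.Ξ.symm q ζ) := by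
  have hs := ((C.symm_smooth hq).differentiableAt (by simp)).hasFDerivAt
  exact DFunLike.congr_fun (hA.hasFDerivAt.comp q hs).fderiv ζ

theorem fderiv_slice {A : S × U → ℝ} {q : Z × U} (hq : q ∈ C.Ξ.target)
    (hA : DifferentiableAt ℝ A (C.Ξ.symm q)) (ζ : Z) :
    fderiv ℝ (fun z => A (C.Ξ.symm (z, q.2))) q.1 ζ =
      fderiv ℝ A (C.Ξ.symm q) (fderiv ℝ C.Ξ.symm q (ζ, 0)) := by
  have hs := ((C.symm_smooth hq).differentiableAt (by simp)).hasFDerivAt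
  have h1 : HasFDerivAt (fun z : Z => (z, q.2)) (ContinuousLinearMap.inl ℝ Z U) q.1 :=
    (hasFDerivAt_id q.1).prodMk (hasFDerivAt_const q.2 q.1)
  have h2 : HasFDerivAt (fun q' => A (C.Ξ.symm q')) _ q := hA.hasFDerivAt.comp q hs
  exact DFunLike.congr_fun (HasFDerivAt.comp (x := q.1) (f := fun z : Z => (z, q.2)) h2 h1).fderiv ζ

/-- A function of the states does not see the choice of the input. -/
theorem comp_symm_eq_slice {A : S × U → ℝ}
    (hC : ∀ p ∈ C.Ξ.source, FeedbackChartAt Zt Vt p)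
    (hA : ∀ p ∈ C.Ξ.source, ContDiffAt ℝ ∞ A p ∧ ∀ δw : U, fderiv ℝ A p (0, δw) = 0)
    {q : Z × U} (hq : q ∈ C.Ξ.target) :
    A (C.Ξ.symm q) = A (C.Ξ.symm (q.1, Vt (s₀, w₀))) := by
  have hd : ∀ y ∈ C.Ξ.target, DifferentiableAt ℝ A (C.Ξ.symm y) := fun y hy =>
    (hA _ (C.symm_mem hy)).1.differentiableAt (by simp)
  refine eq_of_fderiv_eq_zero_on_convex (A := fun q => A (C.Ξ.symm q)) C.convex_target
    (fun y hy => DifferentiableAt.comp y (hd y hy)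
      ((C.symm_smooth hy).differentiableAt (by simp)))
    hq (C.mem_slice (C.fst_mem_target hq)) fun y hy => ?_
  rw [C.fderiv_comp_symm hy (hd y hy)]
  set δ := fderiv ℝ C.Ξ.symm y ((q.1, Vt (s₀, w₀)) - q) with hδ
  have hch := hC _ (C.symm_mem hy)
  have h0 := (C.fderiv_symm hy hch ((q.1, Vt (s₀, w₀)) - q)).1
  rw [← hδ] at h0
  have hδ' : δ = (δ.1, 0) + (0, δ.2) := by simp
  have h1 : δ.1 = 0 := by
    apply hch.state_inj
    rw [hδ', map_add, hch.state_indep, add_zero] at h0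
    rw [h0]; simp
  rw [show δ = (0, δ.2) from Prod.ext h1 rfl]
  exact (hA _ (C.symm_mem hy)).2 _

end FeedbackCharts

/-! ### From infinitesimal conditions to the triangular form -/

/-- The tangent vector `ζ` has no components along `z₁`, `z₂^1, …, z₂^{l₂}`, `z₃^1, …, z₃^{l₃}`. -/
def GTFShape.Kills (I : GTFShape) (l₂ l₃ : ℤ) (ζ : I.State) : Prop :=
  ζ.1 = 0 ∧ (∀ l : ℕ, (l : ℤ) ≤ l₂ → coord ζ.2.1 l = 0) ∧
    ∀ l : ℕ, (l : ℤ) ≤ l₃ → coord ζ.2.2 l = 0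

theorem coord_sub {m : ℕ} (v w : Fin m → ℝ) (l : ℕ) : coord (v - w) l = coord v l - coord w l := by
  unfold coord; split_ifs <;> simp

/-- Coefficient functions of the triangular form, before they are expressed in its coordinates. -/
structure LiftedCoeff (E : Type) where
  a2 : ℕ → E → ℝ
  b21 : ℕ → E → ℝ
  a3 : ℕ → E → ℝ
  b31 : ℕ → E → ℝ
  b32 : ℕ → E → ℝ

/-- The values of the coefficients at `p`. -/
def LiftedCoeff.eval {E : Type} (c : LiftedCoeff E) (I : GTFShape) (p : E) : GTFCoeff I :=
  ⟨fun l _ => c.a2 l p, fun l _ => c.b21 l p, fun l _ => c.a3 l p, fun l _ => c.b31 l p,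
    fun l _ => c.b32 l p⟩

/-- At `p` the functions `Zt`, `Vt` and the coefficients satisfy, infinitesimally, the equations,
the dependencies and the regularity conditions of the triangular form; `X` is the velocity. -/
structure GTFRelationsAt {E : Type} [NormedAddCommGroup E] [NormedSpace ℝ E] (I : GTFShape)
    (Zt : E → I.State) (Vt : E → U) (c : LiftedCoeff E) (X p : E) : Prop where
  smooth_state : ContDiffAt ℝ ∞ Zt p
  smooth_input : ContDiffAt ℝ ∞ Vt p
  smooth2 : ∀ l, I.k2 ≤ l → l < I.p2 → ContDiffAt ℝ ∞ (c.a2 l) p ∧ ContDiffAt ℝ ∞ (c.b21 l) p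
  smooth3 : ∀ l, I.k3 ≤ l → l < I.r3 → ContDiffAt ℝ ∞ (c.a3 l) p ∧ ContDiffAt ℝ ∞ (c.b31 l) p
  smooth32 : ∀ l, I.p3 ≤ l → l < I.r3 → ContDiffAt ℝ ∞ (c.b32 l) p
  dynamics : fderiv ℝ Zt p X = gtfField (c.eval I p) (Zt p) (Vt p)
  dep2 : ∀ i : ℕ, I.k2 + i < I.p2 → ∀ δ, fderiv ℝ Vt p δ = 0 →
    I.Kills (I.k2 + i + 1) (I.k3 + I.δ + i + 1) (fderiv ℝ Zt p δ) →
    fderiv ℝ (c.a2 (I.k2 + i)) p δ = 0 ∧ fderiv ℝ (c.b21 (I.k2 + i)) p δ = 0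
  dep3 : ∀ i : ℕ, I.k3 + i < I.p3 → ∀ δ, fderiv ℝ Vt p δ = 0 →
    I.Kills (I.k2 - I.δ + i + 1) (I.k3 + i + 1) (fderiv ℝ Zt p δ) →
    fderiv ℝ (c.a3 (I.k3 + i)) p δ = 0 ∧ fderiv ℝ (c.b31 (I.k3 + i)) p δ = 0
  dep3' : ∀ l : ℕ, I.p3 ≤ l → l < I.r3 → ∀ δ, fderiv ℝ Vt p δ = 0 →
    I.Kills I.p2 (l + 1) (fderiv ℝ Zt p δ) →
    fderiv ℝ (c.a3 l) p δ = 0 ∧ fderiv ℝ (c.b31 l) p δ = 0 ∧ fderiv ℝ (c.b32 l) p δ = 0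
  b21_ne : I.k2 < I.p2 → c.b21 I.k2 p ≠ 0
  b31_ne : I.k3 < I.r3 → c.b31 I.k3 p ≠ 0
  reg1 : ∀ i : ℕ, i < I.δ → ∀ δ, fderiv ℝ Vt p δ = 0 →
    fderiv ℝ Zt p δ = (0, 0, unitVec I.r3 (I.k3 + i + 1)) →
    fderiv ℝ (fun p' => c.a3 (I.k3 + i) p' + c.b31 (I.k3 + i) p' * Vt p' 0) p δ ≠ 0
  reg2 : ∀ i : ℕ, I.k2 + i < I.p2 → ∀ δ, ∀ α β : ℝ, fderiv ℝ Vt p δ = 0 →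
    fderiv ℝ Zt p δ =
      (0, α • unitVec I.p2 (I.k2 + i + 1), β • unitVec I.r3 (I.k3 + I.δ + i + 1)) →
    fderiv ℝ (fun p' => c.a2 (I.k2 + i) p' + c.b21 (I.k2 + i) p' * Vt p' 0) p δ = 0 →
    fderiv ℝ (fun p' => c.a3 (I.k3 + I.δ + i) p' + c.b31 (I.k3 + I.δ + i) p' * Vt p' 0) p δ = 0 →
    α = 0 ∧ β = 0
  reg3 : ∀ l : ℕ, I.p3 ≤ l → l < I.r3 → ∀ δ, fderiv ℝ Vt p δ = 0 →
    fderiv ℝ Zt p δ = (0, 0, unitVec I.r3 (l + 1)) →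
    fderiv ℝ (fun p' => c.a3 l p' + c.b31 l p' * Vt p' 0 + c.b32 l p' * Vt p' 1) p δ ≠ 0

/-- At `p` the functions `Zt` and `Vt` satisfy, infinitesimally, all the requirements on the
coordinates of the triangular form. -/
structure GTFCoordsAt {S : Type} [NormedAddCommGroup S] [NormedSpace ℝ S] (G : S → U → S)
    (I : GTFShape) (Zt : S × U → I.State) (Vt : S × U → U) (c : LiftedCoeff (S × U)) (p : S × U) :
    Prop extends FeedbackChartAt Zt Vt p, GTFRelationsAt I Zt Vt c (G p.1 p.2, 0) p where
  indep2 : ∀ l, I.k2 ≤ l → l < I.p2 → ∀ δw : U,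
    fderiv ℝ (c.a2 l) p (0, δw) = 0 ∧ fderiv ℝ (c.b21 l) p (0, δw) = 0
  indep3 : ∀ l, I.k3 ≤ l → l < I.r3 → ∀ δw : U,
    fderiv ℝ (c.a3 l) p (0, δw) = 0 ∧ fderiv ℝ (c.b31 l) p (0, δw) = 0
  indep32 : ∀ l, I.p3 ≤ l → l < I.r3 → ∀ δw : U, fderiv ℝ (c.b32 l) p (0, δw) = 0

/-- The coefficients are written in the coordinates z by freezing the new input at its base value,
which is harmless because they do not depend on the input. Since the targets are convex, the
conditions on kernels of differentials integrate to genuine dependencies. The dimension count is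
what the inverse function theorem needs. -/
theorem isSFEToGTF3_of_coords {S : Type} [NormedAddCommGroup S] [NormedSpace ℝ S]
    [FiniteDimensional ℝ S] {G : S → U → S} {I : GTFShape} {Zt : S × U → I.State}
    {Vt : S × U → U} {c : LiftedCoeff (S × U)} {s₀ : S} {w₀ : U} {h : Fin 3 → S → ℝ}
    (hdim : finrank ℝ S = I.k1 + I.p2 + I.r3)
    (hcoords : ∀ᶠ p in 𝓝 (s₀, w₀), GTFCoordsAt G I Zt Vt c p) (σ : Equiv.Perm (Fin 3))
    (hout : ∀ᶠ p in 𝓝 (s₀, w₀), coord (Zt p).1 1 = h (σ 0) p.1 ∧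
      coord (Zt p).2.1 1 = h (σ 1) p.1 ∧ coord (Zt p).2.2 1 = h (σ 2) p.1) :
    IsSFEToGTF3 G s₀ w₀ h := by
  have hdim' : finrank ℝ S = finrank ℝ I.State := by
    rw [hdim]; simp [GTFShape.State, add_assoc]
  obtain ⟨C⟩ := exists_feedbackCharts hdim' (hcoords.mono fun p hp => hp.toFeedbackChartAt)
    (Filter.inter_mem hcoords hout)
  have hco : ∀ p ∈ C.Ξ.source, GTFCoordsAt G I Zt Vt c p := fun p hp => (C.source_sub hp).1
  have hch : ∀ p ∈ C.Ξ.source, FeedbackChartAt Zt Vt p := fun p hp => (hco p hp).toFeedbackChartAt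
  set v' := Vt (s₀, w₀) with hv'
  set lift : I.State → S × U := fun z => C.Ξ.symm (z, v') with hlift
  have hliftmem : ∀ z ∈ C.Φ.target, lift z ∈ C.Ξ.source := fun z hz => C.symm_mem (C.mem_slice hz)
  let c' : GTFCoeff I := ⟨fun l z => c.a2 l (lift z), fun l z => c.b21 l (lift z),
    fun l z => c.a3 l (lift z), fun l z => c.b31 l (lift z), fun l z => c.b32 l (lift z)⟩
  -- transfer of a function of the states
  have hslice : ∀ A : S × U → ℝ,
      (∀ p ∈ C.Ξ.source, ContDiffAt ℝ ∞ A p ∧ ∀ δw : U, fderiv ℝ A p (0, δw) = 0) →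
      ∀ q ∈ C.Ξ.target, A (C.Ξ.symm q) = A (lift q.1) := fun A hA q hq =>
    C.comp_symm_eq_slice hch hA hq
  have hsmooth : ∀ A : S × U → ℝ, (∀ p ∈ C.Ξ.source, ContDiffAt ℝ ∞ A p) →
      ContDiffOn ℝ ∞ (fun z => A (lift z)) C.Φ.target := by
    intro A hA z hz
    refine ContDiffAt.contDiffWithinAt ?_
    have h1 : ContDiffAt ℝ ∞ lift z :=
      (C.symm_smooth (C.mem_slice hz)).comp z (contDiffAt_id.prodMk contDiffAt_const)
    exact (hA _ (hliftmem z hz)).comp z h1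
  -- Two states that agree in the listed coordinates are joined by a segment whose direction has no
  -- component along them and along the new inputs; A is constant on it.
  have hdep : ∀ (A : S × U → ℝ) (l₂ l₃ : ℤ), (∀ p ∈ C.Ξ.source, ContDiffAt ℝ ∞ A p) →
      (∀ p ∈ C.Ξ.source, ∀ δ, fderiv ℝ Vt p δ = 0 → I.Kills l₂ l₃ (fderiv ℝ Zt p δ) →
        fderiv ℝ A p δ = 0) → I.DependsOn C.Φ.target l₂ l₃ (fun z => A (lift z)) := by
    intro A l₂ l₃ hA hk z hz z' hz' h1 h2 h3
    have hd : ∀ y ∈ C.Ξ.target, DifferentiableAt ℝ A (C.Ξ.symm y) := fun y hy =>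
      (hA _ (C.symm_mem hy)).differentiableAt (by simp)
    refine eq_of_fderiv_eq_zero_on_convex (A := fun q => A (C.Ξ.symm q)) C.convex_target
      (fun y hy => DifferentiableAt.comp y (hd y hy)
        ((C.symm_smooth hy).differentiableAt (by simp)))
      (C.mem_slice hz) (C.mem_slice hz') fun y hy => ?_
    rw [C.fderiv_comp_symm hy (hd y hy)]
    have hf := C.fderiv_symm hy (hch _ (C.symm_mem hy)) ((z', v') - (z, v'))
    refine hk _ (C.symm_mem hy) _ (by rw [hf.2]; simp) ?_
    rw [hf.1]
    refine ⟨by simp [h1], fun l hl => ?_, fun l hl => ?_⟩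
    · simp only [Prod.fst_sub, Prod.snd_sub, coord_sub, h2 l hl, sub_self]
    · simp only [Prod.fst_sub, Prod.snd_sub, coord_sub, h3 l hl, sub_self]
  have hfield : ∀ p ∈ C.Ξ.source,
      gtfField (c.eval I p) (Zt p) (Vt p) = gtfField c' (Zt p) (Vt p) := by
    intro p hp
    have hpt : (Zt p, Vt p) ∈ C.Ξ.target := by
      have := C.Ξ.map_source hp; rwa [C.Ξ_eq] at this
    have hps : C.Ξ.symm (Zt p, Vt p) = p := by
      have := C.Ξ.left_inv hp; rwa [C.Ξ_eq] at this
    have key : ∀ A : S × U → ℝ,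
        (∀ p ∈ C.Ξ.source, ContDiffAt ℝ ∞ A p ∧ ∀ δw : U, fderiv ℝ A p (0, δw) = 0) →
        A p = A (lift (Zt p)) := by
      intro A hA
      have := hslice A hA _ hpt
      rwa [hps] at this
    have k2 : ∀ l, I.k2 ≤ l → l < I.p2 →
        c.a2 l p = c.a2 l (lift (Zt p)) ∧ c.b21 l p = c.b21 l (lift (Zt p)) := fun l h1 h2 =>
      ⟨key _ fun p hp => ⟨((hco p hp).smooth2 l h1 h2).1, fun w => ((hco p hp).indep2 l h1 h2 w).1⟩,
       key _ fun p hp => ⟨((hco p hp).smooth2 l h1 h2).2, fun w => ((hco p hp).indep2 l h1 h2 w).2⟩⟩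
    have k3 : ∀ l, I.k3 ≤ l → l < I.r3 →
        c.a3 l p = c.a3 l (lift (Zt p)) ∧ c.b31 l p = c.b31 l (lift (Zt p)) := fun l h1 h2 =>
      ⟨key _ fun p hp => ⟨((hco p hp).smooth3 l h1 h2).1, fun w => ((hco p hp).indep3 l h1 h2 w).1⟩,
       key _ fun p hp => ⟨((hco p hp).smooth3 l h1 h2).2, fun w => ((hco p hp).indep3 l h1 h2 w).2⟩⟩
    have k32 : ∀ l, I.p3 ≤ l → l < I.r3 → c.b32 l p = c.b32 l (lift (Zt p)) := fun l h1 h2 =>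
      key _ fun p hp => ⟨(hco p hp).smooth32 l h1 h2, (hco p hp).indep32 l h1 h2⟩
    have hp3 := I.p3_le_r3
    have hp3' := I.p3_sub_k3
    have hk2p2 := I.k2_le_p2
    simp only [gtfField, LiftedCoeff.eval, c']
    refine Prod.ext rfl (Prod.ext ?_ ?_) <;> funext i <;> dsimp only
    · split_ifs with h1 h2
      · rfl
      · rw [(k2 _ (not_lt.1 h1) h2).1, (k2 _ (not_lt.1 h1) h2).2]
      · rfl
    · split_ifs with h1 h2 h3
      · rfl
      · rw [(k3 _ (not_lt.1 h1) (h2.trans_le hp3)).1, (k3 _ (not_lt.1 h1) (h2.trans_le hp3)).2]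
      · rw [(k3 _ (not_lt.1 h1) h3).1, (k3 _ (not_lt.1 h1) h3).2, k32 _ (not_lt.1 h2) h3]
      · rfl
  have hdyn : ∀ q ∈ C.Ξ.source, fderiv ℝ C.Φ q.1 (G q.1 q.2) = gtfField c' (C.Φ q.1) (C.Ξ q).2 := by
    intro q hq
    rw [C.Φ_fst q hq, C.Ξ_eq, ← hfield q hq, ← (hco q hq).dynamics]
    have h1 : HasFDerivAt (fun s : S => (s, q.2)) (ContinuousLinearMap.inl ℝ S U) q.1 :=
      (hasFDerivAt_id q.1).prodMk (hasFDerivAt_const q.2 q.1)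
    have h2 := ((hco q hq).smooth_state.differentiableAt (by simp)).hasFDerivAt
    have h3 := HasFDerivAt.comp (x := q.1) (g := Zt) (f := fun s : S => (s, q.2)) h2 h1
    have h4 : (C.Φ : S → I.State) =ᶠ[𝓝 q.1] Zt ∘ fun s : S => (s, q.2) := by
      have hc : Continuous fun s : S => (s, q.2) := by fun_prop
      filter_upwards [hc.continuousAt.preimage_mem_nhds (C.Ξ.open_source.mem_nhds hq)] with s hs
      exact C.Φ_fst _ hs
    rw [(h3.congr_of_eventuallyEq h4).fderiv]
    rfl
  -- partial derivatives
  have hpd : ∀ (H : S × U → ℝ) (K : I.State → ℝ) (q : I.State × U), q ∈ C.Ξ.target →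
      (∀ p ∈ C.Ξ.source, ContDiffAt ℝ ∞ H p) →
      (∀ z, (z, q.2) ∈ C.Ξ.target → K z = H (C.Ξ.symm (z, q.2))) → ∀ ζ,
      fderiv ℝ K q.1 ζ = fderiv ℝ H (C.Ξ.symm q) (fderiv ℝ C.Ξ.symm q (ζ, 0)) := by
    intro H K q hq hH hK ζ
    rw [← C.fderiv_slice hq ((hH _ (C.symm_mem hq)).differentiableAt (by simp))]
    have hc : Continuous fun z : I.State => (z, q.2) := by fun_prop
    have : K =ᶠ[𝓝 q.1] fun z => H (C.Ξ.symm (z, q.2)) := by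
      filter_upwards [hc.continuousAt.preimage_mem_nhds (C.Ξ.open_target.mem_nhds hq)] with z hz
      exact hK z hz
    rw [this.fderiv_eq]
  have hsmV : ∀ (j : Fin 3), ∀ p ∈ C.Ξ.source, ContDiffAt ℝ ∞ (fun p => Vt p j) p := fun j p hp =>
    contDiffAt_pi.1 (hco p hp).smooth_input j
  have row2 : ∀ l, I.k2 ≤ l → l < I.p2 → ∀ q ∈ C.Ξ.target, ∀ ζ,
      fderiv ℝ (fun z => c'.a2 l z + c'.b21 l z * q.2 0) q.1 ζ =
        fderiv ℝ (fun p' => c.a2 l p' + c.b21 l p' * Vt p' 0) (C.Ξ.symm q)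
          (fderiv ℝ C.Ξ.symm q (ζ, 0)) := by
    intro l h1 h2 q hq ζ
    refine hpd _ _ q hq (fun p hp => ?_) (fun z hz => ?_) ζ
    · exact ((hco p hp).smooth2 l h1 h2).1.add (((hco p hp).smooth2 l h1 h2).2.mul (hsmV 0 p hp))
    · rw [(C.apply_symm hz).2,
        hslice (c.a2 l) (fun p hp => ⟨((hco p hp).smooth2 l h1 h2).1,
          fun w => ((hco p hp).indep2 l h1 h2 w).1⟩) _ hz,
        hslice (c.b21 l) (fun p hp => ⟨((hco p hp).smooth2 l h1 h2).2,
          fun w => ((hco p hp).indep2 l h1 h2 w).2⟩) _ hz]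
  have sl3 : ∀ l, I.k3 ≤ l → l < I.r3 → ∀ q ∈ C.Ξ.target,
      c.a3 l (C.Ξ.symm q) = c'.a3 l q.1 ∧ c.b31 l (C.Ξ.symm q) = c'.b31 l q.1 := by
    intro l h1 h2 q hq
    exact ⟨hslice (c.a3 l) (fun p hp => ⟨((hco p hp).smooth3 l h1 h2).1,
          fun w => ((hco p hp).indep3 l h1 h2 w).1⟩) _ hq,
        hslice (c.b31 l) (fun p hp => ⟨((hco p hp).smooth3 l h1 h2).2,
          fun w => ((hco p hp).indep3 l h1 h2 w).2⟩) _ hq⟩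
  have row3 : ∀ l, I.k3 ≤ l → l < I.r3 → ∀ q ∈ C.Ξ.target, ∀ ζ,
      fderiv ℝ (fun z => c'.a3 l z + c'.b31 l z * q.2 0) q.1 ζ =
        fderiv ℝ (fun p' => c.a3 l p' + c.b31 l p' * Vt p' 0) (C.Ξ.symm q)
          (fderiv ℝ C.Ξ.symm q (ζ, 0)) := by
    intro l h1 h2 q hq ζ
    refine hpd _ _ q hq (fun p hp => ?_) (fun z hz => ?_) ζ
    · exact ((hco p hp).smooth3 l h1 h2).1.add (((hco p hp).smooth3 l h1 h2).2.mul (hsmV 0 p hp))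
    · rw [(C.apply_symm hz).2, (sl3 l h1 h2 _ hz).1, (sl3 l h1 h2 _ hz).2]
  have hp3 := I.p3_le_r3
  have hp3' := I.p3_sub_k3
  have hk2p2 := I.k2_le_p2
  have hGTF : IsGTF3 c' C.Φ.target C.Ξ.target :=
    { smooth2 := fun l h1 h2 => ⟨hsmooth _ fun p hp => ((hco p hp).smooth2 l h1 h2).1,
        hsmooth _ fun p hp => ((hco p hp).smooth2 l h1 h2).2⟩
      smooth3 := fun l h1 h2 => ⟨hsmooth _ fun p hp => ((hco p hp).smooth3 l h1 h2).1,
        hsmooth _ fun p hp => ((hco p hp).smooth3 l h1 h2).2⟩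
      smooth32 := fun l h1 h2 => hsmooth _ fun p hp => (hco p hp).smooth32 l h1 h2
      dep2 := fun i hi =>
        ⟨hdep _ _ _ (fun p hp => ((hco p hp).smooth2 _ (by omega) hi).1)
          (fun p hp δ h1 h2 => ((hco p hp).dep2 i hi δ h1 h2).1),
        hdep _ _ _ (fun p hp => ((hco p hp).smooth2 _ (by omega) hi).2)
          (fun p hp δ h1 h2 => ((hco p hp).dep2 i hi δ h1 h2).2)⟩
      dep3 := fun i hi =>
        ⟨hdep _ _ _ (fun p hp => ((hco p hp).smooth3 _ (by omega) (by omega)).1)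
          (fun p hp δ h1 h2 => ((hco p hp).dep3 i hi δ h1 h2).1),
        hdep _ _ _ (fun p hp => ((hco p hp).smooth3 _ (by omega) (by omega)).2)
          (fun p hp δ h1 h2 => ((hco p hp).dep3 i hi δ h1 h2).2)⟩
      dep3' := fun l hl hl' =>
        ⟨hdep _ _ _ (fun p hp => ((hco p hp).smooth3 _ (by omega) (by omega)).1)
          (fun p hp δ h1 h2 => ((hco p hp).dep3' l hl hl' δ h1 h2).1),
        hdep _ _ _ (fun p hp => ((hco p hp).smooth3 _ (by omega) (by omega)).2)
          (fun p hp δ h1 h2 => ((hco p hp).dep3' l hl hl' δ h1 h2).2.1),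
        hdep _ _ _ (fun p hp => (hco p hp).smooth32 _ (by omega) (by omega))
          (fun p hp δ h1 h2 => ((hco p hp).dep3' l hl hl' δ h1 h2).2.2)⟩
      b21_ne := fun hk z hz => (hco _ (hliftmem z hz)).b21_ne hk
      b31_ne := fun hk z hz => (hco _ (hliftmem z hz)).b31_ne hk
      reg1 := fun i hi q hq => by
        have hf := C.fderiv_symm hq (hch _ (C.symm_mem hq)) ((0, 0, unitVec I.r3 (I.k3 + i + 1)), 0)
        rw [GTFShape.pd3, row3 _ (by omega) (by omega) q hq]
        exact (hco _ (C.symm_mem hq)).reg1 i hi _ hf.2 hf.1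
      reg2 := fun i hi q hq => by
        simp only [GTFShape.pd2, GTFShape.pd3]
        rw [row3 _ (by omega) (by omega) q hq, row3 _ (by omega) (by omega) q hq,
          row2 _ (by omega) (by omega) q hq, row2 _ (by omega) (by omega) q hq]
        -- A kernel vector of the matrix is a direction along the two coordinates in which both rows
        -- are stationary; the infinitesimal form of the condition makes it zero.
        rw [Ne, ← Matrix.exists_mulVec_eq_zero_iff]
        rintro ⟨x, hx0, hx⟩
        set D := fderiv ℝ C.Ξ.symm q
        have hlin : ∀ L : S × U →L[ℝ] ℝ, L (D ((0, x 0 • unitVec I.p2 (I.k2 + i + 1),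
            x 1 • unitVec I.r3 (I.k3 + I.δ + i + 1)), 0)) =
            L (D ((0, unitVec I.p2 (I.k2 + i + 1), 0), 0)) * x 0 +
            L (D ((0, 0, unitVec I.r3 (I.k3 + I.δ + i + 1)), 0)) * x 1 := by
          intro L
          have : (((0, x 0 • unitVec I.p2 (I.k2 + i + 1),
            x 1 • unitVec I.r3 (I.k3 + I.δ + i + 1)), 0) : I.State × U) =
            x 0 • ((0, unitVec I.p2 (I.k2 + i + 1), 0), 0) +
            x 1 • ((0, 0, unitVec I.r3 (I.k3 + I.δ + i + 1)), 0) := by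
            simp
          rw [this, map_add, map_smul, map_smul, map_add, map_smul, map_smul]
          simp [mul_comm]
        have hf := C.fderiv_symm hq (hch _ (C.symm_mem hq)) ((0, x 0 • unitVec I.p2 (I.k2 + i + 1),
            x 1 • unitVec I.r3 (I.k3 + I.δ + i + 1)), 0)
        have := (hco _ (C.symm_mem hq)).reg2 i hi _ (x 0) (x 1) hf.2 hf.1
          (by rw [hlin]
              have := congrFun hx 0
              simpa [Matrix.mulVec, dotProduct, Fin.sum_univ_two] using this)
          (by rw [hlin]
              have := congrFun hx 1
              simpa [Matrix.mulVec, dotProduct, Fin.sum_univ_two] using this)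
        apply hx0
        ext j; fin_cases j
        · exact this.1
        · exact this.2
      reg3 := fun l h1 h2 q hq => by
        have hf := C.fderiv_symm hq (hch _ (C.symm_mem hq)) ((0, 0, unitVec I.r3 (l + 1)), 0)
        rw [GTFShape.pd3]
        rw [hpd (fun p' => c.a3 l p' + c.b31 l p' * Vt p' 0 + c.b32 l p' * Vt p' 1) _ q hq
          (fun p hp => ?_) (fun z hz => ?_)]
        · exact (hco _ (C.symm_mem hq)).reg3 l h1 h2 _ hf.2 hf.1
        · have h3 := (hco p hp).smooth3 l (by omega) h2
          exact (h3.1.add (h3.2.mul (hsmV 0 p hp))).add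
            (((hco p hp).smooth32 l h1 h2).mul (hsmV 1 p hp))
        · rw [(C.apply_symm hz).2, (sl3 l (by omega) h2 _ hz).1, (sl3 l (by omega) h2 _ hz).2,
            hslice (c.b32 l) (fun p hp => ⟨(hco p hp).smooth32 l h1 h2,
              (hco p hp).indep32 l h1 h2⟩) _ hz] }
  refine ⟨I, c', ⟨C.Φ, C.Ξ, C.base_mem, C.fst_mem, fun q hq => ?_, C.smooth_Φ, C.smooth_Φ_symm,
    C.smooth_Ξ, C.smooth_Ξ_symm, hdyn⟩, σ, hGTF, fun s hs => ?_⟩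
  · rw [C.Φ_fst q hq, C.Ξ_eq]
  · simp only [C.Φ_eq]
    exact (C.slice_mem s hs).2


/-! ### Functions on the extended state-input manifold -/

/-- `h` is smooth at all points near `p`. -/
def SmoothNear {E F : Type*} [NormedAddCommGroup E] [NormedSpace ℝ E] [NormedAddCommGroup F]
    [NormedSpace ℝ F] (h : E → F) (p : E) : Prop := ∀ᶠ q in 𝓝 p, ContDiffAt ℝ ∞ h q

/-- The coordinate `uⁱ_[α]` as a linear functional; it vanishes for `α ≥ N`. -/
def inputFun (n N : ℕ) (i : Fin 3) (α : ℕ) : Jet n N →L[ℝ] ℝ :=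
  if h : α < N then
    (ContinuousLinearMap.proj ⟨α, h⟩ : (Fin N → ℝ) →L[ℝ] ℝ).comp
      ((ContinuousLinearMap.proj i : ((i : Fin 3) → Fin N → ℝ) →L[ℝ] (Fin N → ℝ)).comp
        (ContinuousLinearMap.snd ℝ (Fin n → ℝ) ((i : Fin 3) → Fin N → ℝ)))
  else 0

theorem inputFun_apply {n N : ℕ} (i : Fin 3) (α : ℕ) (q : Jet n N) :
    inputFun n N i α q = inputCoord q 0 i α := by
  unfold inputFun inputCoord; split_ifs <;> simp

theorem inputFun_of_lt {n N : ℕ} (i : Fin 3) {α : ℕ} (h : α < N) (q : Jet n N) :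
    inputFun n N i α q = q.2 i ⟨α, h⟩ := by
  simp [inputFun_apply, inputCoord, h]

theorem inputFun_of_ge {n N : ℕ} (i : Fin 3) {α : ℕ} (h : N ≤ α) (q : Jet n N) :
    inputFun n N i α q = 0 := by
  simp [inputFun_apply, inputCoord, not_lt.2 h]

/-- The vector `∂/∂uⁱ_[α]`; it vanishes for `α ≥ N`. -/
def inputVec (n N : ℕ) (i : Fin 3) (α : ℕ) : Jet n N :=
  (0, fun i' β => if i' = i ∧ β.1 = α then 1 else 0)

theorem inputFun_inputVec {n N : ℕ} (i i' : Fin 3) {α : ℕ} (hα : α < N) (β : ℕ) :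
    inputFun n N i' β (inputVec n N i α) = if i' = i ∧ β = α then 1 else 0 := by
  by_cases h : β < N
  · simp [inputFun_of_lt _ h, inputVec]
  · rw [inputFun_of_ge _ (not_lt.1 h), if_neg]
    rintro ⟨-, rfl⟩; exact h hα

theorem inputVec_of_ge {n N : ℕ} (i : Fin 3) {α : ℕ} (hα : N ≤ α) : inputVec n N i α = 0 := by
  ext i' β
  · rfl
  · simp only [inputVec]
    rw [if_neg]; · rfl
    rintro ⟨-, h⟩; have := β.2; omega

theorem jet_eq_sum {n N : ℕ} (δ : Jet n N) :
    δ = (δ.1, 0) + ∑ i, ∑ α ∈ Finset.range N, inputFun n N i α δ • inputVec n N i α := by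
  refine Prod.ext ?_ ?_
  · simp [Prod.fst_sum, inputVec]
  · funext i β
    simp only [Prod.snd_add, Prod.snd_sum, Pi.add_apply, Finset.sum_apply]
    rw [Finset.sum_eq_single i, Finset.sum_eq_single β.1]
    · simp [inputVec, inputFun_of_lt i β.2]
    · intro b _ hb; simp [inputVec, Ne.symm hb]
    · intro hb; exact absurd (Finset.mem_range.2 β.2) hb
    · intro b _ hb; exact Finset.sum_eq_zero fun a _ => by simp [inputVec, Ne.symm hb]
    · simp

/-- A covector that vanishes on `∂/∂uⁱ_[α]` for `α ≥ bⁱ` sees only `x` and `uⁱ_[α]`, `α < bⁱ`. -/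
theorem apply_eq_zero_of_kills {n N : ℕ} {G : Type*} [NormedAddCommGroup G] [NormedSpace ℝ G]
    (L : Jet n N →L[ℝ] G) (b : Fin 3 → ℕ) (δ : Jet n N)
    (hL : ∀ i α, b i ≤ α → L (inputVec n N i α) = 0) (hx : δ.1 = 0)
    (hu : ∀ i α, α < b i → inputFun n N i α δ = 0) : L δ = 0 := by
  rw [jet_eq_sum δ, hx]
  have : ((0, 0) : Jet n N) = 0 := rfl
  rw [this, zero_add, map_sum]
  refine Finset.sum_eq_zero fun i _ => ?_
  rw [map_sum]
  refine Finset.sum_eq_zero fun α _ => ?_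
  rw [map_smul]
  rcases lt_or_ge α (b i) with h | h
  · rw [hu i α h, zero_smul]
  · rw [hL i α h, smul_zero]

/-- The leading terms of a covector. -/
theorem apply_eq_leading {n N : ℕ} (L : Jet n N →L[ℝ] ℝ) (b : Fin 3 → ℕ) (δ : Jet n N)
    (hL : ∀ i α, b i < α → L (inputVec n N i α) = 0) (hx : δ.1 = 0)
    (hu : ∀ i α, α < b i → inputFun n N i α δ = 0) :
    L δ = ∑ i, L (inputVec n N i (b i)) * inputFun n N i (b i) δ := by
  -- Without its components of order b i, the vector is one on which L vanishes: lower components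
  -- are absent and higher ones are not seen by L.
  set δ' : Jet n N := δ - ∑ i, inputFun n N i (b i) δ • inputVec n N i (b i) with hδ'
  have h0 : L δ' = 0 := by
    refine apply_eq_zero_of_kills L (fun i => b i + 1) δ' (fun i α h => hL i α h) ?_ ?_
    · simp [hδ', hx, Prod.fst_sum, inputVec]
    · intro i α hα
      rw [hδ', map_sub, map_sum, Finset.sum_eq_single i]
      · rw [map_smul, smul_eq_mul]
        rcases lt_or_eq_of_le (Nat.lt_succ_iff.1 hα) with h | rfl
        · rw [hu i α h]
          rcases lt_or_ge (b i) N with h' | h'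
          · rw [inputFun_inputVec _ _ h', if_neg (by omega)]; simp
          · rw [inputVec_of_ge _ h']; simp
        · rcases lt_or_ge (b i) N with h' | h'
          · rw [inputFun_inputVec _ _ h', if_pos ⟨rfl, rfl⟩]; simp
          · simp [inputFun_of_ge _ h']
      · intro i' _ hi'
        rw [map_smul]
        rcases lt_or_ge (b i') N with h' | h'
        · rw [inputFun_inputVec _ _ h', if_neg (by tauto)]; simp
        · rw [inputVec_of_ge _ h']; simp
      · simp
  rw [hδ', map_sub, sub_eq_zero, map_sum] at h0
  rw [h0]
  exact Finset.sum_congr rfl fun i _ => by rw [map_smul, smul_eq_mul, mul_comm]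

/-- The right-hand side is smooth at the points over a neighborhood of `q₀`. -/
def SmoothSystemNear {n N : ℕ} (F : (Fin n → ℝ) → U → (Fin n → ℝ)) (q₀ : Jet n N) : Prop :=
  ∀ᶠ q in 𝓝 q₀, ContDiffAt ℝ ∞ (fun p : (Fin n → ℝ) × U => F p.1 p.2)
    (q.1, fun i => inputFun n N i 0 q)

/-- The Lie derivative along the field of the extended system. -/
def tau {n N : ℕ} (F : (Fin n → ℝ) → U → (Fin n → ℝ)) (h : Jet n N → ℝ) : Jet n N → ℝ :=
  fun q => fderiv ℝ h q (jetField F N q)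

theorem timeDeriv_succ {n N : ℕ} (F : (Fin n → ℝ) → U → (Fin n → ℝ)) (h : Jet n N → ℝ) (α : ℕ) :
    timeDeriv F h (α + 1) = tau F (timeDeriv F h α) := by
  simp only [timeDeriv, Function.iterate_succ_apply']; rfl

theorem outDeriv_succ {n N : ℕ} (F : (Fin n → ℝ) → U → (Fin n → ℝ)) (φ : Fin 3 → (Fin n → ℝ) → ℝ)
    (j : Fin 3) (m : ℕ) : outDeriv F φ N j (m + 1) = tau F (outDeriv F φ N j m) :=
  timeDeriv_succ F _ m

theorem outDeriv_zero {n N : ℕ} (F : (Fin n → ℝ) → U → (Fin n → ℝ)) (φ : Fin 3 → (Fin n → ℝ) → ℝ)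
    (j : Fin 3) : outDeriv F φ N j 0 = fun q => φ j q.1 := rfl

/-- The linear part `uⁱ_[α] ↦ uⁱ_[α+1]` of the field. -/
def shiftMap (n N : ℕ) : Jet n N →L[ℝ] ((i : Fin 3) → Fin N → ℝ) :=
  ContinuousLinearMap.pi fun i => ContinuousLinearMap.pi fun α => inputFun n N i (α.1 + 1)

/-- The values `(x, u)` at a point of the extended manifold. -/
def baseMap (n N : ℕ) : Jet n N →L[ℝ] (Fin n → ℝ) × U :=
  (ContinuousLinearMap.fst ℝ _ _).prod (ContinuousLinearMap.pi fun i => inputFun n N i 0)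

theorem baseMap_apply {n N : ℕ} (q : Jet n N) :
    baseMap n N q = (q.1, fun i => inputFun n N i 0 q) := rfl

theorem jetField_eq {n N : ℕ} (F : (Fin n → ℝ) → U → (Fin n → ℝ)) :
    jetField F N = fun q =>
      ((fun p : (Fin n → ℝ) × U => F p.1 p.2) (baseMap n N q), shiftMap n N q) := by
  funext q
  refine Prod.ext ?_ ?_
  · simp only [jetField, prolong, baseMap_apply, inputFun_apply]
  · funext i α
    simp only [jetField, prolong, shiftMap, ContinuousLinearMap.pi_apply, inputFun_apply]

theorem SmoothSystemNear.jetField {n N : ℕ} {F : (Fin n → ℝ) → U → (Fin n → ℝ)} {q₀ : Jet n N}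
    (hF : SmoothSystemNear F q₀) : SmoothNear (jetField F N) q₀ := by
  filter_upwards [hF] with q hq
  rw [jetField_eq]
  refine ContDiffAt.prodMk ?_ (shiftMap n N).contDiff.contDiffAt
  exact ContDiffAt.comp q hq (baseMap n N).contDiff.contDiffAt

/-- This is the commutator of ∂/∂uⁱ_[α+1] with the field, from which all leading coefficients are
computed. The bound α + 1 < N is needed because the field is truncated: for α + 1 = N the vector on
the left is zero while ∂/∂uⁱ_[α] is not. -/
theorem fderiv_jetField_inputVec {n N : ℕ} {F : (Fin n → ℝ) → U → (Fin n → ℝ)} {q : Jet n N}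
    (hq : ContDiffAt ℝ ∞ (fun p : (Fin n → ℝ) × U => F p.1 p.2)
      (q.1, fun i => inputFun n N i 0 q)) (i : Fin 3) {α : ℕ} (hα : α + 1 < N) :
    fderiv ℝ (jetField F N) q (inputVec n N i (α + 1)) = inputVec n N i α := by
  have h1 : HasFDerivAt (fun p : (Fin n → ℝ) × U => F p.1 p.2) _ (baseMap n N q) :=
    (hq.differentiableAt (by simp)).hasFDerivAt
  have h2 := (h1.comp q (baseMap n N).hasFDerivAt).prodMk (shiftMap n N).hasFDerivAt
  rw [jetField_eq, (show HasFDerivAt (fun q => ((fun p : (Fin n → ℝ) × U => F p.1 p.2)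
    (baseMap n N q), shiftMap n N q)) _ q from h2).fderiv]
  have hb : baseMap n N (inputVec n N i (α + 1)) = 0 := by
    rw [baseMap_apply]
    refine Prod.ext rfl ?_
    funext i'
    simp [inputFun_inputVec _ _ hα]
  refine Prod.ext ?_ ?_
  · simp [hb]; rfl
  · funext i' β
    simp only [ContinuousLinearMap.prod_apply, shiftMap, ContinuousLinearMap.pi_apply,
      inputFun_inputVec _ _ hα]
    simp [inputVec]

theorem SmoothNear.tau {n N : ℕ} {F : (Fin n → ℝ) → U → (Fin n → ℝ)} {q₀ : Jet n N}
    (hF : SmoothSystemNear F q₀) {h : Jet n N → ℝ} (hh : SmoothNear h q₀) :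
    SmoothNear (tau F h) q₀ := by
  filter_upwards [hF.jetField, hh] with q h1 h2
  exact (h2.fderiv_right (m := ∞) (by simp)).clm_apply h1

theorem two_le_smooth : minSmoothness ℝ 2 ≤ (∞ : WithTop ℕ∞) := by
  rw [minSmoothness_of_isRCLikeNormedField]
  exact WithTop.coe_le_coe.2 le_top

theorem fderiv_fderiv_comm {E : Type*} [NormedAddCommGroup E] [NormedSpace ℝ E] {h : E → ℝ} {q : E}
    (hh : ContDiffAt ℝ ∞ h q) (v w : E) :
    fderiv ℝ (fun q => fderiv ℝ h q v) q w = fderiv ℝ (fun q => fderiv ℝ h q w) q v := by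
  have hd : DifferentiableAt ℝ (fderiv ℝ h) q :=
    (hh.fderiv_right (m := ∞) (by simp)).differentiableAt (by simp)
  have h1 : ∀ v w : E, fderiv ℝ (fun q => fderiv ℝ h q v) q w = fderiv ℝ (fderiv ℝ h) q w v := by
    intro v w
    rw [(hd.hasFDerivAt.clm_apply (hasFDerivAt_const v q)).fderiv]; simp
  rw [h1, h1]
  exact (hh.isSymmSndFDerivAt two_le_smooth) w v

/-- Symmetry of the second derivative turns D²h(δ, f_u) into the derivative along f_u of the
function dh(δ). This term disappears when dh(δ) vanishes near the point, which is how the formula is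
used. -/
theorem fderiv_tau {n N : ℕ} {F : (Fin n → ℝ) → U → (Fin n → ℝ)} {q : Jet n N}
    (hF : ContDiffAt ℝ ∞ (jetField F N) q) {h : Jet n N → ℝ} (hh : ContDiffAt ℝ ∞ h q)
    (δ : Jet n N) :
    fderiv ℝ (tau F h) q δ = fderiv ℝ (fun q => fderiv ℝ h q δ) q (jetField F N q) +
      fderiv ℝ h q (fderiv ℝ (jetField F N) q δ) := by
  have hd : DifferentiableAt ℝ (fderiv ℝ h) q :=
    (hh.fderiv_right (m := ∞) (by simp)).differentiableAt (by simp)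
  have h1 : fderiv ℝ (fun q => fderiv ℝ h q δ) q (jetField F N q) =
      fderiv ℝ (fderiv ℝ h) q (jetField F N q) δ := by
    rw [(hd.hasFDerivAt.clm_apply (hasFDerivAt_const δ q)).fderiv]; simp
  have hs : fderiv ℝ (fderiv ℝ h) q (jetField F N q) δ =
      fderiv ℝ (fderiv ℝ h) q δ (jetField F N q) := (hh.isSymmSndFDerivAt two_le_smooth) _ _
  unfold tau
  rw [h1, hs, (hd.hasFDerivAt.clm_apply (hF.differentiableAt (by simp)).hasFDerivAt).fderiv]
  simp [add_comm]

/-- Near `q₀`, the function `h` does not depend on `uⁱ_[α]` for `α ≥ b`. -/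
def FreeNear {n N : ℕ} (h : Jet n N → ℝ) (q₀ : Jet n N) (i : Fin 3) (b : ℕ) : Prop :=
  ∀ᶠ q in 𝓝 q₀, ∀ α, b ≤ α → fderiv ℝ h q (inputVec n N i α) = 0

theorem FreeNear.mono {n N : ℕ} {h : Jet n N → ℝ} {q₀ : Jet n N} {i : Fin 3} {b b' : ℕ}
    (hh : FreeNear h q₀ i b) (hb : b ≤ b') : FreeNear h q₀ i b' :=
  Filter.Eventually.mono hh fun _ hq α hα => hq α (hb.trans hα)

theorem fderiv_eventually_zero {E : Type*} [NormedAddCommGroup E] [NormedSpace ℝ E] {h : E → ℝ}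
    {q₀ : E} (hh : ∀ᶠ q in 𝓝 q₀, h q = 0) : ∀ᶠ q in 𝓝 q₀, fderiv ℝ h q = 0 := by
  filter_upwards [hh.eventually_nhds] with q hq
  have : h =ᶠ[𝓝 q] fun _ => (0 : ℝ) := hq
  rw [this.fderiv_eq]; simp

theorem FreeNear.fderiv {n N : ℕ} {h : Jet n N → ℝ} {q₀ : Jet n N} {i : Fin 3} {b : ℕ}
    (hs : SmoothNear h q₀) (hh : FreeNear h q₀ i b) (v : Jet n N) :
    FreeNear (fun q => fderiv ℝ h q v) q₀ i b := by
  filter_upwards [hh.eventually_nhds, hs] with q hq hsq α hα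
  rw [fderiv_fderiv_comm hsq]
  have : (fun q => _root_.fderiv ℝ h q (inputVec n N i α)) =ᶠ[𝓝 q] fun _ => (0 : ℝ) :=
    hq.mono fun q' hq' => hq' α hα
  rw [this.fderiv_eq]; simp

section
variable {n N : ℕ} {F : (Fin n → ℝ) → U → (Fin n → ℝ)} {q₀ : Jet n N}
  (hF : SmoothSystemNear F q₀) {h : Jet n N → ℝ} (hh : SmoothNear h q₀)
include hF hh

theorem eventually_fderiv_tau_inputVec (i : Fin 3) {α : ℕ} (hα : α + 1 < N)
    (h0 : ∀ᶠ q in 𝓝 q₀, fderiv ℝ h q (inputVec n N i (α + 1)) = 0) :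
    ∀ᶠ q in 𝓝 q₀, fderiv ℝ (tau F h) q (inputVec n N i (α + 1)) =
      fderiv ℝ h q (inputVec n N i α) := by
  filter_upwards [hF, hF.jetField, hh, fderiv_eventually_zero h0] with q h1 h2 h3 h4
  rw [fderiv_tau h2 h3, h4, fderiv_jetField_inputVec h1 i hα]
  simp

theorem FreeNear.tau {i : Fin 3} {b : ℕ} (hb : FreeNear h q₀ i b) :
    FreeNear (tau F h) q₀ i (b + 1) := by
  have : ∀ α ∈ Set.Iio N, ∀ᶠ q in 𝓝 q₀, b + 1 ≤ α →
      _root_.fderiv ℝ (FlatGTF.tau F h) q (inputVec n N i α) = 0 := by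
    intro α hα
    by_cases hbα : b + 1 ≤ α
    · obtain ⟨β, rfl⟩ : ∃ β, α = β + 1 := ⟨α - 1, by omega⟩
      filter_upwards [eventually_fderiv_tau_inputVec hF hh i hα
        (Filter.Eventually.mono hb fun q hq => hq _ (by omega)), hb] with q h1 h2 _
      rw [h1, h2 _ (by omega)]
    · exact Filter.Eventually.of_forall fun q h => absurd h hbα
  filter_upwards [(Filter.eventually_all_finite (Set.finite_Iio N)).2 this] with q hq α hα
  rcases lt_or_ge α N with h | h
  · exact hq α h hα
  · rw [inputVec_of_ge _ h, map_zero]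

theorem FreeNear.symbol {i : Fin 3} {b : ℕ} (hb : FreeNear h q₀ i (b + 1)) (hbN : b + 1 < N) :
    ∀ᶠ q in 𝓝 q₀, _root_.fderiv ℝ (FlatGTF.tau F h) q (inputVec n N i (b + 1)) =
      _root_.fderiv ℝ h q (inputVec n N i b) :=
  eventually_fderiv_tau_inputVec hF hh i hbN (Filter.Eventually.mono hb fun _ hq => hq _ le_rfl)

/-- Descending induction on the order: the highest order that h may still contain enters the time
derivative, one order higher, with the same coefficient, and there it is zero. The hypothesis `htop`
starts the induction, since the truncation hides what happens at the order N. -/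
theorem FreeNear.of_tau {i : Fin 3} {b : ℕ} (htop : FreeNear h q₀ i (N - 1))
    (hb : FreeNear (FlatGTF.tau F h) q₀ i (b + 1)) : FreeNear h q₀ i b := by
  have key : ∀ k, b ≤ N - 1 - k → FreeNear h q₀ i (N - 1 - k) := by
    intro k
    induction k with
    | zero => exact fun _ => htop
    | succ k ih =>
      intro hk
      have ih' := ih (by omega)
      rcases Nat.eq_zero_or_pos (N - 1 - k) with h0 | h0
      · convert ih' using 1; omega
      obtain ⟨c, hc⟩ : ∃ c, N - 1 - k = c + 1 := ⟨N - 1 - k - 1, by omega⟩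
      have hc' : N - 1 - (k + 1) = c := by omega
      rw [hc] at ih'
      rw [hc'] at hk ⊢
      filter_upwards [ih'.symbol hF hh (by omega), hb, ih'] with q h1 h2 h3 α hα
      rcases eq_or_lt_of_le hα with rfl | hα
      · rw [← h1, h2 _ (by omega)]
      · exact h3 α hα
  rcases le_or_gt b (N - 1) with h | h
  · have := key (N - 1 - b) (by omega)
    convert this using 1; omega
  · exact htop.mono h.le

end

section
variable {n N : ℕ} {F : (Fin n → ℝ) → U → (Fin n → ℝ)} {q₀ : Jet n N}
  (hF : SmoothSystemNear F q₀) {φ : Fin 3 → (Fin n → ℝ) → ℝ} (hφ : ∀ j, SmoothNear (φ j) q₀.1)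
include hF

theorem SmoothNear.timeDeriv {h : Jet n N → ℝ} (hh : SmoothNear h q₀) (m : ℕ) :
    SmoothNear (timeDeriv F h m) q₀ := by
  induction m with
  | zero => exact hh
  | succ m ih => rw [timeDeriv_succ]; exact ih.tau hF

theorem FreeNear.timeDeriv {h : Jet n N → ℝ} (hh : SmoothNear h q₀) {i : Fin 3} {b : ℕ}
    (hb : FreeNear h q₀ i b) (m : ℕ) : FreeNear (timeDeriv F h m) q₀ i (b + m) := by
  induction m with
  | zero => exact hb
  | succ m ih => rw [timeDeriv_succ]; exact ih.tau hF (hh.timeDeriv hF m)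

include hφ

theorem smooth_outDeriv (j : Fin 3) (m : ℕ) : SmoothNear (outDeriv F φ N j m) q₀ := by
  refine SmoothNear.timeDeriv hF ?_ m
  filter_upwards [continuous_fst.continuousAt.eventually (hφ j)] with q hq
  exact ContDiffAt.comp q hq contDiffAt_fst

theorem free_outDeriv (j i : Fin 3) (m : ℕ) : FreeNear (outDeriv F φ N j m) q₀ i m := by
  have h0 : FreeNear (outDeriv F φ N j 0) q₀ i 0 := by
    filter_upwards [continuous_fst.continuousAt.eventually (hφ j)] with q hq α _
    have : HasFDerivAt (φ j) _ q.1 := (hq.differentiableAt (by simp)).hasFDerivAt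
    have := (HasFDerivAt.comp q this hasFDerivAt_fst).fderiv
    rw [outDeriv_zero]
    erw [this]
    simp [inputVec]
  have := FreeNear.timeDeriv hF (smooth_outDeriv hF hφ j 0) h0 m
  rwa [zero_add] at this

/-- Lowering the order of differentiation. -/
theorem free_outDeriv_of_add (j i : Fin 3) {m b : ℕ} (l : ℕ) (hm : m + l ≤ N)
    (hb : FreeNear (outDeriv F φ N j (m + l)) q₀ i (b + l)) :
    FreeNear (outDeriv F φ N j m) q₀ i b := by
  induction l generalizing b with
  | zero => exact hb
  | succ l ih =>
    refine ih (by omega) ?_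
    rw [← add_assoc, outDeriv_succ] at hb
    exact FreeNear.of_tau hF (smooth_outDeriv hF hφ j _)
      ((free_outDeriv hF hφ j i _).mono (by omega)) hb

theorem free_outDeriv_add (j i : Fin 3) {m b : ℕ} (l : ℕ)
    (hb : FreeNear (outDeriv F φ N j m) q₀ i b) :
    FreeNear (outDeriv F φ N j (m + l)) q₀ i (b + l) := by
  induction l with
  | zero => exact hb
  | succ l ih =>
    rw [← add_assoc, outDeriv_succ]
    exact FreeNear.tau hF (smooth_outDeriv hF hφ j _) ih

/-- Each differentiation raises the highest order of an input by one and keeps its coefficient; b +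
l < N keeps all orders below the truncation. -/
theorem symbol_outDeriv_add (j i : Fin 3) {m b : ℕ} (l : ℕ) (hl : b + l < N)
    (hb : FreeNear (outDeriv F φ N j m) q₀ i (b + 1)) :
    ∀ᶠ q in 𝓝 q₀, fderiv ℝ (outDeriv F φ N j (m + l)) q (inputVec n N i (b + l)) =
      fderiv ℝ (outDeriv F φ N j m) q (inputVec n N i b) := by
  induction l with
  | zero => exact Filter.Eventually.of_forall fun _ => rfl
  | succ l ih =>
    have h1 := free_outDeriv_add hF hφ j i l hb
    have h2 := FreeNear.symbol (b := b + l) hF (smooth_outDeriv hF hφ j (m + l))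
      (by convert h1 using 1; omega) (by omega)
    filter_upwards [ih (by omega), h2] with q h3 h4
    rw [← h3, ← h4, ← outDeriv_succ]; rfl

end


/-! ### The flat chart -/

theorem fderiv_leftInverse {E F : Type*} [NormedAddCommGroup E] [NormedSpace ℝ E]
    [NormedAddCommGroup F] [NormedSpace ℝ F] (e : OpenPartialHomeomorph E F)
    (h1 : ContDiffOn ℝ ∞ e e.source) (h2 : ContDiffOn ℝ ∞ e.symm e.target) {x : E}
    (hx : x ∈ e.source) (δ : E) : fderiv ℝ e.symm (e x) (fderiv ℝ e x δ) = δ := by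
  have hd1 : HasFDerivAt e _ x :=
    ((h1.contDiffAt (e.open_source.mem_nhds hx)).differentiableAt (by simp)).hasFDerivAt
  have hd2 : HasFDerivAt e.symm _ (e x) := ((h2.contDiffAt
    (e.open_target.mem_nhds (e.map_source hx))).differentiableAt (by simp)).hasFDerivAt
  have h3 : HasFDerivAt (e.symm ∘ e) (ContinuousLinearMap.id ℝ E) x :=
    (hasFDerivAt_id x).congr_of_eventuallyEq
      (Filter.Eventually.mono (e.open_source.mem_nhds hx) fun y hy => e.left_inv hy)
  exact DFunLike.congr_fun ((hd2.comp x hd1).unique h3) δ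

theorem fderiv_rightInverse {E F : Type*} [NormedAddCommGroup E] [NormedSpace ℝ E]
    [NormedAddCommGroup F] [NormedSpace ℝ F] (e : OpenPartialHomeomorph E F)
    (h1 : ContDiffOn ℝ ∞ e e.source) (h2 : ContDiffOn ℝ ∞ e.symm e.target) {x : E}
    (hx : x ∈ e.source) (ζ : F) : fderiv ℝ e x (fderiv ℝ e.symm (e x) ζ) = ζ := by
  have := fderiv_leftInverse e.symm h2 (by simpa using h1) (e.map_source hx) ζ
  rwa [e.symm_symm, e.left_inv hx] at this

theorem LocalSFE.finrank_eq {S Z : Type} [NormedAddCommGroup S] [NormedSpace ℝ S]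
    [NormedAddCommGroup Z] [NormedSpace ℝ Z] {G : S → U → S} {s₀ : S} {w₀ : U} {H : Z → U → Z}
    (T : LocalSFE G s₀ w₀ H) : finrank ℝ S = finrank ℝ Z := by
  have hs := T.source_sub _ T.base_mem
  exact LinearEquiv.finrank_eq (LinearEquiv.ofLinearMap
    (fderiv ℝ T.Φ s₀ : S →ₗ[ℝ] Z) (fderiv ℝ T.Φ.symm (T.Φ s₀) : Z →ₗ[ℝ] S)
    (LinearMap.ext fun ζ => fderiv_rightInverse T.Φ T.smooth_Φ T.smooth_Φ_symm hs ζ)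
    (LinearMap.ext fun δ => fderiv_leftInverse T.Φ T.smooth_Φ T.smooth_Φ_symm hs δ))

/-- The map `(x, u_[0,N-1]) ↦ (x, u_[0,D-1])`. -/
def stateTrunc {n N : ℕ} (D : Fin 3 → ℕ) : Jet n N →L[ℝ] Ext n D :=
  (ContinuousLinearMap.fst ℝ _ _).prod
    (ContinuousLinearMap.pi fun i => ContinuousLinearMap.pi fun α : Fin (D i) => inputFun n N i α.1)

/-- The map `(x, u_[0,N-1]) ↦ u_[D]`. -/
def inputTop {n N : ℕ} (D : Fin 3 → ℕ) : Jet n N →L[ℝ] U :=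
  ContinuousLinearMap.pi fun i => inputFun n N i (D i)

theorem stateTrunc_apply {n N : ℕ} (D : Fin 3 → ℕ) (q : Jet n N) :
    stateTrunc D q = (q.1, fun i α => inputFun n N i α.1 q) := rfl

theorem inputTop_apply {n N : ℕ} (D : Fin 3 → ℕ) (q : Jet n N) (i : Fin 3) :
    inputTop D q i = inputFun n N i (D i) q := rfl

theorem stateTrunc_eq_zero {n N : ℕ} {D : Fin 3 → ℕ} {δ : Jet n N} :
    stateTrunc D δ = 0 ↔ δ.1 = 0 ∧ ∀ i α, α < D i → inputFun n N i α δ = 0 := by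
  rw [stateTrunc_apply, Prod.ext_iff]
  refine and_congr Iff.rfl ⟨fun h i α hα => ?_, fun h => ?_⟩
  · exact congrFun (congrFun h i) ⟨α, hα⟩
  · funext i α; exact h i α.1 α.2

theorem stateTrunc_inputVec {n N : ℕ} {D : Fin 3 → ℕ} {i : Fin 3} {α : ℕ} (hα : D i ≤ α) :
    stateTrunc D (inputVec n N i α) = 0 := by
  rw [stateTrunc_eq_zero]
  refine ⟨rfl, fun i' β hβ => ?_⟩
  rcases lt_or_ge α N with h | h
  · rw [inputFun_inputVec _ _ h, if_neg]
    rintro ⟨rfl, rfl⟩; omega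
  · rw [inputVec_of_ge _ h, map_zero]

theorem inputFun_jetField {n N : ℕ} (F : (Fin n → ℝ) → U → (Fin n → ℝ)) (q : Jet n N) (i : Fin 3)
    {α : ℕ} (hα : α < N) : inputFun n N i α (jetField F N q) = inputFun n N i (α + 1) q := by
  rw [inputFun_of_lt _ hα, inputFun_apply]; rfl

/-- The value `u` of the inputs, as a function of the state and the input of the prolonged
system. -/
def inputZero (n : ℕ) (D : Fin 3 → ℕ) : Ext n D × U →L[ℝ] U :=
  ContinuousLinearMap.pi fun i =>
    if h : 0 < D i then
      (ContinuousLinearMap.proj ⟨0, h⟩ : (Fin (D i) → ℝ) →L[ℝ] ℝ).comp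
        ((ContinuousLinearMap.proj i : ((i : Fin 3) → Fin (D i) → ℝ) →L[ℝ] (Fin (D i) → ℝ)).comp
          ((ContinuousLinearMap.snd ℝ (Fin n → ℝ) ((i : Fin 3) → Fin (D i) → ℝ)).comp
            (ContinuousLinearMap.fst ℝ (Ext n D) U)))
    else (ContinuousLinearMap.proj i : U →L[ℝ] ℝ).comp (ContinuousLinearMap.snd ℝ (Ext n D) U)

theorem inputZero_apply {n : ℕ} {D : Fin 3 → ℕ} (s : Ext n D) (w : U) :
    inputZero n D (s, w) = fun i => inputCoord s w i 0 := by
  funext i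
  simp only [inputZero, inputCoord, ContinuousLinearMap.pi_apply]
  split_ifs <;> rfl

theorem inputZero_trunc {n N : ℕ} {D : Fin 3 → ℕ} (q : Jet n N) :
    inputZero n D (stateTrunc D q, inputTop D q) = fun i => inputFun n N i 0 q := by
  rw [inputZero_apply]
  funext i
  simp only [inputCoord]
  split_ifs with h2
  · rfl
  · rw [inputTop_apply]; congr 2; omega

/-- As D i < N, the projection never reaches the derivative of order N that is set to zero in the
field, so it intertwines the two fields exactly. -/
theorem stateTrunc_jetField {n N : ℕ} (F : (Fin n → ℝ) → U → (Fin n → ℝ)) {D : Fin 3 → ℕ}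
    (hD : ∀ i, D i < N) (q : Jet n N) :
    stateTrunc D (jetField F N q) = prolong F D (stateTrunc D q) (inputTop D q) := by
  refine Prod.ext ?_ ?_
  · have h := inputZero_trunc (D := D) q
    rw [inputZero_apply] at h
    simp only [prolong, h]
    rw [jetField_eq]; rfl
  · funext i α
    have hα : α.1 < N := α.2.trans (hD i)
    simp only [stateTrunc_apply, prolong, inputFun_jetField F q i hα, inputCoord]
    split_ifs with h1
    · rfl
    · rw [inputTop_apply]; congr 2; have := α.2; omega

/-- The matrix `∂φ_[L]/∂u_[D]`. -/
def symbolMatrix {n N : ℕ} (F : (Fin n → ℝ) → U → (Fin n → ℝ)) (φ : Fin 3 → (Fin n → ℝ) → ℝ)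
    (D L : Fin 3 → ℕ) (j i : Fin 3) (q : Jet n N) : ℝ :=
  fderiv ℝ (outDeriv F φ N j (L j)) q (inputVec n N i (D i))

/-- A static feedback linearization of the prolonged system, with linearizing output `φ`. -/
structure FlatChart {n N : ℕ} (F : (Fin n → ℝ) → U → (Fin n → ℝ)) (φ : Fin 3 → (Fin n → ℝ) → ℝ)
    (q₀ : Jet n N) (D L : Fin 3 → ℕ) where
  T : LocalSFE (prolong F D) (stateTrunc D q₀) (inputTop D q₀) (brunovsky L)
  smoothF : SmoothSystemNear F q₀
  smoothφ : ∀ j, SmoothNear (φ j) q₀.1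
  D_lt : ∀ i, D i < N
  L_pos : ∀ j, 0 < L j
  L_le : ∀ j, L j ≤ N
  top : ∀ s ∈ T.Φ.source, ∀ j, T.Φ s j ⟨0, L_pos j⟩ = φ j s.1

namespace FlatChart

variable {n N : ℕ} {F : (Fin n → ℝ) → U → (Fin n → ℝ)} {φ : Fin 3 → (Fin n → ℝ) → ℝ}
  {q₀ : Jet n N} {D L : Fin 3 → ℕ} (C : FlatChart F φ q₀ D L)
include C

theorem eventually_mem : ∀ᶠ q in 𝓝 q₀, (stateTrunc D q, inputTop D q) ∈ C.T.Ξ.source :=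
  ((stateTrunc D).continuous.prodMk (inputTop D).continuous).continuousAt.preimage_mem_nhds
    (C.T.Ξ.open_source.mem_nhds C.T.base_mem)

theorem differentiableAt_Φ {s : Ext n D} (hs : s ∈ C.T.Φ.source) : DifferentiableAt ℝ C.T.Φ s :=
  (C.T.smooth_Φ.contDiffAt (C.T.Φ.open_source.mem_nhds hs)).differentiableAt (by simp)

/-- Along an integrator chain each coordinate is the time derivative of its predecessor. The
identity is assumed on a neighborhood and differentiated there along the field. -/
theorem eventually_outDeriv_eq (j : Fin 3) (m : ℕ) (hm : m < L j) :
    ∀ᶠ q in 𝓝 q₀, outDeriv F φ N j m q = C.T.Φ (stateTrunc D q) j ⟨m, hm⟩ := by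
  induction m with
  | zero =>
    filter_upwards [C.eventually_mem] with q hq
    rw [C.top _ (C.T.source_sub _ hq)]; rfl
  | succ m ih =>
    filter_upwards [(ih (by omega)).eventually_nhds, C.eventually_mem] with q hq hm'
    have hd := C.differentiableAt_Φ (C.T.source_sub _ hm')
    have h1 := hd.hasFDerivAt.comp q (stateTrunc D).hasFDerivAt
    have h2 := hasFDerivAt_pi'.1 (hasFDerivAt_pi'.1 h1 j) ⟨m, by omega⟩
    have h3 : HasFDerivAt (outDeriv F φ N j m) _ q := h2.congr_of_eventuallyEq hq
    rw [outDeriv_succ, tau, h3.fderiv]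
    have h4 := C.T.dynamics _ hm'
    have h5 := congrFun (congrFun h4 j) ⟨m, by omega⟩
    simp only [ContinuousLinearMap.comp_apply, ContinuousLinearMap.proj_apply]
    rw [stateTrunc_jetField F C.D_lt q]
    refine h5.trans ?_
    simp [brunovsky, hm]

theorem eventually_outDeriv_top (j : Fin 3) :
    ∀ᶠ q in 𝓝 q₀, outDeriv F φ N j (L j) q = (C.T.Ξ (stateTrunc D q, inputTop D q)).2 j := by
  have hL := C.L_pos j
  filter_upwards [(C.eventually_outDeriv_eq j (L j - 1) (by omega)).eventually_nhds,
    C.eventually_mem] with q hq hm'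
  have hd := C.differentiableAt_Φ (C.T.source_sub _ hm')
  have h1 := hd.hasFDerivAt.comp q (stateTrunc D).hasFDerivAt
  have h2 := hasFDerivAt_pi'.1 (hasFDerivAt_pi'.1 h1 j) ⟨L j - 1, by omega⟩
  have h3 : HasFDerivAt (outDeriv F φ N j (L j - 1)) _ q := h2.congr_of_eventuallyEq hq
  rw [show L j = L j - 1 + 1 by omega, outDeriv_succ, tau, h3.fderiv]
  have h4 := C.T.dynamics _ hm'
  have h5 := congrFun (congrFun h4 j) ⟨L j - 1, by omega⟩
  simp only [ContinuousLinearMap.comp_apply, ContinuousLinearMap.proj_apply]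
  rw [stateTrunc_jetField F C.D_lt q]
  refine h5.trans ?_
  have : ¬ (L j - 1 + 1 < L j) := by omega
  simp [brunovsky, this]

theorem eventually_outJet_eq : ∀ᶠ q in 𝓝 q₀, outJet F φ N L q = C.T.Φ (stateTrunc D q) := by
  have : ∀ᶠ q in 𝓝 q₀, ∀ j, ∀ m : Fin (L j),
      outDeriv F φ N j m.1 q = C.T.Φ (stateTrunc D q) j m :=
    Filter.eventually_all.2 fun j => Filter.eventually_all.2 fun m =>
      C.eventually_outDeriv_eq j m.1 m.2
  filter_upwards [this] with q hq
  funext j m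
  exact hq j m

theorem eventually_outTop_eq : ∀ᶠ q in 𝓝 q₀,
    (fun j => outDeriv F φ N j (L j) q) = (C.T.Ξ (stateTrunc D q, inputTop D q)).2 := by
  filter_upwards [Filter.eventually_all.2 fun j => C.eventually_outDeriv_top j] with q hq
  funext j
  exact hq j

theorem eventually_fderiv_outDeriv : ∀ᶠ q in 𝓝 q₀, ∀ j, ∀ m : Fin (L j), ∀ δ,
    fderiv ℝ (outDeriv F φ N j m.1) q δ = fderiv ℝ C.T.Φ (stateTrunc D q) (stateTrunc D δ) j m := by
  filter_upwards [C.eventually_outJet_eq.eventually_nhds, C.eventually_mem] with q hq hm' j m δ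
  have hd := C.differentiableAt_Φ (C.T.source_sub _ hm')
  have h1 := hd.hasFDerivAt.comp q (stateTrunc D).hasFDerivAt
  have h2 := hasFDerivAt_pi'.1 (hasFDerivAt_pi'.1 h1 j) m
  have h3 : HasFDerivAt (outDeriv F φ N j m.1) _ q :=
    h2.congr_of_eventuallyEq (hq.mono fun q' hq' => congrFun (congrFun hq' j) m)
  rw [h3.fderiv]; rfl

theorem eventually_injective : ∀ᶠ q in 𝓝 q₀, ∀ δ,
    (∀ j m, m < L j → fderiv ℝ (outDeriv F φ N j m) q δ = 0) → stateTrunc D δ = 0 := by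
  filter_upwards [C.eventually_fderiv_outDeriv, C.eventually_mem] with q hq hm δ hδ
  have h0 : fderiv ℝ C.T.Φ (stateTrunc D q) (stateTrunc D δ) = 0 := by
    funext j m
    rw [← hq j m δ]; exact hδ j m.1 m.2
  rw [← fderiv_leftInverse C.T.Φ C.T.smooth_Φ C.T.smooth_Φ_symm (C.T.source_sub _ hm)
    (stateTrunc D δ), h0, map_zero]

theorem exists_stateTrunc_eq (s : Ext n D) : ∃ δ : Jet n N, stateTrunc D δ = s ∧ inputTop D δ = 0 := by
  refine ⟨(s.1, fun i α => if h : α.1 < D i then s.2 i ⟨α.1, h⟩ else 0), ?_, ?_⟩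
  · rw [stateTrunc_apply]
    refine Prod.ext rfl ?_
    funext i α
    have h := α.2.trans (C.D_lt i)
    simp [inputFun_of_lt _ h]
  · funext i
    rw [inputTop_apply, inputFun_of_lt _ (C.D_lt i)]
    simp

theorem eventually_surjective : ∀ᶠ q in 𝓝 q₀, ∀ y : (j : Fin 3) → Fin (L j) → ℝ,
    ∃ δ, ∀ j, ∀ m : Fin (L j), fderiv ℝ (outDeriv F φ N j m.1) q δ = y j m := by
  filter_upwards [C.eventually_fderiv_outDeriv, C.eventually_mem] with q hq hm y
  obtain ⟨δ, hδ, -⟩ := C.exists_stateTrunc_eq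
    (fderiv ℝ C.T.Φ.symm (C.T.Φ (stateTrunc D q)) y)
  refine ⟨δ, fun j m => ?_⟩
  rw [hq, hδ, fderiv_rightInverse C.T.Φ C.T.smooth_Φ C.T.smooth_Φ_symm (C.T.source_sub _ hm)]

theorem eventually_fderiv_Ξ : ∀ᶠ q in 𝓝 q₀, ∀ δ,
    fderiv ℝ C.T.Ξ (stateTrunc D q, inputTop D q) (stateTrunc D δ, inputTop D δ) =
      (fderiv ℝ C.T.Φ (stateTrunc D q) (stateTrunc D δ),
        fun j => fderiv ℝ (outDeriv F φ N j (L j)) q δ) := by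
  filter_upwards [C.eventually_mem, C.eventually_mem.eventually_nhds,
    C.eventually_outTop_eq.eventually_nhds] with q hm hm' hq δ
  have hdΞ : HasFDerivAt C.T.Ξ (fderiv ℝ C.T.Ξ (stateTrunc D q, inputTop D q))
      (stateTrunc D q, inputTop D q) := ((C.T.smooth_Ξ.contDiffAt
    (C.T.Ξ.open_source.mem_nhds hm)).differentiableAt (by simp)).hasFDerivAt
  have h1 := HasFDerivAt.comp (f := fun q => (stateTrunc D q, inputTop D q)) q hdΞ
    ((stateTrunc D).hasFDerivAt.prodMk (inputTop D).hasFDerivAt)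
  refine Prod.ext ?_ ?_
  · have h2 := hasFDerivAt_fst.comp q h1
    have h3 : HasFDerivAt (fun q => C.T.Φ (stateTrunc D q))
        ((fderiv ℝ C.T.Φ (stateTrunc D q)).comp (stateTrunc D)) q :=
      (C.differentiableAt_Φ (C.T.source_sub _ hm)).hasFDerivAt.comp q (stateTrunc D).hasFDerivAt
    have h4 := h2.unique (h3.congr_of_eventuallyEq
      (hm'.mono fun q' hq' => C.T.fst_eq _ hq'))
    exact DFunLike.congr_fun h4 δ
  · have h2 := hasFDerivAt_snd.comp q h1
    funext j
    have h3 := hasFDerivAt_pi'.1 h2 j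
    have h4 : HasFDerivAt (outDeriv F φ N j (L j)) _ q :=
      h3.congr_of_eventuallyEq (hq.mono fun q' hq' => congrFun hq' j)
    exact (DFunLike.congr_fun h4.fderiv δ).symm

theorem eventually_injective_top : ∀ᶠ q in 𝓝 q₀, ∀ δ, stateTrunc D δ = 0 →
    (∀ j, fderiv ℝ (outDeriv F φ N j (L j)) q δ = 0) → inputTop D δ = 0 := by
  filter_upwards [C.eventually_mem, C.eventually_fderiv_Ξ] with q hm hq δ hδ h0
  have h6 := fderiv_leftInverse C.T.Ξ C.T.smooth_Ξ C.T.smooth_Ξ_symm hm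
    (stateTrunc D δ, inputTop D δ)
  rw [hq, hδ, map_zero, funext h0, show ((0, fun _ => 0) : ((j : Fin 3) → Fin (L j) → ℝ) × U) = 0
    from rfl, map_zero] at h6
  exact (congrArg Prod.snd h6).symm

/-- How the derivatives of `φ` below the order `L` depend on the inputs. -/
theorem free_of_lt (j i : Fin 3) {m b : ℕ} (hm : m < L j) (hb : D i + m < b + L j) :
    FreeNear (outDeriv F φ N j m) q₀ i b := by
  -- The last coordinate φʲ_[Lʲ-1] of the chain is a function of (x, u_[0,D-1]), so it is free of
  -- uⁱ_[α] for α ≥ Dⁱ. Going down Lʲ - 1 - m orders lowers the bound by as much.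
  refine free_outDeriv_of_add C.smoothF C.smoothφ j i (L j - 1 - m)
    (by have := C.L_le j; omega) ?_
  rw [show m + (L j - 1 - m) = L j - 1 by omega]
  filter_upwards [C.eventually_fderiv_outDeriv] with q hq α hα
  have := hq j ⟨L j - 1, by omega⟩ (inputVec n N i α)
  rw [show (⟨L j - 1, by omega⟩ : Fin (L j)).1 = L j - 1 from rfl] at this
  rw [this, stateTrunc_inputVec (by omega)]
  simp

theorem free_top_add (j i : Fin 3) (l : ℕ) :
    FreeNear (outDeriv F φ N j (L j + l)) q₀ i (D i + 1 + l) := by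
  have hL := C.L_pos j
  have := free_outDeriv_add C.smoothF C.smoothφ j i (l + 1)
    (C.free_of_lt j i (m := L j - 1) (b := D i) (by omega) (by omega))
  rw [show L j - 1 + (l + 1) = L j + l by omega, show D i + (l + 1) = D i + 1 + l by omega] at this
  exact this

theorem free (j i : Fin 3) {m b : ℕ} (hm : m ≤ L j) (hb : D i + m < b + L j) :
    FreeNear (outDeriv F φ N j m) q₀ i b := by
  rcases hm.lt_or_eq with h | rfl
  · exact C.free_of_lt j i h hb
  · exact (C.free_top_add j i 0).mono (by omega)

theorem smooth_symbolMatrix (j i : Fin 3) : SmoothNear (symbolMatrix F φ D L j i (N := N)) q₀ := by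
  filter_upwards [smooth_outDeriv C.smoothF C.smoothφ j (L j)] with q hq
  exact (hq.fderiv_right (m := ∞) (by simp)).clm_apply contDiffAt_const

theorem eventually_symbolMatrix_injective : ∀ᶠ q in 𝓝 q₀, ∀ w : Fin 3 → ℝ,
    (∀ j, ∑ i, symbolMatrix F φ D L j i q * w i = 0) → w = 0 := by
  filter_upwards [C.eventually_injective_top] with q hq w hw
  have hfun : ∀ i' β, inputFun n N i' β (∑ i, w i • inputVec n N i (D i)) =
      if β = D i' then w i' else 0 := by
    intro i' β
    rw [map_sum, Finset.sum_eq_single i']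
    · rw [map_smul, inputFun_inputVec _ _ (C.D_lt i')]; simp
    · intro b _ hb
      rw [map_smul, inputFun_inputVec _ _ (C.D_lt b), if_neg (by tauto)]; simp
    · simp
  have := hq (∑ i, w i • inputVec n N i (D i)) ?_ ?_
  · funext i
    have h := congrFun this i
    rwa [inputTop_apply, hfun, if_pos rfl] at h
  · rw [map_sum]
    refine Finset.sum_eq_zero fun i _ => ?_
    rw [map_smul, stateTrunc_inputVec le_rfl, smul_zero]
  · intro j
    rw [map_sum, ← hw j]
    refine Finset.sum_congr rfl fun i _ => ?_
    rw [map_smul, smul_eq_mul, mul_comm]; rfl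

/-- The coefficient of the highest derivative of the `i`-th input in the derivatives of `φʲ`. -/
theorem eventually_symbol_eq (j i : Fin 3) {m b : ℕ} (hm : m ≤ L j) (hb : D i + m = b + L j) :
    ∀ᶠ q in 𝓝 q₀, fderiv ℝ (outDeriv F φ N j m) q (inputVec n N i b) =
      symbolMatrix F φ D L j i q := by
  have := symbol_outDeriv_add C.smoothF C.smoothφ j i (m := m) (b := b) (L j - m)
    (by have := C.D_lt i; omega) (C.free j i hm (by omega))
  filter_upwards [this] with q hq
  rw [← hq, symbolMatrix]
  congr 2
  · congr 1; omega
  · omega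

theorem eventually_symbol_add (j i : Fin 3) (l : ℕ) (hl : D i + l < N) :
    ∀ᶠ q in 𝓝 q₀, fderiv ℝ (outDeriv F φ N j (L j + l)) q (inputVec n N i (D i + l)) =
      symbolMatrix F φ D L j i q :=
  symbol_outDeriv_add C.smoothF C.smoothφ j i l hl (C.free_top_add j i 0)

/-- Whatever the prolongation, φʲ_[Lʲ] contains only input derivatives of orders below Lʲ. -/
theorem eventually_symbol_zero (j i : Fin 3) (h : L j ≤ D i) :
    ∀ᶠ q in 𝓝 q₀, symbolMatrix F φ D L j i q = 0 := by
  filter_upwards [free_outDeriv C.smoothF C.smoothφ j i (L j)] with q hq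
  exact hq _ h

end FlatChart


/-! ### Minimality of the flat parametrization -/

/-- The columns in Is live only in the rows in Js, so the square block Js × Is inherits injectivity
from M and is invertible. A unit vector of a row in Js is thus the image of a vector supported in
Is. -/
theorem exists_block_solution {M : Fin 3 → Fin 3 → ℝ}
    (hM : ∀ w : Fin 3 → ℝ, (∀ j, ∑ i, M j i * w i = 0) → w = 0) {Is Js : Finset (Fin 3)}
    (hcard : Js.card = Is.card) (h0 : ∀ j, j ∉ Js → ∀ i ∈ Is, M j i = 0) (j₀ : Fin 3)
    (hj₀ : j₀ ∈ Js) :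
    ∃ c : Fin 3 → ℝ, (∀ i, i ∉ Is → c i = 0) ∧
      ∀ j, ∑ i, M j i * c i = if j = j₀ then 1 else 0 := by
  let A : (Is → ℝ) →ₗ[ℝ] (Js → ℝ) := Matrix.mulVecLin (Matrix.of fun j i => M j.1 i.1)
  let ext : (Is → ℝ) → Fin 3 → ℝ := fun c i => if h : i ∈ Is then c ⟨i, h⟩ else 0
  have hsum : ∀ (c : Is → ℝ) (j : Fin 3), ∑ i, M j i * ext c i = ∑ i : Is, M j i.1 * c i := by
    intro c j
    rw [← Finset.sum_subset (Finset.subset_univ Is), ← Finset.sum_coe_sort Is]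
    · exact Finset.sum_congr rfl fun i _ => by simp [ext]
    · intro i _ hi; simp [ext, hi]
  have hA : ∀ (c : Is → ℝ) (j : Js), A c j = ∑ i, M j.1 i * ext c i := by
    intro c j; rw [hsum]; rfl
  have hz : ∀ (c : Is → ℝ) (j : Fin 3), j ∉ Js → ∑ i, M j i * ext c i = 0 := by
    intro c j hj
    rw [hsum]
    exact Finset.sum_eq_zero fun i _ => by rw [h0 j hj i.1 i.2, zero_mul]
  have hinj : Function.Injective A := by
    rw [← LinearMap.ker_eq_bot, LinearMap.ker_eq_bot']
    intro c hc
    have : ext c = 0 := hM _ fun j => by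
      by_cases hj : j ∈ Js
      · rw [← hA c ⟨j, hj⟩, hc]; rfl
      · exact hz c j hj
    funext i
    have := congrFun this i.1
    simpa [ext] using this
  have hsurj : Function.Surjective A :=
    (LinearMap.injective_iff_surjective_of_finrank_eq_finrank (by simp [hcard])).1 hinj
  obtain ⟨c, hc⟩ := hsurj fun j => if j.1 = j₀ then 1 else 0
  refine ⟨ext c, fun i hi => by simp [ext, hi], fun j => ?_⟩
  by_cases hj : j ∈ Js
  · rw [← hA c ⟨j, hj⟩, hc]
  · rw [hz c j hj, if_neg]; rintro rfl; exact hj hj₀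

/-- The last coordinate vector of the `j`-th integrator chain. -/
def lastVec (L : Fin 3 → ℕ) (j : Fin 3) : (j : Fin 3) → Fin (L j) → ℝ :=
  fun j' m => if j' = j ∧ m.1 + 1 = L j' then 1 else 0

theorem contDiff_eval {A : Fin 3 → ℕ} (j : Fin 3) (m : Fin (A j)) :
    ContDiff ℝ ∞ fun y : (j : Fin 3) → Fin (A j) → ℝ => y j m :=
  contDiff_pi.1 (contDiff_pi.1 contDiff_id j) m

namespace FlatChart

variable {n N : ℕ} {F : (Fin n → ℝ) → U → (Fin n → ℝ)} {φ : Fin 3 → (Fin n → ℝ) → ℝ}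
  {q₀ : Jet n N} {D L : Fin 3 → ℕ} (C : FlatChart F φ q₀ D L)

include C

/-- The projection is linear and onto, hence open; properties that hold near q₀ and involve only the
projected point hold near the state and input of the prolonged system. -/
theorem map_trunc_nhds : 𝓝 (stateTrunc D q₀, inputTop D q₀) ≤
    Filter.map (fun q : Jet n N => (stateTrunc D q, inputTop D q)) (𝓝 q₀) := by
  have hs : Function.Surjective ((stateTrunc D).prod (inputTop D) : Jet n N →L[ℝ] Ext n D × U) := by
    rintro ⟨s, w⟩
    obtain ⟨δ, h1, h2⟩ := C.exists_stateTrunc_eq s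
    refine ⟨δ + ∑ i, w i • inputVec n N i (D i), ?_⟩
    rw [map_add, map_sum]
    have h3 : ∀ i, ((stateTrunc D).prod (inputTop D) : Jet n N →L[ℝ] Ext n D × U)
        (w i • inputVec n N i (D i)) = (0, Pi.single i (w i)) := by
      intro i
      rw [map_smul]
      refine Prod.ext ?_ ?_
      · simp [stateTrunc_inputVec le_rfl]
      · funext i'
        simp only [ContinuousLinearMap.prod_apply, Prod.smul_mk, Pi.smul_apply, inputTop_apply,
          inputFun_inputVec _ _ (C.D_lt i), Pi.single_apply, smul_eq_mul]
        by_cases h : i' = i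
        · subst h; simp
        · simp [h]
    simp_rw [h3]
    refine Prod.ext ?_ ?_
    · simp [h1, Prod.fst_sum]
    · simp only [ContinuousLinearMap.prod_apply, h2, Prod.snd_add, Prod.snd_sum, zero_add]
      exact Finset.univ_sum_single w
  exact (ContinuousLinearMap.isOpenMap _ hs).nhds_le q₀

/-- The state does not depend on the last variable of a chain whose input can be absorbed. -/
theorem eventually_fderiv_state (Js : Finset (Fin 3))
    (h : ∀ᶠ q in 𝓝 q₀, ∀ j₀ ∈ Js, ∃ c : Fin 3 → ℝ, (∀ i, D i = 0 → c i = 0) ∧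
      ∀ j, ∑ i, symbolMatrix F φ D L j i q * c i = if j = j₀ then 1 else 0) :
    ∀ᶠ y in 𝓝 (C.T.Φ (stateTrunc D q₀)), ∀ j₀ ∈ Js,
      fderiv ℝ (fun y => (C.T.Φ.symm y).1) y (lastVec L j₀) = 0 := by
  have hs₀ := C.T.source_sub _ C.T.base_mem
  have hfree : ∀ᶠ q in 𝓝 q₀, ∀ j, ∀ m : Fin (L j), ∀ i, 0 < D i →
      fderiv ℝ (outDeriv F φ N j m.1) q (inputVec n N i (D i - 1)) =
        if m.1 + 1 = L j then symbolMatrix F φ D L j i q else 0 := by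
    refine Filter.eventually_all.2 fun j => Filter.eventually_all.2 fun m =>
      Filter.eventually_all.2 fun i => ?_
    by_cases hi : 0 < D i
    · by_cases hm : m.1 + 1 = L j
      · filter_upwards [C.eventually_symbol_eq j i (m := m.1) (b := D i - 1) m.2.le (by omega)]
          with q hq _
        rw [hq, if_pos hm]
      · filter_upwards [C.free_of_lt j i (m := m.1) (b := D i - 1) m.2
          (by have := m.2; omega)] with q hq _
        rw [hq _ le_rfl, if_neg hm]
    · exact Filter.Eventually.of_forall fun q h => absurd h hi
  have hq : ∀ᶠ q in 𝓝 q₀, stateTrunc D q ∈ C.T.Φ.source ∧ ∀ j₀ ∈ Js, ∃ δs : Ext n D, δs.1 = 0 ∧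
      fderiv ℝ C.T.Φ (stateTrunc D q) δs = lastVec L j₀ := by
    filter_upwards [h, C.eventually_fderiv_outDeriv, hfree, C.eventually_mem] with q h1 h2 h3 h4
    refine ⟨C.T.source_sub _ h4, fun j₀ hj₀ => ?_⟩
    obtain ⟨c, hc0, hc⟩ := h1 j₀ hj₀
    -- One order below the top, the coefficients of uⁱ_[Dⁱ-1] in φʲ_[Lʲ-1] are again M, and lower
    -- derivatives of φ do not contain these variables. So this direction moves just the last
    -- variable of chain j₀, and x is fixed. Where D i = 0 the index D i - 1 is meaningless, but
    -- there c i = 0.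
    refine ⟨stateTrunc D (∑ i, c i • inputVec n N i (D i - 1)), ?_, ?_⟩
    · simp [stateTrunc_apply, Prod.fst_sum, inputVec]
    · funext j m
      rw [← h2, map_sum]
      have : ∀ i, fderiv ℝ (outDeriv F φ N j m.1) q (c i • inputVec n N i (D i - 1)) =
          if m.1 + 1 = L j then symbolMatrix F φ D L j i q * c i else 0 := by
        intro i
        rcases Nat.eq_zero_or_pos (D i) with hi | hi
        · simp [hc0 i hi]
        · rw [map_smul, h3 j m i hi]
          split_ifs <;> simp [mul_comm]
      simp_rw [this]
      by_cases hm : m.1 + 1 = L j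
      · simp only [hm, if_true, hc j, lastVec, and_true]
      · simp [hm, lastVec]
  have hs : ∀ᶠ s in 𝓝 (stateTrunc D q₀), s ∈ C.T.Φ.source ∧ ∀ j₀ ∈ Js, ∃ δs : Ext n D, δs.1 = 0 ∧
      fderiv ℝ C.T.Φ s δs = lastVec L j₀ := by
    have h1 := C.map_trunc_nhds (show {p : Ext n D × U | p.1 ∈ C.T.Φ.source ∧ ∀ j₀ ∈ Js,
      ∃ δs : Ext n D, δs.1 = 0 ∧ fderiv ℝ C.T.Φ p.1 δs = lastVec L j₀} ∈ _ from hq)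
    have h2 : Continuous fun s : Ext n D => (s, (inputTop D q₀ : U)) := by fun_prop
    exact h2.continuousAt.eventually h1
  have hcont : Filter.Tendsto C.T.Φ.symm (𝓝 (C.T.Φ (stateTrunc D q₀))) (𝓝 (stateTrunc D q₀)) := by
    have := C.T.Φ.continuousAt_symm (C.T.Φ.map_source hs₀)
    rwa [ContinuousAt, C.T.Φ.left_inv hs₀] at this
  filter_upwards [hcont.eventually hs,
    C.T.Φ.open_target.mem_nhds (C.T.Φ.map_source hs₀)] with y hy hyt j₀ hj₀
  obtain ⟨hys, hy⟩ := hy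
  obtain ⟨δs, h1, h2⟩ := hy j₀ hj₀
  have hd := ((C.T.smooth_Φ_symm.contDiffAt
    (C.T.Φ.open_target.mem_nhds hyt)).differentiableAt (by simp)).hasFDerivAt
  rw [(hd.fst).fderiv]
  have h3 := fderiv_leftInverse C.T.Φ C.T.smooth_Φ C.T.smooth_Φ_symm hys δs
  rw [C.T.Φ.right_inv hyt, h2] at h3
  simp [h3, h1]

/-- The inputs do not depend on the highest derivative of an output whose input can be absorbed. -/
theorem eventually_fderiv_input (Js : Finset (Fin 3))
    (h : ∀ᶠ q in 𝓝 q₀, ∀ j₀ ∈ Js, ∃ c : Fin 3 → ℝ, (∀ i, D i = 0 → c i = 0) ∧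
      ∀ j, ∑ i, symbolMatrix F φ D L j i q * c i = if j = j₀ then 1 else 0) :
    ∀ᶠ y in 𝓝 (C.T.Ξ (stateTrunc D q₀, inputTop D q₀)), ∀ j₀ ∈ Js,
      fderiv ℝ (fun y => inputZero n D (C.T.Ξ.symm y)) y (0, Pi.single j₀ 1) = 0 := by
  have hs₀ := C.T.base_mem
  have hq : ∀ᶠ q in 𝓝 q₀, (stateTrunc D q, inputTop D q) ∈ C.T.Ξ.source ∧ ∀ j₀ ∈ Js,
      ∃ δ : Ext n D × U, inputZero n D δ = 0 ∧
      fderiv ℝ C.T.Ξ (stateTrunc D q, inputTop D q) δ = (0, Pi.single j₀ 1) := by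
    filter_upwards [h, C.eventually_fderiv_Ξ, C.eventually_mem] with q h1 h2 h4
    refine ⟨h4, fun j₀ hj₀ => ?_⟩
    obtain ⟨c, hc0, hc⟩ := h1 j₀ hj₀
    -- This direction changes only inputs with D i > 0, in their derivatives of order D i, so the
    -- values u themselves stay fixed.
    set δ : Jet n N := ∑ i, c i • inputVec n N i (D i) with hδ
    have hst : stateTrunc D δ = 0 := by
      rw [hδ, map_sum]
      exact Finset.sum_eq_zero fun i _ => by rw [map_smul, stateTrunc_inputVec le_rfl, smul_zero]
    refine ⟨(stateTrunc D δ, inputTop D δ), ?_, ?_⟩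
    · rw [inputZero_trunc]
      funext i
      rw [hδ, map_sum, Finset.sum_eq_single i]
      · rw [map_smul, inputFun_inputVec _ _ (C.D_lt i)]
        by_cases hi : D i = 0
        · simp [hc0 i hi]
        · simp [Ne.symm hi]
      · intro b _ hb
        rw [map_smul, inputFun_inputVec _ _ (C.D_lt b), if_neg (by tauto), smul_zero]
      · simp
    · rw [h2, hst, map_zero]
      refine Prod.ext rfl ?_
      funext j
      simp only [hδ, map_sum, map_smul, smul_eq_mul, Pi.single_apply]
      rw [← hc j]
      exact Finset.sum_congr rfl fun i _ => mul_comm _ _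
  have hs := C.map_trunc_nhds (show {p : Ext n D × U | p ∈ C.T.Ξ.source ∧ ∀ j₀ ∈ Js,
      ∃ δ : Ext n D × U, inputZero n D δ = 0 ∧
      fderiv ℝ C.T.Ξ p δ = (0, Pi.single j₀ 1)} ∈ _ from hq)
  have hcont : Filter.Tendsto C.T.Ξ.symm (𝓝 (C.T.Ξ ((stateTrunc D q₀, inputTop D q₀)))) (𝓝 ((stateTrunc D q₀, inputTop D q₀))) := by
    have := C.T.Ξ.continuousAt_symm (C.T.Ξ.map_source hs₀)
    rwa [ContinuousAt, C.T.Ξ.left_inv hs₀] at this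
  filter_upwards [hcont.eventually hs,
    C.T.Ξ.open_target.mem_nhds (C.T.Ξ.map_source hs₀)] with y hy hyt j₀ hj₀
  obtain ⟨hys, hy⟩ := hy
  obtain ⟨δs, h1, h2⟩ := hy j₀ hj₀
  have hd := ((C.T.smooth_Ξ_symm.contDiffAt
    (C.T.Ξ.open_target.mem_nhds hyt)).differentiableAt (by simp)).hasFDerivAt
  have h4 : HasFDerivAt (fun y => inputZero n D (C.T.Ξ.symm y)) _ y :=
    (inputZero n D).hasFDerivAt.comp y hd
  rw [h4.fderiv]
  have h3 := fderiv_leftInverse C.T.Ξ C.T.smooth_Ξ C.T.smooth_Ξ_symm hys δs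
  rw [C.T.Ξ.right_inv hyt, h2] at h3
  simp [h3, h1]

/-- The inverse charts express x and u by φ_[0,L-1] and φ_[0,L]. For j in Js, x is independent of
the last variable of the chain and u of the new input, so constants may be inserted for them without
changing the result. -/
theorem hasFlatParam (Js : Finset (Fin 3))
    (h : ∀ᶠ q in 𝓝 q₀, ∀ j₀ ∈ Js, ∃ c : Fin 3 → ℝ, (∀ i, D i = 0 → c i = 0) ∧
      ∀ j, ∑ i, symbolMatrix F φ D L j i q * c i = if j = j₀ then 1 else 0) :
    HasFlatParam F φ N q₀ (fun j => if j ∈ Js then L j - 1 else L j) := by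
  set R' : Fin 3 → ℕ := fun j => if j ∈ Js then L j - 1 else L j with hR'
  have hR1 : ∀ j, j ∈ Js → R' j + 1 = L j := fun j hj => by
    have := C.L_pos j; simp only [hR', if_pos hj]; omega
  have hR2 : ∀ j, j ∉ Js → R' j = L j := fun j hj => by simp only [hR', if_neg hj]
  have hR3 : ∀ j, L j ≤ R' j + 1 := fun j => by
    by_cases hj : j ∈ Js
    · exact (hR1 j hj).ge
    · rw [hR2 j hj]; omega
  set y₀ := C.T.Φ (stateTrunc D q₀) with hy₀
  set v₀ := (C.T.Ξ (stateTrunc D q₀, inputTop D q₀)).2 with hv₀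
  have hΞ₀ : C.T.Ξ (stateTrunc D q₀, inputTop D q₀) = (y₀, v₀) :=
    Prod.ext (C.T.fst_eq _ C.T.base_mem) rfl
  have hs₀ := C.T.source_sub _ C.T.base_mem
  have hyt : C.T.Φ.target ∈ 𝓝 y₀ := C.T.Φ.open_target.mem_nhds (C.T.Φ.map_source hs₀)
  have hΞt : C.T.Ξ.target ∈ 𝓝 (y₀, v₀) := by
    rw [← hΞ₀]; exact C.T.Ξ.open_target.mem_nhds (C.T.Ξ.map_source C.T.base_mem)
  obtain ⟨r, hr, hball⟩ := Metric.mem_nhds_iff.1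
    (Filter.inter_mem hyt (C.eventually_fderiv_state Js h))
  have hin := C.eventually_fderiv_input Js h
  rw [hΞ₀] at hin
  obtain ⟨ρ, hρ, hball2⟩ := Metric.mem_nhds_iff.1 (Filter.inter_mem hΞt hin)
  -- The missing variables are filled in with their values at the base point, which keeps the point
  -- in the ball on which the derivatives vanish.
  let fill : ((j : Fin 3) → Fin (R' j) → ℝ) → (j : Fin 3) → Fin (L j) → ℝ :=
    fun y j m => if h : m.1 < R' j then y j ⟨m.1, h⟩ else y₀ j m
  have hfill : ContDiff ℝ ∞ fill := by
    refine contDiff_pi.2 fun j => contDiff_pi.2 fun m => ?_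
    by_cases h : m.1 < R' j
    · simp only [fill, dif_pos h]; exact contDiff_eval _ _
    · simp only [fill, dif_neg h]; fun_prop
  let fill2 : ((j : Fin 3) → Fin (R' j + 1) → ℝ) → ((j : Fin 3) → Fin (L j) → ℝ) × U :=
    fun y => (fun j m => y j ⟨m.1, m.2.trans_le (hR3 j)⟩,
      fun j => if h : L j < R' j + 1 then y j ⟨L j, h⟩ else v₀ j)
  have hfill2 : ContDiff ℝ ∞ fill2 := by
    refine ContDiff.prodMk (contDiff_pi.2 fun j => contDiff_pi.2 fun m => ?_)
      (contDiff_pi.2 fun j => ?_)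
    · exact contDiff_eval _ _
    · by_cases h : L j < R' j + 1
      · simp only [dif_pos h]; exact contDiff_eval j _
      · simp only [dif_neg h]; fun_prop
  refine ⟨fill ⁻¹' ball y₀ r, fill2 ⁻¹' ball (y₀, v₀) ρ, fun y => (C.T.Φ.symm (fill y)).1,
    fun y => inputZero n D (C.T.Ξ.symm (fill2 y)), isOpen_ball.preimage hfill.continuous,
    isOpen_ball.preimage hfill2.continuous, ?_, ?_, ?_⟩
  · exact (C.T.smooth_Φ_symm.comp hfill.contDiffOn fun y hy => (hball hy).1).fst
  · exact (inputZero n D).contDiff.comp_contDiffOn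
      (C.T.smooth_Ξ_symm.comp hfill2.contDiffOn fun y hy => (hball2 hy).1)
  · have hc1 : ∀ᶠ q in 𝓝 q₀, C.T.Φ (stateTrunc D q) ∈ ball y₀ r :=
      (ContinuousAt.comp (f := fun q : Jet n N => stateTrunc D q)
        (C.differentiableAt_Φ hs₀).continuousAt
        (stateTrunc D).continuous.continuousAt).eventually (ball_mem_nhds _ hr)
    have hc2 : ∀ᶠ q in 𝓝 q₀, C.T.Ξ (stateTrunc D q, inputTop D q) ∈ ball (y₀, v₀) ρ := by
      have h1 : ContinuousAt (fun q : Jet n N => C.T.Ξ (stateTrunc D q, inputTop D q)) q₀ :=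
        (C.T.Ξ.continuousAt C.T.base_mem).comp
          (f := fun q : Jet n N => (stateTrunc D q, inputTop D q))
          ((stateTrunc D).continuous.prodMk (inputTop D).continuous).continuousAt
      refine h1.eventually ?_
      change ball (y₀, v₀) ρ ∈ 𝓝 (C.T.Ξ (stateTrunc D q₀, inputTop D q₀))
      rw [hΞ₀]; exact ball_mem_nhds _ hρ
    filter_upwards [hc1, hc2, C.eventually_outJet_eq, C.eventually_outTop_eq, C.eventually_mem]
      with q h1 h2 h3 h4 h5
    have hfillq : ∀ j m, fill (outJet F φ N R' q) j m =
        if m.1 < R' j then C.T.Φ (stateTrunc D q) j m else y₀ j m := by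
      intro j m
      simp only [fill]
      split_ifs with h
      · rw [← h3]; rfl
      · rfl
    have hmem1 : fill (outJet F φ N R' q) ∈ ball y₀ r := by
      rw [mem_ball] at h1 ⊢
      refine (dist_pi_lt_iff hr).2 fun j => (dist_pi_lt_iff hr).2 fun m => ?_
      rw [hfillq]
      split_ifs
      · exact (dist_pi_lt_iff hr).1 ((dist_pi_lt_iff hr).1 h1 j) m
      · simpa using hr
    have hf1 : ∀ j m, (fill2 (outJet F φ N (fun j => R' j + 1) q)).1 j m =
        (C.T.Ξ (stateTrunc D q, inputTop D q)).1 j m := by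
      intro j m
      rw [C.T.fst_eq _ h5, ← h3]; rfl
    have hf2 : ∀ j, (fill2 (outJet F φ N (fun j => R' j + 1) q)).2 j =
        if j ∈ Js then v₀ j else (C.T.Ξ (stateTrunc D q, inputTop D q)).2 j := by
      intro j
      simp only [fill2]
      by_cases hj : j ∈ Js
      · rw [dif_neg (by have := hR1 j hj; omega), if_pos hj]
      · rw [dif_pos (by rw [hR2 j hj]; omega), if_neg hj, ← h4]; rfl
    have hmem2 : fill2 (outJet F φ N (fun j => R' j + 1) q) ∈ ball (y₀, v₀) ρ := by
      rw [← ball_prod_same] at h2 ⊢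
      refine ⟨?_, ?_⟩
      · rw [show (fill2 (outJet F φ N (fun j => R' j + 1) q)).1 = _ from
          funext fun j => funext fun m => hf1 j m]
        exact h2.1
      · have h2' := h2.2
        rw [mem_ball] at h2' ⊢
        refine (dist_pi_lt_iff hρ).2 fun j => ?_
        rw [hf2]
        split_ifs
        · simpa using hρ
        · exact (dist_pi_lt_iff hρ).1 h2' j
    refine ⟨hmem1, hmem2, ?_, ?_⟩
    · have : (C.T.Φ.symm (C.T.Φ (stateTrunc D q))).1 =
          (C.T.Φ.symm (fill (outJet F φ N R' q))).1 := by
        refine eq_of_fderiv_eq_zero_on_convex (A := fun y => (C.T.Φ.symm y).1) (convex_ball y₀ r)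
          (fun y hy => ?_) h1 hmem1 fun y hy => ?_
        · exact ((C.T.smooth_Φ_symm.contDiffAt (C.T.Φ.open_target.mem_nhds
            (hball hy).1)).differentiableAt (by simp)).fst
        -- The true point and the filled one differ only along last variables of chains in Js,
        -- directions in which x is stationary.
        · have hdec : fill (outJet F φ N R' q) - C.T.Φ (stateTrunc D q) =
              ∑ j ∈ Js, (y₀ j ⟨L j - 1, by have := C.L_pos j; omega⟩ -
                C.T.Φ (stateTrunc D q) j ⟨L j - 1, by have := C.L_pos j; omega⟩) • lastVec L j := by
            funext j m
            simp only [Pi.sub_apply, hfillq, Finset.sum_apply, Pi.smul_apply, lastVec, smul_eq_mul]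
            have hm := m.2
            by_cases hj : j ∈ Js
            · rw [Finset.sum_eq_single_of_mem j hj]
              · have := hR1 j hj
                by_cases hm' : m.1 + 1 = L j
                · rw [if_neg (by omega), if_pos ⟨rfl, hm'⟩, mul_one]
                  rw [show m = ⟨L j - 1, by omega⟩ from Fin.ext (by simp only; omega)]
                · rw [if_pos (by omega), if_neg (by tauto)]; simp
              · intro b _ hb
                rw [if_neg (by rintro ⟨rfl, -⟩; exact hb rfl), mul_zero]
            · rw [Finset.sum_eq_zero]
              · rw [if_pos (by rw [hR2 j hj]; exact hm), sub_self]
              · intro b hb'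
                rw [if_neg (by rintro ⟨rfl, -⟩; exact hj hb'), mul_zero]
          rw [hdec, map_sum]
          exact Finset.sum_eq_zero fun j hj => by rw [map_smul, (hball hy).2 j hj, smul_zero]
      rw [← this, C.T.Φ.left_inv (C.T.source_sub _ h5)]; rfl
    · have : inputZero n D (C.T.Ξ.symm (C.T.Ξ (stateTrunc D q, inputTop D q))) =
          inputZero n D (C.T.Ξ.symm (fill2 (outJet F φ N (fun j => R' j + 1) q))) := by
        refine eq_of_fderiv_eq_zero_on_convex (A := fun y => inputZero n D (C.T.Ξ.symm y))
          (convex_ball (y₀, v₀) ρ) (fun y hy => ?_) h2 hmem2 fun y hy => ?_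
        · exact (inputZero n D).differentiableAt.comp y ((C.T.smooth_Ξ_symm.contDiffAt
            (C.T.Ξ.open_target.mem_nhds (hball2 hy).1)).differentiableAt (by simp))
        · have hdec : fill2 (outJet F φ N (fun j => R' j + 1) q) -
              C.T.Ξ (stateTrunc D q, inputTop D q) =
              ∑ j ∈ Js, (v₀ j - (C.T.Ξ (stateTrunc D q, inputTop D q)).2 j) •
                (0, Pi.single j 1) := by
            refine Prod.ext ?_ ?_
            · rw [Prod.fst_sub, show (fill2 (outJet F φ N (fun j => R' j + 1) q)).1 = _ from
                funext fun j => funext fun m => hf1 j m]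
              simp [Prod.fst_sum]
            · funext j
              simp only [Prod.snd_sub, Pi.sub_apply, hf2, Prod.snd_sum, Finset.sum_apply,
                Prod.smul_mk, Pi.smul_apply, Pi.single_apply, smul_eq_mul]
              by_cases hj : j ∈ Js
              · simp [hj]
              · rw [if_neg hj, Finset.sum_eq_zero, sub_self]
                intro b hb
                rw [if_neg (by rintro rfl; exact hj hb), mul_zero]
          rw [hdec, map_sum]
          exact Finset.sum_eq_zero fun j hj => by rw [map_smul, (hball2 hy).2 j hj, smul_zero]
      rw [← this, C.T.Ξ.left_inv h5, inputZero_trunc]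
      funext i
      rw [inputFun_apply]

/-- If the inputs in `Is` were prolonged, and only as many outputs see their highest derivatives,
the multi-index would not be minimal. -/
theorem minimality (hmin : ∀ R' : Fin 3 → ℕ, (∀ j, R' j ≤ N) → HasFlatParam F φ N q₀ R' →
      ∀ j, L j ≤ R' j) (Is Js : Finset (Fin 3)) (hne : Is.Nonempty) (hI : ∀ i ∈ Is, 0 < D i)
    (hcard : Js.card = Is.card)
    (h0 : ∀ j, j ∉ Js → ∀ i ∈ Is, ∀ᶠ q in 𝓝 q₀, symbolMatrix F φ D L j i q = 0) : False := by
  have h0' : ∀ᶠ q in 𝓝 q₀, ∀ j, j ∉ Js → ∀ i, i ∈ Is → symbolMatrix F φ D L j i q = 0 := by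
    refine Filter.eventually_all.2 fun j => ?_
    by_cases hj : j ∈ Js
    · exact Filter.Eventually.of_forall fun q h => absurd hj h
    · refine (Filter.eventually_all.2 fun i => ?_).mono fun q hq _ => hq
      by_cases hi : i ∈ Is
      · exact (h0 j hj i hi).mono fun q hq _ => hq
      · exact Filter.Eventually.of_forall fun q h => absurd h hi
  have hp := C.hasFlatParam Js (by
    filter_upwards [C.eventually_symbolMatrix_injective, h0'] with q h1 h2 j₀ hj₀
    obtain ⟨c, hc1, hc2⟩ := exists_block_solution h1 hcard h2 j₀ hj₀
    refine ⟨c, fun i hi => hc1 i fun hi' => ?_, hc2⟩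
    have := hI i hi'
    omega)
  obtain ⟨j, hj⟩ : Js.Nonempty := by
    rw [← Finset.card_pos, hcard, Finset.card_pos]; exact hne
  have := hmin _ (fun j => by have := C.L_le j; split_ifs <;> omega) hp j
  have hpos := C.L_pos j
  rw [if_pos hj] at this
  omega

theorem hasFlatParam_self : HasFlatParam F φ N q₀ L := by
  simpa using C.hasFlatParam ∅ (Filter.Eventually.of_forall fun q j hj => by simp at hj)

end FlatChart


/-! ### Consequences of the constant rank of the codistributions -/

theorem mem_stateCodist {n N : ℕ} {η : Jet n N →L[ℝ] ℝ} :
    η ∈ stateCodist n N ↔ ∀ i α, η (inputVec n N i α) = 0 := by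
  constructor
  · intro h i α
    unfold stateCodist at h
    induction h using Submodule.span_induction with
    | mem x hx => obtain ⟨k, rfl⟩ := hx; simp [inputVec]
    | zero => rfl
    | add x y _ _ hx hy => simp [hx, hy]
    | smul a x _ hx => simp [hx]
  · intro h
    have hη : η = ∑ k, η (Pi.single k 1, 0) • ((ContinuousLinearMap.proj k :
        (Fin n → ℝ) →L[ℝ] ℝ).comp (ContinuousLinearMap.fst ℝ _ _)) := by
      refine ContinuousLinearMap.ext fun δ => ?_
      rw [show η δ = η (δ.1, 0) by
        conv_lhs => rw [← add_sub_cancel (δ.1, 0) δ]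
        rw [map_add, apply_eq_zero_of_kills η 0 (δ - (δ.1, 0)) (fun i α _ => h i α) (by simp)
          (by simp), add_zero]]
      have : ((δ.1, 0) : Jet n N) = ∑ k, δ.1 k • (Pi.single k 1, 0) := by
        refine Prod.ext ?_ ?_
        · rw [Prod.fst_sum]
          funext k
          simp [Finset.sum_apply, Pi.single_apply]
        · simp [Prod.snd_sum]
      rw [this, map_sum, sum_apply]
      refine Finset.sum_congr rfl fun k _ => ?_
      rw [map_smul]
      simp [mul_comm]
    rw [hη]
    exact Submodule.sum_mem _ fun k _ => Submodule.smul_mem _ _ (Submodule.subset_span ⟨k, rfl⟩)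

theorem outCodist_eq_span_range {n N : ℕ} (F : (Fin n → ℝ) → U → (Fin n → ℝ))
    (φ : Fin 3 → (Fin n → ℝ) → ℝ) (A : Fin 3 → ℕ) (q : Jet n N) :
    outCodist F φ N A q = Submodule.span ℝ
      (Set.range fun p : (j : Fin 3) × Fin (A j) => fderiv ℝ (outDeriv F φ N p.1 p.2.1) q) := by
  unfold outCodist
  congr 1
  ext η
  constructor
  · rintro ⟨j, α, hα, rfl⟩; exact ⟨⟨j, α, hα⟩, rfl⟩
  · rintro ⟨⟨j, α⟩, rfl⟩; exact ⟨j, α.1, α.2, rfl⟩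

theorem finrank_outCodist_le {n N : ℕ} (F : (Fin n → ℝ) → U → (Fin n → ℝ))
    (φ : Fin 3 → (Fin n → ℝ) → ℝ) (A : Fin 3 → ℕ) (q : Jet n N) :
    finrank ℝ (outCodist F φ N A q) ≤ ∑ j, A j := by
  rw [outCodist_eq_span_range]
  refine (finrank_range_le_card (R := ℝ) _).trans ?_
  simp

/-- Evaluation of the covectors in `Ω` at finitely many vectors. -/
def evalMap {E ι : Type*} [NormedAddCommGroup E] [NormedSpace ℝ E]
    (Ω : Submodule ℝ (E →L[ℝ] ℝ)) (e : ι → E) : Ω →ₗ[ℝ] (ι → ℝ) where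
  toFun η a := η.1 (e a)
  map_add' _ _ := rfl
  map_smul' _ _ := rfl

/-- Rank-nullity for the evaluation at the vectors e: its range has at most as many dimensions as
there are vectors, and its kernel lies in Ω ⊓ St. -/
theorem finrank_le_finrank_inf_add {E ι : Type*} [NormedAddCommGroup E] [NormedSpace ℝ E]
    [FiniteDimensional ℝ E] [Fintype ι] (Ω St : Submodule ℝ (E →L[ℝ] ℝ)) (e : ι → E)
    (h : ∀ η ∈ Ω, (∀ a, η (e a) = 0) → η ∈ St) :
    finrank ℝ Ω ≤ finrank ℝ ↥(Ω ⊓ St) + Fintype.card ι := by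
  have h1 := LinearMap.finrank_range_add_finrank_ker (K := ℝ) (V := Ω) (V₂ := ι → ℝ) (evalMap Ω e)
  have h2 : finrank ℝ (LinearMap.range (evalMap Ω e)) ≤ Fintype.card ι := by
    refine (Submodule.finrank_le _).trans ?_
    simp
  have h3 : finrank ℝ (LinearMap.ker (evalMap Ω e)) ≤ finrank ℝ ↥(Ω ⊓ St) := by
    rw [← Submodule.finrank_map_subtype_eq]
    apply Submodule.finrank_mono
    rintro η ⟨⟨η', hη'⟩, hk, rfl⟩
    exact ⟨hη', h _ hη' fun a => congrFun (LinearMap.mem_ker.1 hk) a⟩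
  omega

/-- Rank-nullity again, now with a surjective evaluation: a functional that kills its range would be
a nontrivial combination of the vectors annihilated by Ω. The covectors in Ω ⊓ St lie in the kernel.
-/
theorem finrank_inf_add_le_finrank {E ι : Type*} [NormedAddCommGroup E] [NormedSpace ℝ E]
    [FiniteDimensional ℝ E] [Fintype ι] (Ω St : Submodule ℝ (E →L[ℝ] ℝ)) (e : ι → E)
    (hSt : ∀ η ∈ St, ∀ a, η (e a) = 0)
    (h : ∀ c : ι → ℝ, (∀ η ∈ Ω, ∑ a, c a * η (e a) = 0) → c = 0) :
    finrank ℝ ↥(Ω ⊓ St) + Fintype.card ι ≤ finrank ℝ Ω := by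
  classical
  have h1 := LinearMap.finrank_range_add_finrank_ker (K := ℝ) (V := Ω) (V₂ := ι → ℝ) (evalMap Ω e)
  have h2 : LinearMap.range (evalMap Ω e) = ⊤ := by
    by_contra hne
    obtain ⟨f, hf0, hf⟩ := Submodule.exists_le_ker_of_lt_top _ (lt_top_iff_ne_top.2 hne)
    apply hf0
    have hfe : ∀ v, f v = ∑ a, f (Pi.single a 1) * v a := by
      intro v
      conv_lhs => rw [← Finset.univ_sum_single v, map_sum]
      refine Finset.sum_congr rfl fun a _ => ?_
      rw [show (Pi.single a (v a) : ι → ℝ) = v a • Pi.single a 1 by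
        rw [← Pi.single_smul']; simp, map_smul, smul_eq_mul, mul_comm]
    have hc := h (fun a => f (Pi.single a 1)) fun η hη => by
      have := hf (LinearMap.mem_range_self (evalMap Ω e) ⟨η, hη⟩)
      rw [LinearMap.mem_ker, hfe] at this
      exact this
    refine LinearMap.ext fun v => ?_
    rw [hfe]
    exact Finset.sum_eq_zero fun a _ => by rw [congrFun hc a]; simp
  rw [h2, finrank_top, Module.finrank_fintype_fun_eq_card] at h1
  have h3 : finrank ℝ ↥(Ω ⊓ St) ≤ finrank ℝ (LinearMap.ker (evalMap Ω e)) := by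
    rw [← Submodule.finrank_map_subtype_eq]
    apply Submodule.finrank_mono
    rintro η ⟨hη, hs⟩
    exact ⟨⟨η, hη⟩, LinearMap.mem_ker.2 (funext fun a => hSt η hs a), rfl⟩
  omega

namespace FlatChart

variable {n N : ℕ} {F : (Fin n → ℝ) → U → (Fin n → ℝ)} {φ : Fin 3 → (Fin n → ℝ) → ℝ}
  {q₀ : Jet n N} {D L : Fin 3 → ℕ} (C : FlatChart F φ q₀ D L)
include C

theorem finrank_outCodist (A : Fin 3 → ℕ) (hA : ∀ j, A j ≤ L j) :
    finrank ℝ (outCodist F φ N A q₀) = ∑ j, A j := by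
  rw [outCodist_eq_span_range, finrank_span_eq_card]
  · simp
  · rw [Fintype.linearIndependent_iff]
    intro c hc p
    obtain ⟨δ, hδ⟩ := C.eventually_surjective.self_of_nhds
      (fun j m => if j = p.1 ∧ m.1 = p.2.1 then 1 else 0)
    have h := DFunLike.congr_fun hc δ
    simp only [sum_apply, smul_apply,
      zero_apply] at h
    rw [Finset.sum_eq_single p] at h
    · have h2 := hδ p.1 ⟨p.2.1, p.2.2.trans_le (hA _)⟩
      simp only [and_self, if_true] at h2
      rw [h2] at h
      simpa using h
    · rintro ⟨j, m⟩ _ hne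
      have h2 := hδ j ⟨m.1, m.2.trans_le (hA _)⟩
      simp only at h2
      rw [h2, if_neg, smul_zero]
      rintro ⟨h3, h4⟩
      obtain ⟨pj, pm⟩ := p
      simp only at h3 h4
      subst h3
      exact hne (by rw [Fin.ext h4])
    · simp

/-- The first derivative of an output that depends on the inputs does so at `q₀`. -/
theorem free_of_rank (hrank : HasConstantRanks F φ N q₀ L) (j : Fin 3) {m : ℕ} (hm : m < L j)
    (hlow : ∀ m', m' < m → ∀ i, FreeNear (outDeriv F φ N j m') q₀ i 0)
    (h0 : ∀ i α, fderiv ℝ (outDeriv F φ N j m) q₀ (inputVec n N i α) = 0) (i : Fin 3) :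
    FreeNear (outDeriv F φ N j m) q₀ i 0 := by
  set A : Fin 3 → ℕ := fun j' => if j' = j then m + 1 else 0 with hA
  have hAL : ∀ j', A j' ≤ L j' := by
    intro j'
    simp only [hA]
    split_ifs with h
    · rw [h]; exact hm
    · exact Nat.zero_le _
  -- At q₀ all m + 1 covectors lie in ⟨dx⟩. They are independent, so the intersection has rank m + 1
  -- at q₀ and hence nearby, where m + 1 covectors then leave no room outside ⟨dx⟩.
  have hle : outCodist F φ N A q₀ ≤ stateCodist n N := by
    rw [outCodist_eq_span_range, Submodule.span_le]
    rintro _ ⟨⟨j', m'⟩, rfl⟩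
    have hm' := m'.2
    simp only [hA] at hm'
    by_cases h : j' = j
    · subst h
      rw [if_pos rfl] at hm'
      refine mem_stateCodist.2 fun i α => ?_
      rcases lt_or_eq_of_le (Nat.lt_succ_iff.1 hm') with h | h
      · exact (hlow _ h i).self_of_nhds α (Nat.zero_le _)
      · simp only [h]; exact h0 i α
    · rw [if_neg h] at hm'; omega
  filter_upwards [hrank A hAL] with q hq α _
  rw [inf_eq_left.2 hle, C.finrank_outCodist A hAL] at hq
  have heq : outCodist F φ N A q ⊓ stateCodist n N = outCodist F φ N A q :=
    Submodule.eq_of_le_of_finrank_le inf_le_left (by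
      rw [hq]; exact finrank_outCodist_le F φ A q)
  have hmem : fderiv ℝ (outDeriv F φ N j m) q ∈ outCodist F φ N A q :=
    Submodule.subset_span ⟨j, m, by simp [hA], rfl⟩
  rw [← heq] at hmem
  exact mem_stateCodist.1 hmem.2 i α

/-- Dichotomy for the second-longest prolonged input. -/
theorem symbol_zero_of_rank (hrank : HasConstantRanks F φ N q₀ L) {j₁ j₂ i₂ i₃ : Fin 3}
    (hj : j₁ ≠ j₂) (hi : i₂ ≠ i₃) (hD : ∀ i, i ≠ i₂ → i ≠ i₃ → D i = 0) (h2 : 0 < D i₂)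
    (h23 : D i₂ < D i₃) (hB1 : symbolMatrix F φ D L j₁ i₃ q₀ ≠ 0)
    (hB2 : ∀ᶠ q in 𝓝 q₀, symbolMatrix F φ D L j₂ i₃ q = 0)
    (hC : symbolMatrix F φ D L j₂ i₂ q₀ = 0) :
    ∀ᶠ q in 𝓝 q₀, symbolMatrix F φ D L j₂ i₂ q = 0 := by
  have hL1 : D i₃ < L j₁ := by
    by_contra h
    exact hB1 (C.eventually_symbol_zero j₁ i₃ (not_lt.1 h)).self_of_nhds
  rcases le_or_gt (L j₂) (D i₂) with hL2 | hL2
  · exact C.eventually_symbol_zero j₂ i₂ hL2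
  -- In these derivatives the input i₂ occurs only in the last one of φ^{j₂}, through u^{i₂}_[0]
  -- with the coefficient M j₂ i₂. The input i₃ occurs only in orders below D i₃ - D i₂; for the
  -- last derivative of φ^{j₂} this uses `hB2`. The unprolonged input does not occur.
  set A : Fin 3 → ℕ := fun j => if j = j₁ then L j₁ - D i₂ else if j = j₂ then L j₂ - D i₂ + 1 else 0
    with hA
  have hAL : ∀ j, A j ≤ L j := by
    intro j
    simp only [hA]
    split_ifs with h h'
    · rw [h]; omega
    · rw [h']; omega
    · exact Nat.zero_le _
  -- the covectors, near `q₀`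
  have hother : ∀ᶠ q in 𝓝 q₀, ∀ p : (j : Fin 3) × Fin (A j), ∀ i, i ≠ i₃ → ∀ α,
      fderiv ℝ (outDeriv F φ N p.1 p.2.1) q (inputVec n N i α) ≠ 0 →
        p.1 = j₂ ∧ p.2.1 = L j₂ - D i₂ ∧ i = i₂ ∧ α = 0 := by
    refine Filter.eventually_all.2 fun p => Filter.eventually_all.2 fun i => ?_
    by_cases hi3 : i = i₃
    · exact Filter.Eventually.of_forall fun q h => absurd hi3 h
    have hp := p.2.2
    obtain ⟨j, m⟩ := p
    simp only [hA] at hp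
    by_cases hj1 : j = j₁
    · subst hj1
      rw [if_pos rfl] at hp
      have : D i ≤ D i₂ := by
        by_cases h : i = i₂
        · rw [h]
        · rw [hD i h hi3]; exact Nat.zero_le _
      filter_upwards [C.free_of_lt j i (m := m.1) (b := 0) (by omega) (by omega)] with q hq _ α hne
      exact absurd (hq α (Nat.zero_le _)) hne
    · rw [if_neg hj1] at hp
      by_cases hj2 : j = j₂
      · subst hj2
        rw [if_pos rfl] at hp
        by_cases hi2 : i = i₂
        · subst hi2
          by_cases hm : m.1 = L j - D i
          · filter_upwards [C.free_of_lt j i (m := m.1) (b := 1) (by omega) (by omega)]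
              with q hq _ α hne
            refine ⟨rfl, hm, rfl, ?_⟩
            by_contra h
            exact hne (hq α (by omega))
          · filter_upwards [C.free_of_lt j i (m := m.1) (b := 0) (by omega) (by omega)]
              with q hq _ α hne
            exact absurd (hq α (Nat.zero_le _)) hne
        · have := hD i hi2 hi3
          filter_upwards [C.free_of_lt j i (m := m.1) (b := 0) (by omega) (by omega)]
            with q hq _ α hne
          exact absurd (hq α (Nat.zero_le _)) hne
      · rw [if_neg hj2] at hp; omega
  have hthird : ∀ᶠ q in 𝓝 q₀, ∀ p : (j : Fin 3) × Fin (A j), ∀ α, D i₃ - D i₂ ≤ α →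
      fderiv ℝ (outDeriv F φ N p.1 p.2.1) q (inputVec n N i₃ α) = 0 := by
    refine Filter.eventually_all.2 fun p => ?_
    have hp := p.2.2
    obtain ⟨j, m⟩ := p
    simp only [hA] at hp
    by_cases hj1 : j = j₁
    · subst hj1
      rw [if_pos rfl] at hp
      exact C.free_of_lt j i₃ (m := m.1) (by omega) (by omega)
    · rw [if_neg hj1] at hp
      by_cases hj2 : j = j₂
      · subst hj2
        rw [if_pos rfl] at hp
        by_cases hm : m.1 = L j - D i₂
        · have htop : FreeNear (outDeriv F φ N j (L j)) q₀ i₃ (D i₃) := by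
            filter_upwards [C.free_top_add j i₃ 0, hB2] with q hq1 hq2 α hα
            rcases eq_or_lt_of_le hα with rfl | h
            · exact hq2
            · exact hq1 α (by omega)
          refine free_outDeriv_of_add C.smoothF C.smoothφ j i₃ (D i₂)
            (by have := C.L_le j; simp only; omega) ?_
          rw [show (⟨j, m⟩ : (j : Fin 3) × Fin (A j)).2.1 + D i₂ = L j by simp only; omega,
            show D i₃ - D i₂ + D i₂ = D i₃ by omega]
          exact htop
        · exact C.free_of_lt j i₃ (m := m.1) (by omega) (by omega)
      · rw [if_neg hj2] at hp; omega
  have hspan : ∀ q : Jet n N, ∀ v : Jet n N,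
      (∀ p : (j : Fin 3) × Fin (A j), fderiv ℝ (outDeriv F φ N p.1 p.2.1) q v = 0) →
      ∀ η ∈ outCodist F φ N A q, η v = 0 := by
    intro q v hv η hη
    rw [outCodist_eq_span_range] at hη
    induction hη using Submodule.span_induction with
    | mem x hx => obtain ⟨p, rfl⟩ := hx; exact hv p
    | zero => rfl
    | add x y _ _ hx hy => simp [hx, hy]
    | smul a x _ hx => simp [hx]
  have hsym2 := C.eventually_symbol_eq j₂ i₂ (m := L j₂ - D i₂) (b := 0) (by omega) (by omega)
  have hmem1 : ∀ q, ∀ m, m < L j₁ - D i₂ →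
      fderiv ℝ (outDeriv F φ N j₁ m) q ∈ outCodist F φ N A q := fun q m hm =>
    Submodule.subset_span ⟨j₁, m, by simpa [hA] using hm, rfl⟩
  have hmem2 : ∀ q, fderiv ℝ (outDeriv F φ N j₂ (L j₂ - D i₂)) q ∈ outCodist F φ N A q := fun q =>
    Submodule.subset_span ⟨j₂, _, by simp [hA, hj.symm], rfl⟩
  -- At q₀ the coefficient of u^{i₂}_[0] is zero, so modulo ⟨dx⟩ only D i₃ - D i₂ directions are
  -- left.
  have hlow : finrank ℝ (outCodist F φ N A q₀) ≤
      finrank ℝ ↥(outCodist F φ N A q₀ ⊓ stateCodist n N) + (D i₃ - D i₂) := by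
    have := finrank_le_finrank_inf_add (outCodist F φ N A q₀) (stateCodist n N)
      (fun a : Fin (D i₃ - D i₂) => inputVec n N i₃ a.1) ?_
    · simpa using this
    · intro η hη h
      refine mem_stateCodist.2 fun i α => ?_
      by_cases hi3 : i = i₃
      · subst hi3
        rcases lt_or_ge α (D i - D i₂) with hα | hα
        · exact h ⟨α, hα⟩
        · exact hspan q₀ _ (fun p => hthird.self_of_nhds p α hα) η hη
      · refine hspan q₀ _ (fun p => ?_) η hη
        by_contra hne
        obtain ⟨h1, h2, rfl, rfl⟩ := hother.self_of_nhds p i hi3 α hne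
        apply hne
        obtain ⟨j', m'⟩ := p
        simp only at h1 h2
        subst h1
        simp only [h2]
        rw [hsym2.self_of_nhds]; exact hC
  -- Successive derivatives of φ^{j₁} have the leading variables u^{i₃}_[0], u^{i₃}_[1], … with the
  -- common nonzero coefficient M j₁ i₃.
  have htri : ∀ᶠ q in 𝓝 q₀, ∀ a : Fin (D i₃ - D i₂), (∀ α, a.1 + 1 ≤ α →
      fderiv ℝ (outDeriv F φ N j₁ (L j₁ - D i₃ + a.1)) q (inputVec n N i₃ α) = 0) ∧
      fderiv ℝ (outDeriv F φ N j₁ (L j₁ - D i₃ + a.1)) q (inputVec n N i₃ a.1) ≠ 0 := by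
    refine Filter.eventually_all.2 fun a => ?_
    have ha := a.2
    have hc : ∀ᶠ q in 𝓝 q₀, symbolMatrix F φ D L j₁ i₃ q ≠ 0 :=
      ((C.smooth_symbolMatrix j₁ i₃).self_of_nhds.continuousAt).eventually_ne hB1
    filter_upwards [C.free_of_lt j₁ i₃ (m := L j₁ - D i₃ + a.1) (b := a.1 + 1) (by omega) (by omega),
      C.eventually_symbol_eq j₁ i₃ (m := L j₁ - D i₃ + a.1) (b := a.1) (by omega) (by omega), hc]
      with q h1 h2 h3
    exact ⟨h1, by rw [h2]; exact h3⟩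
  filter_upwards [hrank A hAL, hother, hsym2, htri] with q hq hot hsq htq
  by_contra hne
  -- If M j₂ i₂ were nonzero at q, the direction u^{i₂}_[0] would be independent of the D i₃ - D i₂
  -- directions of i₃; the intersection with ⟨dx⟩ would lose a dimension compared with q₀.
  have hup := finrank_inf_add_le_finrank (outCodist F φ N A q) (stateCodist n N)
    (fun a : Option (Fin (D i₃ - D i₂)) => a.elim (inputVec n N i₂ 0) fun a => inputVec n N i₃ a.1)
    (fun η hη a => by cases a <;> exact mem_stateCodist.1 hη _ _) (by
      intro c hc
      have hc' : ∀ η ∈ outCodist F φ N A q,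
          c none * η (inputVec n N i₂ 0) + ∑ a, c (some a) * η (inputVec n N i₃ a.1) = 0 := by
        intro η hη
        simpa [Fintype.sum_option] using hc η hη
      have hsome : ∀ k, ∀ a : Fin (D i₃ - D i₂), a.1 = k → c (some a) = 0 := by
        intro k
        induction k using Nat.strong_induction_on with
        | _ k ih =>
        rintro a rfl
        have ha := a.2
        have h1 := hc' _ (hmem1 q (L j₁ - D i₃ + a.1) (by omega))
        have h2 : fderiv ℝ (outDeriv F φ N j₁ (L j₁ - D i₃ + a.1)) q (inputVec n N i₂ 0) = 0 := by
          by_contra hne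
          have hlt : L j₁ - D i₃ + a.1 < A j₁ := by simp only [hA, if_true]; omega
          exact hj (hot ⟨j₁, ⟨_, hlt⟩⟩ i₂ hi 0 hne).1
        rw [h2, mul_zero, zero_add, Finset.sum_eq_single a] at h1
        · exact (mul_eq_zero.1 h1).resolve_right (htq a).2
        · intro b _ hb
          rcases lt_or_gt_of_ne (fun h => hb (Fin.ext h) : b.1 ≠ a.1) with h | h
          · rw [ih b.1 h b rfl, zero_mul]
          · rw [(htq a).1 b.1 h, mul_zero]
        · simp
      have hnone : c none = 0 := by
        have h1 := hc' _ (hmem2 q)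
        rw [Finset.sum_eq_zero fun a _ => by rw [hsome a.1 a rfl, zero_mul], add_zero, hsq] at h1
        exact (mul_eq_zero.1 h1).resolve_right hne
      funext a
      cases a with
      | none => exact hnone
      | some a => exact hsome a.1 a rfl)
  have h1 := finrank_outCodist_le F φ A q
  rw [C.finrank_outCodist A hAL] at hlow
  simp only [Fintype.card_option, Fintype.card_fin] at hup
  omega

end FlatChart


/-! ### Coordinates of the triangular form as functions on the extended manifold -/

/-- The coordinates `Z` depend on `(x, u_[0,κ-1])` and the new inputs `V` on `(x, u_[0,κ])`, both
as local diffeomorphisms, and they satisfy the requirements of the triangular form at `q`. -/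
structure JetCoordsAt {n N : ℕ} (κ : ℕ) (I : GTFShape) (Z : Jet n N → I.State) (V : Jet n N → U)
    (c : LiftedCoeff (Jet n N)) (X q : Jet n N) : Prop extends GTFRelationsAt I Z V c X q where
  state_indep : ∀ δ, stateTrunc (fun _ => κ) δ = 0 → fderiv ℝ Z q δ = 0
  state_inj : ∀ δ, fderiv ℝ Z q δ = 0 → stateTrunc (fun _ => κ) δ = 0
  input_inj : ∀ δ, stateTrunc (fun _ => κ) δ = 0 → fderiv ℝ V q δ = 0 →
    stateTrunc (fun _ => κ + 1) δ = 0
  indep2 : ∀ l, I.k2 ≤ l → l < I.p2 → ∀ δ, stateTrunc (fun _ => κ) δ = 0 →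
    fderiv ℝ (c.a2 l) q δ = 0 ∧ fderiv ℝ (c.b21 l) q δ = 0
  indep3 : ∀ l, I.k3 ≤ l → l < I.r3 → ∀ δ, stateTrunc (fun _ => κ) δ = 0 →
    fderiv ℝ (c.a3 l) q δ = 0 ∧ fderiv ℝ (c.b31 l) q δ = 0
  indep32 : ∀ l, I.p3 ≤ l → l < I.r3 → ∀ δ, stateTrunc (fun _ => κ) δ = 0 →
    fderiv ℝ (c.b32 l) q δ = 0

/-- The pull-back of coefficient functions. -/
def LiftedCoeff.comp {E E' : Type} (c : LiftedCoeff E) (Λ : E' → E) : LiftedCoeff E' :=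
  ⟨fun l p => c.a2 l (Λ p), fun l p => c.b21 l (Λ p), fun l p => c.a3 l (Λ p),
    fun l p => c.b31 l (Λ p), fun l p => c.b32 l (Λ p)⟩

/-- At `p` the map `Λ` identifies `S × U` with the space of all `(x, u_[0,κ])`, the states
with `(x, u_[0,κ-1])`, and the system `G` with the `κ`-fold prolongation of `F`. -/
structure JetLiftAt {n N : ℕ} {S : Type} [NormedAddCommGroup S] [NormedSpace ℝ S]
    (F : (Fin n → ℝ) → U → (Fin n → ℝ)) (κ : ℕ) (G : S → U → S) (Λ : S × U → Jet n N)
    (p : S × U) : Prop where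
  smooth : ContDiffAt ℝ ∞ Λ p
  state : ∀ δ, stateTrunc (fun _ => κ) (fderiv ℝ Λ p δ) = 0 ↔ δ.1 = 0
  inj : ∀ δ, stateTrunc (fun _ => κ + 1) (fderiv ℝ Λ p δ) = 0 → δ = 0
  velocity : stateTrunc (fun _ => κ) (fderiv ℝ Λ p (G p.1 p.2, 0)) =
    stateTrunc (fun _ => κ) (jetField F N (Λ p))

/-- Every requirement concerns differentials along tangent vectors, so the chain rule transports it.
The velocities need to agree only in (x, u_[0,κ-1]), because Z sees nothing else. -/
theorem JetCoordsAt.comp {n N κ : ℕ} {S : Type} [NormedAddCommGroup S] [NormedSpace ℝ S]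
    {F : (Fin n → ℝ) → U → (Fin n → ℝ)} {G : S → U → S} {Λ : S × U → Jet n N} {p : S × U}
    {I : GTFShape} {Z : Jet n N → I.State} {V : Jet n N → U} {c : LiftedCoeff (Jet n N)}
    (h : JetCoordsAt κ I Z V c (jetField F N (Λ p)) (Λ p)) (hΛ : JetLiftAt F κ G Λ p) :
    GTFCoordsAt G I (fun p => Z (Λ p)) (fun p => V (Λ p)) (c.comp Λ) p := by
  have hd := (hΛ.smooth.differentiableAt (by simp)).hasFDerivAt
  have chain : ∀ {W : Type} [NormedAddCommGroup W] [NormedSpace ℝ W] {A : Jet n N → W},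
      ContDiffAt ℝ ∞ A (Λ p) → ∀ δ, fderiv ℝ (fun p => A (Λ p)) p δ =
        fderiv ℝ A (Λ p) (fderiv ℝ Λ p δ) := fun hA δ =>
    DFunLike.congr_fun ((hA.differentiableAt (by simp)).hasFDerivAt.comp p hd).fderiv δ
  have hsm : ∀ {W : Type} [NormedAddCommGroup W] [NormedSpace ℝ W] {A : Jet n N → W},
      ContDiffAt ℝ ∞ A (Λ p) → ContDiffAt ℝ ∞ (fun p => A (Λ p)) p := fun hA =>
    ContDiffAt.comp p hA hΛ.smooth
  have hZ := fun δ => chain h.smooth_state δ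
  have hV := fun δ => chain h.smooth_input δ
  have hw : ∀ δw : U, stateTrunc (fun _ => κ) (fderiv ℝ Λ p (0, δw)) = 0 := fun δw =>
    (hΛ.state _).2 rfl
  have hV0 : ContDiffAt ℝ ∞ (fun q => V q 0) (Λ p) := contDiffAt_pi.1 h.smooth_input 0
  have hV1 : ContDiffAt ℝ ∞ (fun q => V q 1) (Λ p) := contDiffAt_pi.1 h.smooth_input 1
  refine
    { smooth_state := hsm h.smooth_state
      smooth_input := hsm h.smooth_input
      state_indep := fun δw => by rw [hZ]; exact h.state_indep _ (hw δw)
      state_inj := fun δs hs => by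
        rw [hZ] at hs
        exact (hΛ.state _).1 (h.state_inj _ hs)
      input_inj := fun δw hs => by
        rw [hV] at hs
        exact congrArg Prod.snd (hΛ.inj _ (h.input_inj _ (hw δw) hs))
      smooth2 := fun l h1 h2 => ⟨hsm (h.smooth2 l h1 h2).1, hsm (h.smooth2 l h1 h2).2⟩
      smooth3 := fun l h1 h2 => ⟨hsm (h.smooth3 l h1 h2).1, hsm (h.smooth3 l h1 h2).2⟩
      smooth32 := fun l h1 h2 => hsm (h.smooth32 l h1 h2)
      indep2 := fun l h1 h2 δw => by
        refine ⟨(chain (h.smooth2 l h1 h2).1 _).trans (h.indep2 l h1 h2 _ (hw δw)).1,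
          (chain (h.smooth2 l h1 h2).2 _).trans (h.indep2 l h1 h2 _ (hw δw)).2⟩
      indep3 := fun l h1 h2 δw => by
        refine ⟨(chain (h.smooth3 l h1 h2).1 _).trans (h.indep3 l h1 h2 _ (hw δw)).1,
          (chain (h.smooth3 l h1 h2).2 _).trans (h.indep3 l h1 h2 _ (hw δw)).2⟩
      indep32 := fun l h1 h2 δw =>
        (chain (h.smooth32 l h1 h2) _).trans (h.indep32 l h1 h2 _ (hw δw))
      dynamics := ?_
      dep2 := ?_
      dep3 := ?_
      dep3' := ?_
      b21_ne := h.b21_ne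
      b31_ne := h.b31_ne
      reg1 := ?_
      reg2 := ?_
      reg3 := ?_ }
  · rw [hZ]
    have h0 : fderiv ℝ Z (Λ p) (fderiv ℝ Λ p (G p.1 p.2, 0) - jetField F N (Λ p)) = 0 :=
      h.state_indep _ (by rw [map_sub, hΛ.velocity, sub_self])
    rw [map_sub, sub_eq_zero] at h0
    rw [h0, h.dynamics]; rfl
  · intro i hi δ h1 h2
    rw [hV] at h1
    rw [hZ] at h2
    have hs := h.smooth2 (I.k2 + i) (Nat.le_add_right _ _) hi
    exact ⟨(chain hs.1 _).trans (h.dep2 i hi _ h1 h2).1,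
      (chain hs.2 _).trans (h.dep2 i hi _ h1 h2).2⟩
  · intro i hi δ h1 h2
    rw [hV] at h1
    rw [hZ] at h2
    have hs := h.smooth3 (I.k3 + i) (Nat.le_add_right _ _) (hi.trans_le I.p3_le_r3)
    exact ⟨(chain hs.1 _).trans (h.dep3 i hi _ h1 h2).1,
      (chain hs.2 _).trans (h.dep3 i hi _ h1 h2).2⟩
  · intro l hl hl' δ h1 h2
    rw [hV] at h1
    rw [hZ] at h2
    have hk : I.k3 ≤ I.p3 := by have := I.p3_sub_k3; have := I.k2_le_p2; omega
    have hs := h.smooth3 l (hk.trans hl) hl'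
    have hh := h.dep3' l hl hl' _ h1 h2
    exact ⟨(chain hs.1 _).trans hh.1, (chain hs.2 _).trans hh.2.1,
      (chain (h.smooth32 l hl hl') _).trans hh.2.2⟩
  · intro i hi δ h1 h2
    rw [hV] at h1
    rw [hZ] at h2
    have hlt : I.k3 + i < I.r3 := by
      have := I.p3_sub_k3; have := I.k2_le_p2; have := I.p3_le_r3; omega
    have hs := h.smooth3 (I.k3 + i) (Nat.le_add_right _ _) hlt
    have hh := h.reg1 i hi _ h1 h2
    rwa [← chain (hs.1.add (hs.2.mul hV0))] at hh
  · intro i hi δ α β h1 h2 h3 h4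
    rw [hV] at h1
    rw [hZ] at h2
    have hlt : I.k3 + I.δ + i < I.r3 := by
      have := I.p3_sub_k3; have := I.k2_le_p2; have := I.p3_le_r3; omega
    have hs2 := h.smooth2 (I.k2 + i) (Nat.le_add_right _ _) hi
    have hs3 := h.smooth3 (I.k3 + I.δ + i) (by omega) hlt
    refine h.reg2 i hi _ α β h1 h2 ?_ ?_
    · rw [← chain (hs2.1.add (hs2.2.mul hV0))]; exact h3
    · rw [← chain (hs3.1.add (hs3.2.mul hV0))]; exact h4
  · intro l hl hl' δ h1 h2
    rw [hV] at h1
    rw [hZ] at h2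
    have hk : I.k3 ≤ I.p3 := by have := I.p3_sub_k3; have := I.k2_le_p2; omega
    have hs := h.smooth3 l (hk.trans hl) hl'
    have hs' := h.smooth32 l hl hl'
    have hh := h.reg3 l hl hl' _ h1 h2
    rwa [← chain ((hs.1.add (hs.2.mul hV0)).add (hs'.mul hV1))] at hh


/-! ### The coordinates of the triangular form -/

theorem coord_succ {m : ℕ} (w : Fin m → ℝ) {l : ℕ} (hl : l < m) : coord w (l + 1) = w ⟨l, hl⟩ := by
  simp [coord, hl]

/-- The data from which the coordinates of the triangular form are built: orderings `σ` of the
outputs and `ρ` of the inputs, the integer `e`, and the functions `b21`, `b31`, `b32`. -/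
structure TriData (n N : ℕ) where
  F : (Fin n → ℝ) → U → (Fin n → ℝ)
  φ : Fin 3 → (Fin n → ℝ) → ℝ
  D : Fin 3 → ℕ
  R : Fin 3 → ℕ
  σ : Equiv.Perm (Fin 3)
  ρ : Equiv.Perm (Fin 3)
  e : ℕ
  b21 : Jet n N → ℝ
  b31 : Jet n N → ℝ
  b32 : Jet n N → ℝ

namespace TriData

variable {n N : ℕ} (T : TriData n N)

/-- The number of prolongations of the `k`-th input. -/
def d (k : Fin 3) : ℕ := T.D (T.ρ k)

/-- The order of the `k`-th output. -/
def r (k : Fin 3) : ℕ := T.R (T.σ k)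

/-- The derivatives of the `k`-th input. -/
def u (k : Fin 3) (α : ℕ) : Jet n N →L[ℝ] ℝ := inputFun n N (T.ρ k) α

/-- The derivatives of the `k`-th output. -/
def y (k : Fin 3) (m : ℕ) : Jet n N → ℝ := outDeriv T.F T.φ N (T.σ k) m

/-- The entries of the matrix `∂φ_[R]/∂u_[D]`. -/
def s (k l : Fin 3) : Jet n N → ℝ := symbolMatrix T.F T.φ T.D T.R (T.σ k) (T.ρ l)

/-- Input 0 is not prolonged and input 2 is prolonged most often. The integer e must leave d 2 - d 1
- e ≥ 0 derivatives of input 1 to complete z₂. -/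
structure Admissible : Prop where
  d_zero : T.d 0 = 0
  d_one_add_le : T.d 1 + T.e ≤ T.d 2
  d_two_pos : 0 < T.d 2
  d_lt : ∀ k, T.d k < N
  r_pos : ∀ k, 0 < T.r k

/-- The coordinates `z₂`, and the function that follows them. -/
def z2 (l : ℕ) : Jet n N → ℝ :=
  if l < T.r 1 + T.e then T.y 1 l else T.u 1 (T.d 1 + l - T.r 1)

/-- The coordinates `z₃`, and the function that follows them. -/
def z3 (l : ℕ) : Jet n N → ℝ := if l < T.r 2 then T.y 2 l else T.u 0 (l - T.r 2)

/-- The second input. -/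
def v2 : Jet n N → ℝ :=
  if T.d 1 + T.e < T.d 2 then T.u 1 (T.d 2) else T.y 1 (T.r 1 + T.e)

variable {T}

/-- The shape of the triangular form. -/
def Admissible.shape (h : T.Admissible) : GTFShape where
  k1 := T.r 0
  k2 := T.r 1 + T.e
  k3 := T.r 2
  p2 := T.r 1 + (T.d 2 - T.d 1)
  p3 := T.r 2 + (T.d 2 - T.d 1)
  r3 := T.r 2 + T.d 2
  δ := T.e
  one_le_k1 := h.r_pos 0
  one_le_k2 := (h.r_pos 1).trans_le (Nat.le_add_right _ _)
  one_le_k3 := h.r_pos 2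
  k2_le_p2 := by have := h.d_one_add_le; omega
  p3_le_r3 := by omega
  p3_sub_k3 := by omega

/-- The coordinates of the triangular form. -/
def Admissible.state (h : T.Admissible) : Jet n N → h.shape.State := fun q =>
  (fun l => T.y 0 l.1 q, fun l => T.z2 l.1 q, fun l => T.z3 l.1 q)

variable (T) in
/-- The inputs of the triangular form. -/
def input : Jet n N → U := fun q => ![T.y 0 (T.r 0) q, T.v2 q, T.u 0 (T.d 2) q]

variable (T) in
/-- The coefficients of the triangular form. -/
def coeff : LiftedCoeff (Jet n N) where
  a2 l := if l = T.r 1 + T.e then fun q => T.y 1 (T.r 1 + T.e) q - T.b21 q * T.y 0 (T.r 0) q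
    else T.z2 l
  b21 l := if l = T.r 1 + T.e then T.b21 else 0
  a3 l := if l = T.r 2 then
      fun q => T.y 2 (T.r 2) q - T.b31 q * T.y 0 (T.r 0) q - T.b32 q * T.v2 q
    else T.z3 l
  b31 l := if l = T.r 2 then T.b31 else 0
  b32 l := if l = T.r 2 then T.b32 else 0

variable (T) in
/-- The properties of the data at a point that make the coordinates triangular. -/
structure TriangularAt (q : Jet n N) : Prop where
  smooth_y : ∀ k m, m ≤ T.r k + T.e → ContDiffAt ℝ ∞ (T.y k m) q
  smooth_b21 : ContDiffAt ℝ ∞ T.b21 q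
  smooth_b31 : ContDiffAt ℝ ∞ T.b31 q
  smooth_b32 : ContDiffAt ℝ ∞ T.b32 q
  inj : ∀ δ, (∀ k m, m < T.r k → fderiv ℝ (T.y k m) q δ = 0) → stateTrunc T.D δ = 0
  vanish : ∀ δ, stateTrunc T.D δ = 0 → ∀ k m, m < T.r k → fderiv ℝ (T.y k m) q δ = 0
  inj_top : ∀ δ, stateTrunc T.D δ = 0 → (∀ k, fderiv ℝ (T.y k (T.r k)) q δ = 0) →
    ∀ k, T.u k (T.d k) δ = 0
  lead : ∀ δ, stateTrunc T.D δ = 0 → ∀ k, fderiv ℝ (T.y k (T.r k)) q δ =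
    T.s k 0 q * T.u 0 0 δ + T.s k 1 q * T.u 1 (T.d 1) δ + T.s k 2 q * T.u 2 (T.d 2) δ
  lead2 : ∀ l, l ≤ T.e → ∀ δ, stateTrunc T.D δ = 0 → (∀ α, α ≤ l → T.u 0 α δ = 0) →
    (∀ α, α < T.d 1 + l → T.u 1 α δ = 0) → fderiv ℝ (T.y 1 (T.r 1 + l)) q δ =
      T.s 1 1 q * T.u 1 (T.d 1 + l) δ +
        fderiv ℝ (T.y 1 (T.r 1 + l)) q (inputVec n N (T.ρ 2) (T.d 2)) * T.u 2 (T.d 2) δ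
  sym_zero : ∀ l, l < T.e →
    fderiv ℝ (T.y 1 (T.r 1 + l)) q (inputVec n N (T.ρ 2) (T.d 2)) = 0
  sym_ne : 0 < T.e → T.s 1 1 q ≠ 0
  b21_eq : T.d 1 + T.e < T.d 2 →
    fderiv ℝ (T.y 1 (T.r 1 + T.e)) q (inputVec n N (T.ρ 2) (T.d 2)) = T.b21 q * T.s 0 2 q
  b21_dep : T.d 1 + T.e < T.d 2 → ∀ δ, stateTrunc T.D δ = 0 → (∀ α, α ≤ T.e → T.u 0 α δ = 0) →
    (∀ α, α ≤ T.d 1 + T.e → T.u 1 α δ = 0) → fderiv ℝ T.b21 q δ = 0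
  b31_dep : ∀ δ, stateTrunc T.D δ = 0 → fderiv ℝ T.b31 q δ = 0
  b32_dep : ∀ δ, stateTrunc T.D δ = 0 → fderiv ℝ T.b32 q δ = 0
  b32_zero : T.d 1 < T.d 2 → T.b32 q = 0
  b3_eq : T.s 2 2 q = T.b31 q * T.s 0 2 q + T.b32 q * T.s 1 2 q
  b3_eq' : T.d 1 = T.d 2 → T.s 2 1 q = T.b31 q * T.s 0 1 q + T.b32 q * T.s 1 1 q
  s02_ne : T.d 1 < T.d 2 → T.s 0 2 q ≠ 0
  det_ne : T.d 1 = T.d 2 → T.s 0 1 q * T.s 1 2 q - T.s 0 2 q * T.s 1 1 q ≠ 0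
  b21_ne : T.d 1 + T.e < T.d 2 → T.b21 q ≠ 0
  b31_ne : T.b31 q ≠ 0

theorem stateTrunc_eq_zero_iff {δ : Jet n N} :
    stateTrunc T.D δ = 0 ↔ δ.1 = 0 ∧ ∀ k α, α < T.d k → T.u k α δ = 0 := by
  rw [stateTrunc_eq_zero]
  refine and_congr Iff.rfl ⟨fun h k α hα => h _ α hα, fun h i α hα => ?_⟩
  have := h (T.ρ.symm i) α
  simp only [d, u, Equiv.apply_symm_apply] at this
  exact this hα

theorem stateTrunc_const_eq_zero_iff {κ : ℕ} {δ : Jet n N} :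
    stateTrunc (fun _ => κ) δ = 0 ↔ δ.1 = 0 ∧ ∀ k α, α < κ → T.u k α δ = 0 := by
  rw [stateTrunc_eq_zero]
  refine and_congr Iff.rfl ⟨fun h k α hα => h _ α hα, fun h i α hα => ?_⟩
  have := h (T.ρ.symm i) α
  simp only [u, Equiv.apply_symm_apply] at this
  exact this hα

theorem forall_fin_three {P : Fin 3 → Prop} : (∀ k, P k) ↔ P 0 ∧ P 1 ∧ P 2 :=
  ⟨fun h => ⟨h 0, h 1, h 2⟩, fun ⟨h0, h1, h2⟩ k => by fin_cases k <;> assumption⟩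

theorem z2_of_lt {l : ℕ} (hl : l < T.r 1 + T.e) : T.z2 l = T.y 1 l := if_pos hl

theorem z2_of_ge {l : ℕ} (hl : T.r 1 + T.e ≤ l) : T.z2 l = T.u 1 (T.d 1 + l - T.r 1) :=
  if_neg (not_lt.2 hl)

theorem z3_of_lt {l : ℕ} (hl : l < T.r 2) : T.z3 l = T.y 2 l := if_pos hl

theorem z3_of_ge {l : ℕ} (hl : T.r 2 ≤ l) : T.z3 l = T.u 0 (l - T.r 2) := if_neg (not_lt.2 hl)

theorem fderiv_u (k : Fin 3) (α : ℕ) (q δ : Jet n N) :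
    fderiv ℝ (T.u k α) q δ = T.u k α δ := by rw [ContinuousLinearMap.fderiv]

theorem fderiv_z2_of_ge {l : ℕ} (hl : T.r 1 + T.e ≤ l) (q δ : Jet n N) :
    fderiv ℝ (T.z2 l) q δ = T.u 1 (T.d 1 + l - T.r 1) δ := by rw [z2_of_ge hl, fderiv_u]

theorem fderiv_z3_of_ge {l : ℕ} (hl : T.r 2 ≤ l) (q δ : Jet n N) :
    fderiv ℝ (T.z3 l) q δ = T.u 0 (l - T.r 2) δ := by rw [z3_of_ge hl, fderiv_u]

theorem tau_u (k : Fin 3) {α : ℕ} (hα : α < N) (q : Jet n N) :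
    fderiv ℝ (T.u k α) q (jetField T.F N q) = T.u k (α + 1) q := by
  rw [fderiv_u]; exact inputFun_jetField T.F q _ hα

theorem tau_y (k : Fin 3) (m : ℕ) (q : Jet n N) :
    fderiv ℝ (T.y k m) q (jetField T.F N q) = T.y k (m + 1) q := by
  rw [y, y, outDeriv_succ]; rfl

theorem fderiv_sub_mul {q : Jet n N} {A B b : Jet n N → ℝ} (hA : ContDiffAt ℝ ∞ A q) (hB : ContDiffAt ℝ ∞ B q)
    (hb : ContDiffAt ℝ ∞ b q) (δ : Jet n N) :
    fderiv ℝ (fun q => A q - b q * B q) q δ =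
      fderiv ℝ A q δ - (b q * fderiv ℝ B q δ + B q * fderiv ℝ b q δ) := by
  have hd : ∀ {A : Jet n N → ℝ}, ContDiffAt ℝ ∞ A q → HasFDerivAt A (fderiv ℝ A q) q :=
    fun hA => (hA.differentiableAt (by simp)).hasFDerivAt
  exact DFunLike.congr_fun ((hd hA).sub ((hd hb).mul (hd hB))).fderiv δ

namespace TriangularAt

variable {q : Jet n N} (h : T.TriangularAt q) (hT : T.Admissible)
include h

theorem smooth_z2 (l : ℕ) : ContDiffAt ℝ ∞ (T.z2 l) q := by
  rcases lt_or_ge l (T.r 1 + T.e) with hl | hl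
  · rw [z2_of_lt hl]; exact h.smooth_y 1 l hl.le
  · rw [z2_of_ge hl]; exact (T.u _ _).contDiff.contDiffAt

theorem smooth_z3 (l : ℕ) : ContDiffAt ℝ ∞ (T.z3 l) q := by
  rcases lt_or_ge l (T.r 2) with hl | hl
  · rw [z3_of_lt hl]; exact h.smooth_y 2 l (by omega)
  · rw [z3_of_ge hl]; exact (T.u _ _).contDiff.contDiffAt

theorem smooth_v2 : ContDiffAt ℝ ∞ T.v2 q := by
  unfold v2
  split_ifs
  · exact (T.u _ _).contDiff.contDiffAt
  · exact h.smooth_y 1 _ le_rfl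

theorem smooth_state : ContDiffAt ℝ ∞ hT.state q := by
  refine ContDiffAt.prodMk (contDiffAt_pi.2 fun l => h.smooth_y 0 _ ?_)
    (ContDiffAt.prodMk (contDiffAt_pi.2 fun l => h.smooth_z2 _)
      (contDiffAt_pi.2 fun l => h.smooth_z3 _))
  have : l.1 < T.r 0 := l.2
  omega

theorem smooth_input : ContDiffAt ℝ ∞ T.input q := by
  refine contDiffAt_pi.2 fun k => ?_
  fin_cases k
  · exact h.smooth_y 0 _ (Nat.le_add_right _ _)
  · exact h.smooth_v2
  · exact (T.u _ _).contDiff.contDiffAt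

theorem fderiv_state (δ : Jet n N) : fderiv ℝ hT.state q δ =
    (fun l => fderiv ℝ (T.y 0 l.1) q δ, fun l => fderiv ℝ (T.z2 l.1) q δ,
      fun l => fderiv ℝ (T.z3 l.1) q δ) := by
  have hd : ∀ {A : Jet n N → ℝ}, ContDiffAt ℝ ∞ A q → HasFDerivAt A (fderiv ℝ A q) q :=
    fun hA => (hA.differentiableAt (by simp)).hasFDerivAt
  have h1 : HasFDerivAt (fun q => (fun l => T.y 0 l.1 q : Fin hT.shape.k1 → ℝ)) _ q :=
    hasFDerivAt_pi.2 fun l => hd (h.smooth_y 0 l.1 (by have : l.1 < T.r 0 := l.2; omega))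
  have h2 : HasFDerivAt (fun q => (fun l => T.z2 l.1 q : Fin hT.shape.p2 → ℝ)) _ q :=
    hasFDerivAt_pi.2 fun l => hd (h.smooth_z2 l.1)
  have h3 : HasFDerivAt (fun q => (fun l => T.z3 l.1 q : Fin hT.shape.r3 → ℝ)) _ q :=
    hasFDerivAt_pi.2 fun l => hd (h.smooth_z3 l.1)
  have := (h1.prodMk (h2.prodMk h3)).fderiv
  exact DFunLike.congr_fun this δ

theorem fderiv_input (δ : Jet n N) : fderiv ℝ T.input q δ =
    ![fderiv ℝ (T.y 0 (T.r 0)) q δ, fderiv ℝ T.v2 q δ, T.u 0 (T.d 2) δ] := by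
  have hs := h.smooth_input
  have hd := hasFDerivAt_pi'.1 (hs.differentiableAt (by simp)).hasFDerivAt
  funext k
  have := DFunLike.congr_fun (hd k).fderiv δ
  refine this.symm.trans ?_
  fin_cases k
  · rfl
  · rfl
  · exact fderiv_u _ _ _ _

theorem fderiv_input_eq_zero {δ : Jet n N} (hδ : fderiv ℝ T.input q δ = 0) :
    fderiv ℝ (T.y 0 (T.r 0)) q δ = 0 ∧ fderiv ℝ T.v2 q δ = 0 ∧ T.u 0 (T.d 2) δ = 0 := by
  rw [h.fderiv_input] at hδ
  exact ⟨congrFun hδ 0, congrFun hδ 1, congrFun hδ 2⟩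

theorem of_kills {l₂ l₃ : ℤ} {δ : Jet n N} (hδ : hT.shape.Kills l₂ l₃ (fderiv ℝ hT.state q δ)) :
    (∀ l, l < T.r 0 → fderiv ℝ (T.y 0 l) q δ = 0) ∧
    (∀ l : ℕ, (l : ℤ) + 1 ≤ l₂ → l < T.r 1 + (T.d 2 - T.d 1) → fderiv ℝ (T.z2 l) q δ = 0) ∧
    (∀ l : ℕ, (l : ℤ) + 1 ≤ l₃ → l < T.r 2 + T.d 2 → fderiv ℝ (T.z3 l) q δ = 0) := by
  rw [h.fderiv_state] at hδ
  obtain ⟨h1, h2, h3⟩ := hδ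
  refine ⟨fun l hl => congrFun h1 ⟨l, hl⟩, fun l hl hl' => ?_, fun l hl hl' => ?_⟩
  · have := h2 (l + 1) (by push_cast; exact hl)
    rwa [coord_succ _ (show l < hT.shape.p2 from hl')] at this
  · have := h3 (l + 1) (by push_cast; exact hl)
    rwa [coord_succ _ (show l < hT.shape.r3 from hl')] at this

theorem of_unit {a b : ℕ} {α β : ℝ} {δ : Jet n N}
    (hδ : fderiv ℝ hT.state q δ = (0, α • unitVec _ (a + 1), β • unitVec _ (b + 1))) :
    (∀ l, l < T.r 0 → fderiv ℝ (T.y 0 l) q δ = 0) ∧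
    (∀ l : ℕ, l < T.r 1 + (T.d 2 - T.d 1) → fderiv ℝ (T.z2 l) q δ = if l = a then α else 0) ∧
    (∀ l : ℕ, l < T.r 2 + T.d 2 → fderiv ℝ (T.z3 l) q δ = if l = b then β else 0) := by
  rw [h.fderiv_state] at hδ
  refine ⟨fun l hl => congrFun (congrArg Prod.fst hδ) ⟨l, hl⟩, fun l hl => ?_, fun l hl => ?_⟩
  · refine (congrFun (congrArg (fun z => z.2.1) hδ) ⟨l, hl⟩).trans ?_
    simp [unitVec]
  · refine (congrFun (congrArg (fun z => z.2.2) hδ) ⟨l, hl⟩).trans ?_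
    simp [unitVec]

/-- The outputs of order below `R` determine the states of the prolonged system. -/
theorem trunc_eq_zero {δ : Jet n N} (h1 : ∀ l, l < T.r 0 → fderiv ℝ (T.y 0 l) q δ = 0)
    (h2 : ∀ l, l < T.r 1 → fderiv ℝ (T.z2 l) q δ = 0)
    (h3 : ∀ l, l < T.r 2 → fderiv ℝ (T.z3 l) q δ = 0) : stateTrunc T.D δ = 0 := by
  refine h.inj δ (forall_fin_three.2 ⟨h1, fun m hm => ?_, fun m hm => ?_⟩)
  · have := h2 m hm
    rwa [z2_of_lt (by omega)] at this
  · have := h3 m hm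
    rwa [z3_of_lt hm] at this

/-- The functions y 1 (r 1 + l), l < m, do not contain the derivative of order d 2 of input 2, and
each has the new leading variable u 1 (d 1 + l) with the coefficient s 1 1 ≠ 0. Their vanishing
removes these variables one after the other. -/
theorem u1_eq_zero {m : ℕ} (hm : m ≤ T.e) {δ : Jet n N} (hδ : stateTrunc T.D δ = 0)
    (h0 : ∀ α, α < m → T.u 0 α δ = 0)
    (hy : ∀ l, l < m → fderiv ℝ (T.y 1 (T.r 1 + l)) q δ = 0) :
    ∀ α, α < T.d 1 + m → T.u 1 α δ = 0 := by
  induction m with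
  | zero => exact fun α hα => (stateTrunc_eq_zero_iff.1 hδ).2 1 α hα
  | succ m ih =>
    have ih' := ih (by omega) (fun α hα => h0 α (by omega)) fun l hl => hy l (by omega)
    have hl := h.lead2 m (by omega) δ hδ (fun α hα => h0 α (by omega)) ih'
    rw [hy m (by omega), h.sym_zero m (by omega), zero_mul, add_zero] at hl
    have h1 := (mul_eq_zero.1 hl.symm).resolve_left (h.sym_ne (by omega))
    intro α hα
    rcases Nat.lt_succ_iff_lt_or_eq.1 (show α < (T.d 1 + m) + 1 by omega) with h2 | rfl
    · exact ih' α h2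
    · exact h1

/-- The multiple b21 of y 0 (r 0) is chosen so that u 2 (d 2) cancels; the remaining leading
variables are those assumed to be zero. -/
theorem fderiv_a2_eq_zero (he : T.d 1 + T.e < T.d 2) {δ : Jet n N}
    (hδ : stateTrunc T.D δ = 0)
    (h0 : ∀ α, α ≤ T.e → T.u 0 α δ = 0) (h1 : ∀ α, α ≤ T.d 1 + T.e → T.u 1 α δ = 0) :
    fderiv ℝ (T.coeff.a2 (T.r 1 + T.e)) q δ = 0 := by
  simp only [coeff, if_true]
  rw [fderiv_sub_mul (h.smooth_y 1 _ le_rfl) (h.smooth_y 0 _ (Nat.le_add_right _ _))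
    h.smooth_b21, h.b21_dep he δ hδ h0 h1, h.lead2 T.e le_rfl δ hδ h0 fun α hα => h1 α hα.le,
    h.lead δ hδ, h.b21_eq he, h1 _ le_rfl, h0 0 (Nat.zero_le _), h1 (T.d 1) (Nat.le_add_right _ _)]
  ring

/-- Here b31 and b32 cancel u 2 (d 2), and also u 1 (d 1) if d 1 = d 2. In the latter case e = 0 and
the second new input is y 1 (r 1), which makes the cancellation possible. -/
theorem fderiv_a3_eq_zero (hT : T.Admissible) {δ : Jet n N} (hδ : stateTrunc T.D δ = 0)
    (h0 : T.u 0 0 δ = 0) (h1 : T.d 1 < T.d 2 → T.u 1 (T.d 1) δ = 0) :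
    fderiv ℝ (T.coeff.a3 (T.r 2)) q δ = 0 := by
  simp only [coeff, if_true]
  have hs1 := h.smooth_y 2 (T.r 2) (Nat.le_add_right _ _)
  have hs2 := h.smooth_y 0 (T.r 0) (Nat.le_add_right _ _)
  rw [fderiv_sub_mul (hs1.sub (h.smooth_b31.mul hs2)) h.smooth_v2 h.smooth_b32,
    fderiv_sub_mul hs1 hs2 h.smooth_b31, h.b31_dep δ hδ, h.b32_dep δ hδ, h.lead δ hδ,
    h.lead δ hδ, h0]
  rcases lt_or_ge (T.d 1) (T.d 2) with hd | hd
  · have h3 := h.b3_eq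
    rw [h.b32_zero hd] at h3 ⊢
    rw [h1 hd, h3]
    ring
  · have hde := hT.d_one_add_le
    have he : T.e = 0 := by omega
    have hv : T.v2 = T.y 1 (T.r 1) := by
      unfold v2; rw [if_neg (by omega), he, add_zero]
    rw [hv, h.lead δ hδ, h0, h.b3_eq, h.b3_eq' (by omega)]
    ring

end TriangularAt

end TriData


/-! ### Verification of the requirements of the triangular form -/

namespace TriData

section
variable {n N : ℕ} {T : TriData n N} (hT : T.Admissible)
include hT

theorem Admissible.trunc_of_const {δ : Jet n N} (hδ : stateTrunc (fun _ => T.d 2) δ = 0) :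
    stateTrunc T.D δ = 0 := by
  rw [stateTrunc_const_eq_zero_iff (T := T)] at hδ
  refine stateTrunc_eq_zero_iff.2 ⟨hδ.1, fun k α hα => hδ.2 k α (hα.trans_le ?_)⟩
  have h0 := hT.d_zero
  have h1 := hT.d_one_add_le
  fin_cases k
  · change T.d 0 ≤ T.d 2; omega
  · change T.d 1 ≤ T.d 2; omega
  · exact le_rfl

theorem Admissible.v2_of_le (hd : T.d 2 ≤ T.d 1) : T.v2 = T.y 1 (T.r 1) := by
  have he := hT.d_one_add_le
  unfold v2
  rw [if_neg (by omega), show T.e = 0 by omega, add_zero]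

end

section
variable {n N : ℕ} {T : TriData n N} {l : ℕ}

theorem coeff_a2_of_ne (hl : l ≠ T.r 1 + T.e) : T.coeff.a2 l = T.z2 l := if_neg hl

theorem coeff_b21_of_ne (hl : l ≠ T.r 1 + T.e) : T.coeff.b21 l = 0 := if_neg hl

theorem coeff_a3_of_ne (hl : l ≠ T.r 2) : T.coeff.a3 l = T.z3 l := if_neg hl

theorem coeff_b31_of_ne (hl : l ≠ T.r 2) : T.coeff.b31 l = 0 := if_neg hl

theorem coeff_b32_of_ne (hl : l ≠ T.r 2) : T.coeff.b32 l = 0 := if_neg hl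

theorem a2_add_eq : (fun q => T.coeff.a2 (T.r 1 + T.e) q + T.coeff.b21 (T.r 1 + T.e) q *
    T.input q 0) = T.y 1 (T.r 1 + T.e) := by
  funext q
  simp only [coeff, if_true]
  change _ - _ + _ * T.y 0 (T.r 0) q = _
  ring

theorem a2_add_eq_of_ne (hl : l ≠ T.r 1 + T.e) :
    (fun q => T.coeff.a2 l q + T.coeff.b21 l q * T.input q 0) = T.z2 l := by
  rw [coeff_a2_of_ne hl, coeff_b21_of_ne hl]; simp

theorem a3_add_eq : (fun q => T.coeff.a3 (T.r 2) q + T.coeff.b31 (T.r 2) q * T.input q 0) =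
    fun q => T.y 2 (T.r 2) q - T.b32 q * T.v2 q := by
  funext q
  simp only [coeff, if_true]
  change _ - _ - _ + _ * T.y 0 (T.r 0) q = _
  ring

theorem a3_add_eq_of_ne (hl : l ≠ T.r 2) :
    (fun q => T.coeff.a3 l q + T.coeff.b31 l q * T.input q 0) = T.z3 l := by
  rw [coeff_a3_of_ne hl, coeff_b31_of_ne hl]; simp

theorem a3_add_add_eq : (fun q => T.coeff.a3 (T.r 2) q + T.coeff.b31 (T.r 2) q * T.input q 0 +
    T.coeff.b32 (T.r 2) q * T.input q 1) = T.y 2 (T.r 2) := by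
  funext q
  simp only [coeff, if_true]
  change _ - _ - _ + _ * T.y 0 (T.r 0) q + _ * T.v2 q = _
  ring

theorem a3_add_add_eq_of_ne (hl : l ≠ T.r 2) : (fun q => T.coeff.a3 l q +
    T.coeff.b31 l q * T.input q 0 + T.coeff.b32 l q * T.input q 1) = T.z3 l := by
  rw [coeff_a3_of_ne hl, coeff_b31_of_ne hl, coeff_b32_of_ne hl]; simp

end

end TriData

namespace TriData.TriangularAt

variable {n N : ℕ} {T : TriData n N} {q : Jet n N} (h : T.TriangularAt q) (hT : T.Admissible)
include h hT

theorem fderiv_z2_eq_zero {δ : Jet n N} (hδ : stateTrunc (fun _ => T.d 2) δ = 0) {l : ℕ}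
    (hl : l < T.r 1 + (T.d 2 - T.d 1)) : fderiv ℝ (T.z2 l) q δ = 0 := by
  have hs := hT.trunc_of_const hδ
  have hu := (stateTrunc_const_eq_zero_iff (T := T)).1 hδ
  have he := hT.d_one_add_le
  rcases lt_or_ge l (T.r 1 + T.e) with h1 | h1
  · rw [z2_of_lt h1]
    rcases lt_or_ge l (T.r 1) with h2 | h2
    · exact h.vanish δ hs 1 l h2
    · obtain ⟨m, rfl⟩ := Nat.exists_eq_add_of_le h2
      rw [h.lead2 m (by omega) δ hs (fun α hα => hu.2 0 α (by omega))
        (fun α hα => hu.2 1 α (by omega)), h.sym_zero m (by omega), hu.2 1 _ (by omega)]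
      ring
  · rw [fderiv_z2_of_ge h1]
    exact hu.2 1 _ (by omega)

theorem fderiv_z3_eq_zero {δ : Jet n N} (hδ : stateTrunc (fun _ => T.d 2) δ = 0) {l : ℕ}
    (hl : l < T.r 2 + T.d 2) : fderiv ℝ (T.z3 l) q δ = 0 := by
  have hs := hT.trunc_of_const hδ
  have hu := (stateTrunc_const_eq_zero_iff (T := T)).1 hδ
  rcases lt_or_ge l (T.r 2) with h1 | h1
  · rw [z3_of_lt h1]
    exact h.vanish δ hs 2 l h1
  · rw [fderiv_z3_of_ge h1]
    exact hu.2 0 _ (by omega)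

/-- The outputs up to orders r give x and the inputs up to orders d; z₃ contributes the derivatives
of input 0. Those of input 1 come from the e additional derivatives of the second output and then
from z₂ directly. -/
theorem state_inj {δ : Jet n N} (hδ : fderiv ℝ hT.state q δ = 0) :
    stateTrunc (fun _ => T.d 2) δ = 0 := by
  have he := hT.d_one_add_le
  have h0 := hT.d_zero
  rw [h.fderiv_state] at hδ
  have h1 : ∀ l, l < T.r 0 → fderiv ℝ (T.y 0 l) q δ = 0 := fun l hl =>
    congrFun (congrArg Prod.fst hδ) ⟨l, hl⟩
  have h2 : ∀ l, l < T.r 1 + (T.d 2 - T.d 1) → fderiv ℝ (T.z2 l) q δ = 0 := fun l hl =>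
    congrFun (congrArg (fun z => z.2.1) hδ) ⟨l, hl⟩
  have h3 : ∀ l, l < T.r 2 + T.d 2 → fderiv ℝ (T.z3 l) q δ = 0 := fun l hl =>
    congrFun (congrArg (fun z => z.2.2) hδ) ⟨l, hl⟩
  have hs := h.trunc_eq_zero h1 (fun l hl => h2 l (by omega)) fun l hl => h3 l (by omega)
  have hu0 : ∀ α, α < T.d 2 → T.u 0 α δ = 0 := fun α hα => by
    have := h3 (T.r 2 + α) (by omega)
    rwa [fderiv_z3_of_ge (by omega), Nat.add_sub_cancel_left] at this
  have hu1 := h.u1_eq_zero le_rfl hs (fun α hα => hu0 α (by omega)) fun l hl => by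
    have := h2 (T.r 1 + l) (by omega)
    rwa [z2_of_lt (by omega)] at this
  rw [stateTrunc_const_eq_zero_iff (T := T)]
  refine ⟨(stateTrunc_eq_zero_iff.1 hs).1, forall_fin_three.2 ⟨hu0, fun α hα => ?_, fun α hα =>
    (stateTrunc_eq_zero_iff.1 hs).2 2 α hα⟩⟩
  rcases lt_or_ge α (T.d 1 + T.e) with h4 | h4
  · exact hu1 α h4
  · have := h2 (T.r 1 + (α - T.d 1)) (by omega)
    rwa [fderiv_z2_of_ge (by omega), show T.d 1 + (T.r 1 + (α - T.d 1)) - T.r 1 = α by omega] at this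

theorem input_inj {δ : Jet n N} (hδ : stateTrunc (fun _ => T.d 2) δ = 0)
    (hV : fderiv ℝ T.input q δ = 0) : stateTrunc (fun _ => T.d 2 + 1) δ = 0 := by
  have hs := hT.trunc_of_const hδ
  have hu := (stateTrunc_const_eq_zero_iff (T := T)).1 hδ
  have he := hT.d_one_add_le
  have hp := hT.d_two_pos
  obtain ⟨hv1, hv2, hv3⟩ := h.fderiv_input_eq_zero hV
  have key : T.u 1 (T.d 2) δ = 0 ∧ T.u 2 (T.d 2) δ = 0 := by
    rw [h.lead δ hs, hu.2 0 0 hp] at hv1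
    -- If d 1 < d 2, the first new input determines u 2 (d 2) through the pivot s 0 2, and the
    -- second one then determines u 1 (d 2). If d 1 = d 2, both are the solution of a linear system
    -- with the determinant from `det_ne`.
    rcases lt_or_ge (T.d 1) (T.d 2) with hd | hd
    · rw [hu.2 1 _ hd, mul_zero, mul_zero, zero_add, zero_add] at hv1
      have hu2 := (mul_eq_zero.1 hv1).resolve_left (h.s02_ne hd)
      refine ⟨?_, hu2⟩
      unfold v2 at hv2
      split_ifs at hv2 with h1
      · rwa [fderiv_u] at hv2
      · rw [h.lead2 T.e le_rfl δ hs _ fun α hα => hu.2 1 α (by omega), hu2, mul_zero, add_zero,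
          show T.d 1 + T.e = T.d 2 by omega] at hv2
        · exact (mul_eq_zero.1 hv2).resolve_left (h.sym_ne (by omega))
        · intro α hα
          rcases lt_or_ge α (T.d 2) with h2 | h2
          · exact hu.2 0 α h2
          · rw [show α = T.d 2 by omega]; exact hv3
    · have hde : T.d 1 = T.d 2 := by omega
      rw [hT.v2_of_le hd, h.lead δ hs, hu.2 0 0 hp] at hv2
      have hdet := h.det_ne hde
      rw [hde] at hv1 hv2
      constructor
      · refine (mul_eq_zero.1 (?_ : _ * T.u 1 (T.d 2) δ = 0)).resolve_left hdet
        linear_combination T.s 1 2 q * hv1 - T.s 0 2 q * hv2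
      · refine (mul_eq_zero.1 (?_ : _ * T.u 2 (T.d 2) δ = 0)).resolve_left hdet
        linear_combination T.s 0 1 q * hv2 - T.s 1 1 q * hv1
  rw [stateTrunc_const_eq_zero_iff (T := T)]
  refine ⟨hu.1, fun k α hα => ?_⟩
  rcases lt_or_ge α (T.d 2) with h2 | h2
  · exact hu.2 k α h2
  · obtain rfl : α = T.d 2 := by omega
    fin_cases k
    · exact hv3
    · exact key.1
    · exact key.2

theorem dynamics : fderiv ℝ hT.state q (jetField T.F N q) =
    gtfField (T.coeff.eval hT.shape q) (hT.state q) (T.input q) := by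
  have he := hT.d_one_add_le
  have hN := hT.d_lt 2
  have h0 := hT.d_zero
  rw [h.fderiv_state]
  refine Prod.ext ?_ (Prod.ext ?_ ?_)
  · funext l
    have hl : l.1 < T.r 0 := l.2
    simp only [gtfField]
    rw [tau_y]
    split_ifs with h1
    · rw [coord_succ _ h1]; rfl
    · have : ¬ l.1 + 1 < T.r 0 := h1
      rw [show l.1 + 1 = T.r 0 by omega]; rfl
  · funext l
    have hl : l.1 < T.r 1 + (T.d 2 - T.d 1) := l.2
    simp only [gtfField]
    split_ifs with h1 h2
    · have h1' : l.1 + 1 < T.r 1 + T.e := h1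
      rw [coord_succ _ (show l.1 + 1 < hT.shape.p2 from by
        change l.1 + 1 < T.r 1 + (T.d 2 - T.d 1); omega), z2_of_lt (by omega), tau_y]
      change _ = T.z2 (l.1 + 1) q
      rw [z2_of_lt h1']
    · have h1' : ¬ l.1 + 1 < T.r 1 + T.e := h1
      have h2' : l.1 + 1 < T.r 1 + (T.d 2 - T.d 1) := h2
      simp only [LiftedCoeff.eval, coeff]
      split_ifs with h3
      · rw [z2_of_lt (by omega), tau_y, h3]
        change _ = _ - _ + _ * T.y 0 (T.r 0) q
        ring
      · rw [z2_of_ge (by omega), tau_u _ (by omega), z2_of_ge (by omega),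
          show T.d 1 + l.1 - T.r 1 + 1 = T.d 1 + (l.1 + 1) - T.r 1 by omega]
        simp
    · have h1' : ¬ l.1 + 1 < T.r 1 + T.e := h1
      have h2' : ¬ l.1 + 1 < T.r 1 + (T.d 2 - T.d 1) := h2
      change _ = T.v2 q
      unfold v2
      split_ifs with h3
      · rw [z2_of_ge (by omega), tau_u _ (by omega),
          show T.d 1 + l.1 - T.r 1 + 1 = T.d 2 by omega]
      · rw [z2_of_lt (by omega), tau_y, show l.1 + 1 = T.r 1 + T.e by omega]
  · funext l
    have hl : l.1 < T.r 2 + T.d 2 := l.2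
    simp only [gtfField]
    have hnext : T.r 2 ≤ l.1 → fderiv ℝ (T.z3 l.1) q (jetField T.F N q) = T.z3 (l.1 + 1) q := by
      intro h1
      rw [z3_of_ge h1, tau_u _ (by omega), z3_of_ge (by omega),
          show l.1 - T.r 2 + 1 = l.1 + 1 - T.r 2 by omega]
    split_ifs with h1 h2 h3
    · have h1' : l.1 + 1 < T.r 2 := h1
      rw [coord_succ _ (show l.1 + 1 < hT.shape.r3 from by
        change l.1 + 1 < T.r 2 + T.d 2; omega), z3_of_lt (by omega), tau_y]
      change _ = T.z3 (l.1 + 1) q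
      rw [z3_of_lt h1']
    · have h1' : ¬ l.1 + 1 < T.r 2 := h1
      have h2' : l.1 + 1 < T.r 2 + (T.d 2 - T.d 1) := h2
      simp only [LiftedCoeff.eval, coeff]
      split_ifs with h4
      · rw [z3_of_lt (by omega), tau_y, h4]
        change _ = _ - _ - T.b32 q * _ + _ * T.y 0 (T.r 0) q
        -- Rows below p3 have no term with the second input. This row is of that kind only if d 1 <
        -- d 2, when b32 is zero.
        rw [h.b32_zero (by omega)]
        ring
      · rw [hnext (by omega)]
        simp
    · have h1' : ¬ l.1 + 1 < T.r 2 := h1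
      simp only [LiftedCoeff.eval, coeff]
      split_ifs with h4
      · rw [z3_of_lt (by omega), tau_y, h4]
        change _ = _ - _ - _ + _ * T.y 0 (T.r 0) q + _ * T.v2 q
        ring
      · rw [hnext (by omega)]
        simp
    · have h3' : ¬ l.1 + 1 < T.r 2 + T.d 2 := h3
      have hp := hT.d_two_pos
      rw [hnext (by omega), z3_of_ge (by omega), show l.1 + 1 - T.r 2 = T.d 2 by omega]
      rfl

theorem jetCoordsAt : JetCoordsAt (T.d 2) hT.shape hT.state T.input T.coeff (jetField T.F N q) q := by
  have he := hT.d_one_add_le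
  have h0 := hT.d_zero
  have hp := hT.d_two_pos
  have hk2 : hT.shape.k2 = T.r 1 + T.e := rfl
  have hk3 : hT.shape.k3 = T.r 2 := rfl
  have hp2 : hT.shape.p2 = T.r 1 + (T.d 2 - T.d 1) := rfl
  have hp3 : hT.shape.p3 = T.r 2 + (T.d 2 - T.d 1) := rfl
  have hr3 : hT.shape.r3 = T.r 2 + T.d 2 := rfl
  have hδ : hT.shape.δ = T.e := rfl
  have hzero : ∀ δ : Jet n N, fderiv ℝ (0 : Jet n N → ℝ) q δ = 0 := fun δ => by simp
  refine
    { smooth_state := h.smooth_state hT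
      smooth_input := h.smooth_input
      state_indep := ?state_indep
      state_inj := fun δ hδ => h.state_inj hT hδ
      input_inj := fun δ hδ hV => h.input_inj hT hδ hV
      dynamics := h.dynamics hT
      smooth2 := ?smooth2
      smooth3 := ?smooth3
      smooth32 := ?smooth32
      indep2 := ?indep2
      indep3 := ?indep3
      indep32 := ?indep32
      dep2 := ?dep2
      dep3 := ?dep3
      dep3' := ?dep3'
      b21_ne := ?b21_ne
      b31_ne := ?b31_ne
      reg1 := ?reg1
      reg2 := ?reg2
      reg3 := ?reg3 }
  case state_indep =>
    intro δ hδ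
    rw [h.fderiv_state]
    refine Prod.ext (funext fun l => ?_) (Prod.ext (funext fun l => ?_) (funext fun l => ?_))
    · exact h.vanish δ (hT.trunc_of_const hδ) 0 l.1 l.2
    · exact h.fderiv_z2_eq_zero hT hδ l.2
    · exact h.fderiv_z3_eq_zero hT hδ l.2
  case smooth2 =>
    intro l _ _
    by_cases hl : l = T.r 1 + T.e
    · subst hl
      simp only [coeff, if_true]
      exact ⟨(h.smooth_y 1 _ le_rfl).sub
        (h.smooth_b21.mul (h.smooth_y 0 _ (Nat.le_add_right _ _))), h.smooth_b21⟩
    · rw [coeff_a2_of_ne hl, coeff_b21_of_ne hl]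
      exact ⟨h.smooth_z2 l, contDiffAt_const⟩
  case smooth3 =>
    intro l _ _
    by_cases hl : l = T.r 2
    · subst hl
      simp only [coeff, if_true]
      exact ⟨((h.smooth_y 2 _ (Nat.le_add_right _ _)).sub
        (h.smooth_b31.mul (h.smooth_y 0 _ (Nat.le_add_right _ _)))).sub
          (h.smooth_b32.mul h.smooth_v2), h.smooth_b31⟩
    · rw [coeff_a3_of_ne hl, coeff_b31_of_ne hl]
      exact ⟨h.smooth_z3 l, contDiffAt_const⟩
  case smooth32 =>
    intro l _ _
    by_cases hl : l = T.r 2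
    · subst hl
      simp only [coeff, if_true]
      exact h.smooth_b32
    · rw [coeff_b32_of_ne hl]
      exact contDiffAt_const
  case indep2 =>
    intro l hl1 hl2 δ hs
    have hs' := hT.trunc_of_const hs
    have hu := (stateTrunc_const_eq_zero_iff (T := T)).1 hs
    by_cases hl : l = T.r 1 + T.e
    · subst hl
      have hlt : T.d 1 + T.e < T.d 2 := by omega
      have hu0 : ∀ α, α ≤ T.e → T.u 0 α δ = 0 := fun α hα => hu.2 0 α (by omega)
      have hu1 : ∀ α, α ≤ T.d 1 + T.e → T.u 1 α δ = 0 := fun α hα => hu.2 1 α (by omega)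
      refine ⟨h.fderiv_a2_eq_zero hlt hs' hu0 hu1, ?_⟩
      simp only [coeff, if_true]
      exact h.b21_dep hlt δ hs' hu0 hu1
    · rw [coeff_a2_of_ne hl, coeff_b21_of_ne hl]
      exact ⟨h.fderiv_z2_eq_zero hT hs hl2, hzero δ⟩
  case indep3 =>
    intro l hl1 hl2 δ hs
    have hs' := hT.trunc_of_const hs
    have hu := (stateTrunc_const_eq_zero_iff (T := T)).1 hs
    by_cases hl : l = T.r 2
    · subst hl
      refine ⟨h.fderiv_a3_eq_zero hT hs' (hu.2 0 0 hp) fun hd => hu.2 1 _ hd, ?_⟩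
      simp only [coeff, if_true]
      exact h.b31_dep δ hs'
    · rw [coeff_a3_of_ne hl, coeff_b31_of_ne hl]
      exact ⟨h.fderiv_z3_eq_zero hT hs hl2, hzero δ⟩
  case indep32 =>
    intro l hl1 hl2 δ hs
    by_cases hl : l = T.r 2
    · subst hl
      simp only [coeff, if_true]
      exact h.b32_dep δ (hT.trunc_of_const hs)
    · rw [coeff_b32_of_ne hl]
      exact hzero δ
  case dep2 =>
    intro i hi δ hV hK
    obtain ⟨h1, h2, h3⟩ := h.of_kills hT hK
    -- Only the first row, i = 0, has genuine coefficients; the later ones are integrators, whose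
    -- right-hand side is the next coordinate.
    rcases Nat.eq_zero_or_pos i with rfl | hi0
    · have hlt : T.d 1 + T.e < T.d 2 := by omega
      have hs := h.trunc_eq_zero h1 (fun l hl => h2 l (by rw [hk2]; push_cast; omega) (by omega))
        fun l hl => h3 l (by rw [hk3, hδ]; push_cast; omega) (by omega)
      have hu0 : ∀ α, α ≤ T.e → T.u 0 α δ = 0 := fun α hα => by
        have := h3 (T.r 2 + α) (by rw [hk3, hδ]; push_cast; omega) (by omega)
        rwa [fderiv_z3_of_ge (by omega), Nat.add_sub_cancel_left] at this
      have hu1 : ∀ α, α ≤ T.d 1 + T.e → T.u 1 α δ = 0 := fun α hα => by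
        rcases hα.lt_or_eq with hα | rfl
        · refine h.u1_eq_zero le_rfl hs (fun α hα => hu0 α hα.le) (fun l hl => ?_) α hα
          have := h2 (T.r 1 + l) (by rw [hk2]; push_cast; omega) (by omega)
          rwa [z2_of_lt (by omega)] at this
        · have := h2 (T.r 1 + T.e) (by rw [hk2]; push_cast; omega) (by omega)
          rwa [fderiv_z2_of_ge le_rfl, show T.d 1 + (T.r 1 + T.e) - T.r 1 = T.d 1 + T.e by omega]
            at this
      rw [hk2, add_zero]
      refine ⟨h.fderiv_a2_eq_zero hlt hs hu0 hu1, ?_⟩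
      simp only [coeff, if_true]
      exact h.b21_dep hlt δ hs hu0 hu1
    · rw [coeff_a2_of_ne (by omega), coeff_b21_of_ne (by omega)]
      exact ⟨h2 _ (by push_cast; omega) (by omega), hzero δ⟩
  case dep3 =>
    intro i hi δ hV hK
    obtain ⟨h1, h2, h3⟩ := h.of_kills hT hK
    rcases Nat.eq_zero_or_pos i with rfl | hi0
    · have hs := h.trunc_eq_zero h1
        (fun l hl => h2 l (by rw [hk2, hδ]; push_cast; omega) (by omega))
        fun l hl => h3 l (by rw [hk3]; push_cast; omega) (by omega)
      have hu0 : T.u 0 0 δ = 0 := by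
        have := h3 (T.r 2) (by rw [hk3]; push_cast; omega) (by omega)
        rwa [fderiv_z3_of_ge le_rfl, Nat.sub_self] at this
      have hz := h2 (T.r 1) (by rw [hk2, hδ]; push_cast; omega) (by omega)
      -- The last admitted coordinate of z₂ has the number k2 - δ + 1 = r 1 + 1. It is u 1 (d 1)
      -- itself if e = 0, and otherwise y 1 (r 1), whose leading term gives u 1 (d 1).
      have hu1 : T.u 1 (T.d 1) δ = 0 := by
        rcases Nat.eq_zero_or_pos T.e with he0 | he0
        · rwa [fderiv_z2_of_ge (by omega), Nat.add_sub_cancel] at hz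
        · rw [z2_of_lt (by omega)] at hz
          refine h.u1_eq_zero (m := 1) he0 hs (fun α hα => ?_) (fun l hl => ?_) _ (by omega)
          · rw [show α = 0 by omega]; exact hu0
          · rw [show l = 0 by omega]; exact hz
      rw [hk3, add_zero]
      refine ⟨h.fderiv_a3_eq_zero hT hs hu0 fun _ => hu1, ?_⟩
      simp only [coeff, if_true]
      exact h.b31_dep δ hs
    · rw [coeff_a3_of_ne (by omega), coeff_b31_of_ne (by omega)]
      exact ⟨h3 _ (by push_cast; omega) (by omega), hzero δ⟩
  case dep3' =>
    intro l hl hl' δ hV hK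
    obtain ⟨h1, h2, h3⟩ := h.of_kills hT hK
    by_cases hlk : l = T.r 2
    · subst hlk
      have hs := h.trunc_eq_zero h1 (fun l hl => h2 l (by rw [hp2]; push_cast; omega) (by omega))
        fun l hl => h3 l (by omega) (by omega)
      have hu0 : T.u 0 0 δ = 0 := by
        have := h3 (T.r 2) (by omega) (by omega)
        rwa [fderiv_z3_of_ge le_rfl, Nat.sub_self] at this
      refine ⟨h.fderiv_a3_eq_zero hT hs hu0 fun hd => by omega, ?_⟩
      simp only [coeff, if_true]
      exact ⟨h.b31_dep δ hs, h.b32_dep δ hs⟩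
    · rw [coeff_a3_of_ne hlk, coeff_b31_of_ne hlk, coeff_b32_of_ne hlk]
      exact ⟨h3 _ (by omega) (by omega), hzero δ, hzero δ⟩
  case b21_ne =>
    intro hlt
    rw [hk2]
    simp only [coeff, if_true]
    exact h.b21_ne (by omega)
  case b31_ne =>
    intro hlt
    rw [hk3]
    simp only [coeff, if_true]
    exact h.b31_ne
  case reg1 =>
    intro i hi δ hV hK
    obtain ⟨hv1, hv2, hv3⟩ := h.fderiv_input_eq_zero hV
    obtain ⟨h1, h2, h3⟩ := h.of_unit hT (a := 0) (α := 0) (β := 1) (b := T.r 2 + i)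
      (by rw [hK, zero_smul, one_smul]; rfl)
    rcases Nat.eq_zero_or_pos i with rfl | hi0
    · rw [hk3, add_zero, a3_add_eq]
      have hs := h.trunc_eq_zero h1 (fun l hl => by rw [h2 l (by omega), ite_self])
        fun l hl => by rw [h3 l (by omega), if_neg (by omega)]
      rw [fderiv_sub_mul (h.smooth_y 2 _ (Nat.le_add_right _ _)) h.smooth_v2 h.smooth_b32,
        h.b32_zero (by omega), h.b32_dep δ hs]
      -- If this row were stationary too, all outputs of orders r would be, and u 0 0 would have to
      -- vanish by `inj_top`, although its component along the unit vector is one.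
      intro hy
      have hz := h2 (T.r 1) (by omega)
      rw [z2_of_lt (by omega), ite_self] at hz
      have hu := h.inj_top δ hs (forall_fin_three.2 ⟨hv1, hz, by simpa using hy⟩) 0
      have hone := h3 (T.r 2) (by omega)
      rw [fderiv_z3_of_ge le_rfl, Nat.sub_self, if_pos (by omega)] at hone
      rw [h0] at hu
      linarith
    · rw [a3_add_eq_of_ne (by omega), hk3, h3 _ (by omega), if_pos rfl]
      exact one_ne_zero
  case reg2 =>
    intro i hi δ α β hV hK hh2 hh3
    obtain ⟨hv1, hv2, hv3⟩ := h.fderiv_input_eq_zero hV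
    obtain ⟨h1, h2, h3⟩ := h.of_unit hT (a := T.r 1 + T.e + i) (b := T.r 2 + T.e + i) hK
    rcases Nat.eq_zero_or_pos i with rfl | hi0
    · simp only [add_zero] at h2 h3 hh2 hh3
      have hlt : T.d 1 + T.e < T.d 2 := by omega
      rw [hk2, a2_add_eq] at hh2
      have hs := h.trunc_eq_zero h1 (fun l hl => by rw [h2 l (by omega), if_neg (by omega)])
        fun l hl => by rw [h3 l (by omega), if_neg (by omega)]
      have hα := h2 (T.r 1 + T.e) (by omega)
      rw [fderiv_z2_of_ge le_rfl, if_pos rfl,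
        show T.d 1 + (T.r 1 + T.e) - T.r 1 = T.d 1 + T.e by omega] at hα
      have hβ := h3 (T.r 2 + T.e) (by omega)
      rw [fderiv_z3_of_ge (by omega), if_pos rfl, Nat.add_sub_cancel_left] at hβ
      -- For e = 0 both rows are genuine and `inj_top` applies. For e > 0 the third block
      -- contributes an integrator, which gives β = 0; then the first new input kills u 2 (d 2), and
      -- s 1 1 ≠ 0 gives α = 0.
      rcases Nat.eq_zero_or_pos T.e with he0 | he0
      · rw [hk3, hδ, he0, add_zero, a3_add_eq,
          fderiv_sub_mul (h.smooth_y 2 _ (Nat.le_add_right _ _)) h.smooth_v2 h.smooth_b32,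
          h.b32_zero (by omega), h.b32_dep δ hs] at hh3
        rw [he0, add_zero] at hh2 hα
        rw [he0] at hβ
        have hu := h.inj_top δ hs (forall_fin_three.2 ⟨hv1, hh2, by simpa using hh3⟩)
        rw [← hα, ← hβ]
        refine ⟨hu 1, ?_⟩
        have := hu 0
        rwa [h0] at this
      · rw [a3_add_eq_of_ne (by omega), hk3, hδ, h3 _ (by omega), if_pos rfl] at hh3
        subst hh3
        refine ⟨?_, rfl⟩
        have hu0 : ∀ α, α ≤ T.e → T.u 0 α δ = 0 := fun α hα => by
          have := h3 (T.r 2 + α) (by omega)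
          rwa [fderiv_z3_of_ge (by omega), Nat.add_sub_cancel_left, ite_self] at this
        have hu1 := h.u1_eq_zero le_rfl hs (fun α hα => hu0 α hα.le) fun l hl => by
          have := h2 (T.r 1 + l) (by omega)
          rwa [z2_of_lt (by omega), if_neg (by omega)] at this
        rw [h.lead δ hs, hu0 0 (Nat.zero_le _), hu1 (T.d 1) (by omega), mul_zero, mul_zero,
          zero_add, zero_add] at hv1
        have hu2 := (mul_eq_zero.1 hv1).resolve_left (h.s02_ne (by omega))
        rw [h.lead2 T.e le_rfl δ hs hu0 hu1, hu2, mul_zero, add_zero, hα] at hh2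
        exact (mul_eq_zero.1 hh2).resolve_left (h.sym_ne he0)
    · rw [a2_add_eq_of_ne (by omega), hk2, h2 _ (by omega), if_pos rfl] at hh2
      rw [a3_add_eq_of_ne (by omega), hk3, hδ, h3 _ (by omega), if_pos rfl] at hh3
      exact ⟨hh2, hh3⟩
  case reg3 =>
    intro l hl hl' δ hV hK
    obtain ⟨hv1, hv2, hv3⟩ := h.fderiv_input_eq_zero hV
    obtain ⟨h1, h2, h3⟩ := h.of_unit hT (a := 0) (α := 0) (β := 1) (b := l)
      (by rw [hK, zero_smul, one_smul])
    by_cases hlk : l = T.r 2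
    · subst hlk
      rw [a3_add_add_eq]
      have hs := h.trunc_eq_zero h1 (fun l hl => by rw [h2 l (by omega), ite_self])
        fun l hl => by rw [h3 l (by omega), if_neg (by omega)]
      intro hy
      rw [hT.v2_of_le (by omega)] at hv2
      have hu := h.inj_top δ hs (forall_fin_three.2 ⟨hv1, hv2, hy⟩) 0
      have hone := h3 (T.r 2) (by omega)
      rw [fderiv_z3_of_ge le_rfl, Nat.sub_self, if_pos rfl] at hone
      rw [h0] at hu
      linarith
    · rw [a3_add_add_eq_of_ne hlk, h3 _ (by omega), if_pos rfl]
      exact one_ne_zero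

end TriData.TriangularAt


/-! ### Quotients and determinants of functions free of high input derivatives -/

section
variable {n N : ℕ} {A B : Jet n N → ℝ} {q₀ : Jet n N} {i : Fin 3} {b : ℕ}

theorem SmoothNear.eventually_ne {E : Type*} [NormedAddCommGroup E] [NormedSpace ℝ E] {A : E → ℝ}
    {q₀ : E} (hA : SmoothNear A q₀) (h : A q₀ ≠ 0) : ∀ᶠ q in 𝓝 q₀, A q ≠ 0 :=
  hA.self_of_nhds.continuousAt.eventually_ne h

theorem SmoothNear.div {E : Type*} [NormedAddCommGroup E] [NormedSpace ℝ E] {A B : E → ℝ}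
    {q₀ : E} (hA : SmoothNear A q₀) (hB : SmoothNear B q₀) (h : B q₀ ≠ 0) :
    SmoothNear (fun q => A q / B q) q₀ := by
  filter_upwards [hA, hB, hB.eventually_ne h] with q h1 h2 h3
  exact h1.div h2 h3

theorem SmoothNear.mul_sub_mul {E : Type*} [NormedAddCommGroup E] [NormedSpace ℝ E]
    {A B A' B' : E → ℝ} {q₀ : E} (hA : SmoothNear A q₀) (hB : SmoothNear B q₀)
    (hA' : SmoothNear A' q₀) (hB' : SmoothNear B' q₀) :
    SmoothNear (fun q => A q * B q - A' q * B' q) q₀ := by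
  filter_upwards [hA, hB, hA', hB'] with q h1 h2 h3 h4
  exact (h1.mul h2).sub (h3.mul h4)

theorem FreeNear.congr (hA : FreeNear A q₀ i b) (h : ∀ᶠ q in 𝓝 q₀, B q = A q) :
    FreeNear B q₀ i b := by
  filter_upwards [hA, h.eventually_nhds] with q h1 h2 α hα
  have : B =ᶠ[𝓝 q] A := h2
  rw [this.fderiv_eq, h1 α hα]

theorem FreeNear.mul_sub_mul {A' B' : Jet n N → ℝ} (hA : SmoothNear A q₀) (hB : SmoothNear B q₀)
    (hA' : SmoothNear A' q₀) (hB' : SmoothNear B' q₀) (h1 : FreeNear A q₀ i b)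
    (h2 : FreeNear B q₀ i b) (h3 : FreeNear A' q₀ i b) (h4 : FreeNear B' q₀ i b) :
    FreeNear (fun q => A q * B q - A' q * B' q) q₀ i b := by
  filter_upwards [hA, hB, hA', hB', h1, h2, h3, h4] with q s1 s2 s3 s4 f1 f2 f3 f4 α hα
  have hd : ∀ {A : Jet n N → ℝ}, ContDiffAt ℝ ∞ A q → HasFDerivAt A (_root_.fderiv ℝ A q) q :=
    fun hA => (hA.differentiableAt (by simp)).hasFDerivAt
  have h5 : HasFDerivAt (fun q => A q * B q - A' q * B' q) _ q :=
    ((hd s1).mul (hd s2)).sub ((hd s3).mul (hd s4))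
  rw [h5.fderiv]
  simp [f1 α hα, f2 α hα, f3 α hα, f4 α hα]

/-- Differentiating (A / B) · B = A avoids the quotient rule. -/
theorem FreeNear.div (hA : SmoothNear A q₀) (hB : SmoothNear B q₀) (h : B q₀ ≠ 0)
    (h1 : FreeNear A q₀ i b) (h2 : FreeNear B q₀ i b) :
    FreeNear (fun q => A q / B q) q₀ i b := by
  filter_upwards [hA, hB, h1, h2, (hA.div hB h), hB.eventually_ne h, 
    (hB.eventually_ne h).eventually_nhds] with q s1 s2 f1 f2 s3 hne hne' α hα
  have hd : ∀ {A : Jet n N → ℝ}, ContDiffAt ℝ ∞ A q → HasFDerivAt A (_root_.fderiv ℝ A q) q :=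
    fun hA => (hA.differentiableAt (by simp)).hasFDerivAt
  have h3 : HasFDerivAt (fun q => A q / B q * B q) _ q := (hd s3).mul (hd s2)
  have h4 : (fun q => A q / B q * B q) =ᶠ[𝓝 q] A := hne'.mono fun q' hq' => div_mul_cancel₀ _ hq'
  have h5 := DFunLike.congr_fun (h3.fderiv.symm.trans h4.fderiv_eq) (inputVec n N i α)
  rw [f1 α hα] at h5
  simp only [add_apply, smul_apply, f2 α hα, smul_eq_mul, mul_zero, zero_add] at h5
  exact (mul_eq_zero.1 h5).resolve_left hne

end

namespace FlatChart

variable {n N : ℕ} {F : (Fin n → ℝ) → U → (Fin n → ℝ)} {φ : Fin 3 → (Fin n → ℝ) → ℝ}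
  {q₀ : Jet n N} {D L : Fin 3 → ℕ} (C : FlatChart F φ q₀ D L)
include C

/-- The coefficients of a prolonged input are functions of the state of the prolonged system. -/
theorem free_symbolMatrix (j : Fin 3) {i : Fin 3} (hi : 0 < D i) (i' : Fin 3) :
    FreeNear (symbolMatrix F φ D L j i (N := N)) q₀ i' (D i') := by
  have hL := C.L_pos j
  -- The entry is also the coefficient of uⁱ_[Dⁱ-1] in the chain coordinate φʲ_[Lʲ-1], which is a
  -- function of the states; this needs D i > 0.
  have h1 := FreeNear.fderiv (smooth_outDeriv C.smoothF C.smoothφ j (L j - 1))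
    (C.free_of_lt j i' (m := L j - 1) (b := D i') (by omega) (by omega)) (inputVec n N i (D i - 1))
  exact h1.congr (by
    filter_upwards [C.eventually_symbol_eq j i (m := L j - 1) (b := D i - 1) (by omega) (by omega)]
      with q hq
    exact hq.symm)

end FlatChart

namespace TriData

variable {n N : ℕ} {T : TriData n N} {q₀ : Jet n N}

theorem smooth_s (C : FlatChart T.F T.φ q₀ T.D T.R) (k l : Fin 3) : SmoothNear (T.s k l) q₀ :=
  C.smooth_symbolMatrix _ _

theorem smooth_y (C : FlatChart T.F T.φ q₀ T.D T.R) (k : Fin 3) (m : ℕ) : SmoothNear (T.y k m) q₀ :=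
  smooth_outDeriv C.smoothF C.smoothφ _ m

theorem sum_perm (ρ : Equiv.Perm (Fin 3)) (f : Fin 3 → ℝ) : ∑ i, f i = f (ρ 0) + f (ρ 1) + f (ρ 2) := by
  rw [← Equiv.sum_comp ρ, Fin.sum_univ_three]

theorem fderiv_eq_zero_of_free {b : Jet n N → ℝ} {B : Fin 3 → ℕ}
    (hb : ∀ k, FreeNear b q₀ (T.ρ k) (B k)) :
    ∀ᶠ q in 𝓝 q₀, ∀ δ : Jet n N, δ.1 = 0 → (∀ k α, α < B k → T.u k α δ = 0) →
      fderiv ℝ b q δ = 0 := by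
  filter_upwards [Filter.eventually_all.2 hb] with q hq δ h1 h2
  refine apply_eq_zero_of_kills _ (fun i => B (T.ρ.symm i)) δ (fun i α hα => ?_) h1
    fun i α hα => ?_
  · have := hq (T.ρ.symm i) α hα
    rwa [Equiv.apply_symm_apply] at this
  · have := h2 (T.ρ.symm i) α hα
    rwa [u, Equiv.apply_symm_apply] at this

theorem leading_of_free {b : Jet n N → ℝ} {B : Fin 3 → ℕ}
    (hb : ∀ k, FreeNear b q₀ (T.ρ k) (B k + 1)) :
    ∀ᶠ q in 𝓝 q₀, ∀ δ : Jet n N, δ.1 = 0 → (∀ k α, α < B k → T.u k α δ = 0) →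
      fderiv ℝ b q δ = fderiv ℝ b q (inputVec n N (T.ρ 0) (B 0)) * T.u 0 (B 0) δ +
        fderiv ℝ b q (inputVec n N (T.ρ 1) (B 1)) * T.u 1 (B 1) δ +
        fderiv ℝ b q (inputVec n N (T.ρ 2) (B 2)) * T.u 2 (B 2) δ := by
  filter_upwards [Filter.eventually_all.2 hb] with q hq δ h1 h2
  rw [apply_eq_leading _ (fun i => B (T.ρ.symm i)) δ (fun i α hα => ?_) h1 fun i α hα => ?_,
    sum_perm T.ρ]
  · simp only [Equiv.symm_apply_apply]; rfl
  · have := hq (T.ρ.symm i) α hα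
    rwa [Equiv.apply_symm_apply] at this
  · have := h2 (T.ρ.symm i) α hα
    rwa [u, Equiv.apply_symm_apply] at this

variable (T q₀) in
/-- Conditions on the data that make the coordinates triangular near `q₀`. -/
structure Triangular : Prop extends T.Admissible where
  smooth_b21 : SmoothNear T.b21 q₀
  smooth_b31 : SmoothNear T.b31 q₀
  smooth_b32 : SmoothNear T.b32 q₀
  free_y : ∀ l, l < T.e → FreeNear (T.y 1 (T.r 1 + l)) q₀ (T.ρ 2) (T.d 2)
  sym_ne : 0 < T.e → T.s 1 1 q₀ ≠ 0
  b21_eq : T.d 1 + T.e < T.d 2 → ∀ᶠ q in 𝓝 q₀,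
    fderiv ℝ (T.y 1 (T.r 1 + T.e)) q (inputVec n N (T.ρ 2) (T.d 2)) = T.b21 q * T.s 0 2 q
  b21_free0 : T.d 1 + T.e < T.d 2 → FreeNear T.b21 q₀ (T.ρ 0) (T.e + 1)
  b21_free1 : T.d 1 + T.e < T.d 2 → FreeNear T.b21 q₀ (T.ρ 1) (T.d 1 + T.e + 1)
  b21_free2 : T.d 1 + T.e < T.d 2 → FreeNear T.b21 q₀ (T.ρ 2) (T.d 2)
  b31_free : ∀ k, FreeNear T.b31 q₀ (T.ρ k) (T.d k)
  b32_free : ∀ k, FreeNear T.b32 q₀ (T.ρ k) (T.d k)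
  b32_zero : T.d 1 < T.d 2 → ∀ q, T.b32 q = 0
  b3_eq : ∀ᶠ q in 𝓝 q₀, T.s 2 2 q = T.b31 q * T.s 0 2 q + T.b32 q * T.s 1 2 q
  b3_eq' : T.d 1 = T.d 2 → ∀ᶠ q in 𝓝 q₀, T.s 2 1 q = T.b31 q * T.s 0 1 q + T.b32 q * T.s 1 1 q
  s02_ne : T.d 1 < T.d 2 → T.s 0 2 q₀ ≠ 0
  det_ne : T.d 1 = T.d 2 → T.s 0 1 q₀ * T.s 1 2 q₀ - T.s 0 2 q₀ * T.s 1 1 q₀ ≠ 0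
  b21_ne : T.d 1 + T.e < T.d 2 → T.b21 q₀ ≠ 0
  b31_ne : T.b31 q₀ ≠ 0

theorem free_y_add (C : FlatChart T.F T.φ q₀ T.D T.R) (k : Fin 3) (l : ℕ) (m : Fin 3) :
    FreeNear (T.y k (T.r k + l)) q₀ (T.ρ m) (T.d m + 1 + l) :=
  C.free_top_add (T.σ k) (T.ρ m) l

theorem free_y_e (C : FlatChart T.F T.φ q₀ T.D T.R) {e : ℕ}
    (h : ∀ l, l < e → FreeNear (T.y 1 (T.r 1 + l)) q₀ (T.ρ 2) (T.d 2)) :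
    FreeNear (T.y 1 (T.r 1 + e)) q₀ (T.ρ 2) (T.d 2 + 1) := by
  rcases e with _ | e
  · exact free_y_add C 1 0 2
  · exact free_outDeriv_add C.smoothF C.smoothφ _ _ 1 (h e (Nat.lt_succ_self e))

/-- Nonvanishing at q₀ persists by continuity, and everything else already holds near q₀; finitely
many neighborhoods are intersected. -/
theorem Triangular.eventually_triangularAt (h : T.Triangular q₀)
    (C : FlatChart T.F T.φ q₀ T.D T.R) : ∀ᶠ q in 𝓝 q₀, T.TriangularAt q := by
  have hT := h.toAdmissible
  have hd0 := hT.d_zero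
  have hde := hT.d_one_add_le
  have himp : ∀ {p : Prop} {P : Jet n N → Prop}, (p → ∀ᶠ q in 𝓝 q₀, P q) →
      ∀ᶠ q in 𝓝 q₀, p → P q := by
    intro p P hp
    by_cases h : p
    · exact (hp h).mono fun q hq _ => hq
    · exact Filter.Eventually.of_forall fun q h' => absurd h' h
  have hall : ∀ {m : ℕ} {P : ℕ → Jet n N → Prop}, (∀ l, l < m → ∀ᶠ q in 𝓝 q₀, P l q) →
      ∀ᶠ q in 𝓝 q₀, ∀ l, l < m → P l q := fun {m P} hP =>
    (Filter.eventually_all_finite (Set.finite_Iio m)).2 hP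
  have hsm : ∀ᶠ q in 𝓝 q₀, ∀ k, ∀ m, m < T.r k + T.e + 1 → ContDiffAt ℝ ∞ (T.y k m) q :=
    Filter.eventually_all.2 fun k => hall fun m _ => smooth_y C k m
  have hvan : ∀ᶠ q in 𝓝 q₀, ∀ δ : Jet n N, stateTrunc T.D δ = 0 → ∀ k m, m < T.r k →
      fderiv ℝ (T.y k m) q δ = 0 := by
    filter_upwards [C.eventually_fderiv_outDeriv] with q hq δ hδ k m hm
    refine (hq (T.σ k) ⟨m, hm⟩ δ).trans ?_
    rw [hδ, map_zero]; rfl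
  have hlead : ∀ᶠ q in 𝓝 q₀, ∀ k, ∀ δ : Jet n N, δ.1 = 0 → (∀ l α, α < T.d l → T.u l α δ = 0) →
      fderiv ℝ (T.y k (T.r k)) q δ = T.s k 0 q * T.u 0 (T.d 0) δ + T.s k 1 q * T.u 1 (T.d 1) δ +
        T.s k 2 q * T.u 2 (T.d 2) δ :=
    Filter.eventually_all.2 fun k => leading_of_free fun l => free_y_add C k 0 l
  have hlead2 : ∀ᶠ q in 𝓝 q₀, ∀ l, l < T.e + 1 → ∀ δ : Jet n N, stateTrunc T.D δ = 0 →
      (∀ α, α ≤ l → T.u 0 α δ = 0) → (∀ α, α < T.d 1 + l → T.u 1 α δ = 0) →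
      fderiv ℝ (T.y 1 (T.r 1 + l)) q δ = T.s 1 1 q * T.u 1 (T.d 1 + l) δ +
        fderiv ℝ (T.y 1 (T.r 1 + l)) q (inputVec n N (T.ρ 2) (T.d 2)) * T.u 2 (T.d 2) δ := by
    refine hall fun l hl => ?_
    -- The leading orders are l and d 1 + l for inputs 0 and 1, by the general growth of orders with
    -- d 0 = 0. For input 2 it stays at d 2, because the preceding derivatives do not contain u 2 (d
    -- 2).
    have hf : ∀ k, FreeNear (T.y 1 (T.r 1 + l)) q₀ (T.ρ k)
        ((![l, T.d 1 + l, T.d 2] : Fin 3 → ℕ) k + 1) := by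
      refine forall_fin_three.2 ⟨?_, ?_, ?_⟩
      · refine (free_y_add C 1 l 0).mono ?_
        simp; omega
      · refine (free_y_add C 1 l 1).mono ?_
        simp; omega
      · exact free_y_e C fun l' hl' => h.free_y l' (by omega)
    have hsym : ∀ᶠ q in 𝓝 q₀, fderiv ℝ (T.y 1 (T.r 1 + l)) q
        (inputVec n N (T.ρ 1) (T.d 1 + l)) = T.s 1 1 q :=
      C.eventually_symbol_add (T.σ 1) (T.ρ 1) l (by
        have := hT.d_lt 2
        change T.d 1 + l < N
        omega)
    filter_upwards [leading_of_free hf, hsym] with q h1 h2 δ hδ hu0 hu1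
    have hu := stateTrunc_eq_zero_iff.1 hδ
    rw [h1 δ hu.1 (forall_fin_three.2 ⟨fun α hα => hu0 α (le_of_lt hα), hu1, fun α hα =>
      hu.2 2 α hα⟩)]
    simp only [Matrix.cons_val_zero, Matrix.cons_val_one, Matrix.cons_val]
    rw [hu0 l le_rfl, h2]
    ring
  have hb21 : ∀ᶠ q in 𝓝 q₀, T.d 1 + T.e < T.d 2 → ∀ δ : Jet n N, δ.1 = 0 →
      (∀ k α, α < (![T.e + 1, T.d 1 + T.e + 1, T.d 2] : Fin 3 → ℕ) k → T.u k α δ = 0) →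
      fderiv ℝ T.b21 q δ = 0 :=
    himp fun hlt => fderiv_eq_zero_of_free (forall_fin_three.2
      ⟨h.b21_free0 hlt, h.b21_free1 hlt, h.b21_free2 hlt⟩)
  have hdet := (smooth_s C 0 1).mul_sub_mul (smooth_s C 1 2) (smooth_s C 0 2) (smooth_s C 1 1)
  filter_upwards [hsm, h.smooth_b21, h.smooth_b31, h.smooth_b32, C.eventually_injective, hvan,
    C.eventually_injective_top, hlead, hlead2, hall h.free_y,
    himp fun hp => (smooth_s C 1 1).eventually_ne (h.sym_ne hp), himp h.b21_eq, hb21,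
    fderiv_eq_zero_of_free h.b31_free, fderiv_eq_zero_of_free h.b32_free, h.b3_eq, himp h.b3_eq',
    himp fun hp => (smooth_s C 0 2).eventually_ne (h.s02_ne hp),
    himp fun hp => hdet.eventually_ne (h.det_ne hp),
    himp fun hp => h.smooth_b21.eventually_ne (h.b21_ne hp),
    h.smooth_b31.eventually_ne h.b31_ne]
    with q h1 h2 h3 h4 h5 h6 h7 h8 h9 h10 h11 h12 h13 h14 h15 h16 h17 h18 h19 h20 h21
  exact
    { smooth_y := fun k m hm => h1 k m (Nat.lt_succ_of_le hm)
      smooth_b21 := h2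
      smooth_b31 := h3
      smooth_b32 := h4
      inj := fun δ hδ => h5 δ fun j m hm => by
        have := hδ (T.σ.symm j) m
        simp only [r, y, Equiv.apply_symm_apply] at this
        exact this hm
      vanish := h6
      inj_top := fun δ hδ hy k => by
        refine congrFun (h7 δ hδ fun j => ?_) (T.ρ k)
        have := hy (T.σ.symm j)
        simp only [r, y, Equiv.apply_symm_apply] at this
        exact this
      lead := fun δ hδ k => by
        have hu := stateTrunc_eq_zero_iff.1 hδ
        rw [h8 k δ hu.1 hu.2, hd0]
      lead2 := fun l hl => h9 l (Nat.lt_succ_of_le hl)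
      sym_zero := fun l hl => h10 l hl _ le_rfl
      sym_ne := h11
      b21_eq := h12
      b21_dep := fun hlt δ hδ hu0 hu1 => by
        have hu := stateTrunc_eq_zero_iff.1 hδ
        exact h13 hlt δ hu.1 (forall_fin_three.2 ⟨fun α hα => hu0 α (Nat.lt_succ_iff.1 hα),
          fun α hα => hu1 α (Nat.lt_succ_iff.1 hα), fun α hα => hu.2 2 α hα⟩)
      b31_dep := fun δ hδ => h14 δ (stateTrunc_eq_zero_iff.1 hδ).1 (stateTrunc_eq_zero_iff.1 hδ).2
      b32_dep := fun δ hδ => h15 δ (stateTrunc_eq_zero_iff.1 hδ).1 (stateTrunc_eq_zero_iff.1 hδ).2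
      b32_zero := fun hd => h.b32_zero hd q
      b3_eq := h16
      b3_eq' := h17
      s02_ne := h18
      det_ne := h19
      b21_ne := h20
      b31_ne := h21 }

/-- The prolonged system is equivalent to the triangular form. -/
theorem Triangular.isSFEToGTF3 (h : T.Triangular q₀) (C : FlatChart T.F T.φ q₀ T.D T.R)
    {S : Type} [NormedAddCommGroup S] [NormedSpace ℝ S] [FiniteDimensional ℝ S] {G : S → U → S}
    {Λ : S × U → Jet n N} {s₀ : S} {w₀ : U} (hΛ₀ : Λ (s₀, w₀) = q₀)
    (hΛ : ∀ᶠ p in 𝓝 (s₀, w₀), JetLiftAt T.F (T.d 2) G Λ p)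
    (hdim : finrank ℝ S = n + 3 * T.d 2) {hout : Fin 3 → S → ℝ}
    (hh : ∀ᶠ p in 𝓝 (s₀, w₀), ∀ j, hout j p.1 = T.φ j (Λ p).1) : IsSFEToGTF3 G s₀ w₀ hout := by
  have hT := h.toAdmissible
  have hcont : Filter.Tendsto Λ (𝓝 (s₀, w₀)) (𝓝 q₀) := by
    rw [← hΛ₀]; exact hΛ.self_of_nhds.smooth.continuousAt
  refine isSFEToGTF3_of_coords (I := hT.shape) (Zt := fun p => hT.state (Λ p))
    (Vt := fun p => T.input (Λ p)) (c := T.coeff.comp Λ) ?_ ?_ T.σ ?_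
  · have h1 := C.T.finrank_eq
    have h2 : ∀ f : Fin 3 → ℕ, ∀ π : Equiv.Perm (Fin 3), ∑ i, f i = f (π 0) + f (π 1) + f (π 2) :=
      fun f π => by rw [← Equiv.sum_comp π, Fin.sum_univ_three]
    simp only [Ext, Module.finrank_prod, Module.finrank_pi, Module.finrank_pi_fintype,
      Fintype.card_fin] at h1
    -- The chart gives n + d 0 + d 1 + d 2 = r 0 + r 1 + r 2; with d 0 = 0 the triangular
    -- coordinates are n + 3 d 2 in number.
    rw [h2 T.D T.ρ, h2 T.R T.σ] at h1
    change _ = T.r 0 + (T.r 1 + (T.d 2 - T.d 1)) + (T.r 2 + T.d 2)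
    change n + (T.d 0 + T.d 1 + T.d 2) = T.r 0 + T.r 1 + T.r 2 at h1
    have := hT.d_zero
    have := hT.d_one_add_le
    omega
  · filter_upwards [hΛ, hcont.eventually (h.eventually_triangularAt C)] with p h1 h2
    exact (h2.jetCoordsAt hT).comp h1
  · filter_upwards [hh] with p hp
    have h1 : ∀ k, hout (T.σ k) p.1 = T.y k 0 (Λ p) := fun k => hp _
    rw [h1, h1, h1]
    refine ⟨?_, ?_, ?_⟩
    · exact coord_succ _ (l := 0) (hT.r_pos 0)
    · refine (coord_succ _ (l := 0) (hT.shape.one_le_k2.trans hT.shape.k2_le_p2)).trans ?_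
      exact congrFun (z2_of_lt (l := 0) (by have := hT.r_pos 1; omega)) _
    · refine (coord_succ _ (l := 0) (by have := hT.r_pos 2; change 0 < T.r 2 + T.d 2; omega)).trans ?_
      exact congrFun (z3_of_lt (l := 0) (hT.r_pos 2)) _

end TriData


/-! ### Choice of the orderings and of the coefficients -/

theorem exists_perm {a b c : Fin 3} (hab : a ≠ b) (hac : a ≠ c) (hbc : b ≠ c) :
    ∃ ρ : Equiv.Perm (Fin 3), ρ 0 = a ∧ ρ 1 = b ∧ ρ 2 = c := by
  have hinj : Function.Injective (![a, b, c] : Fin 3 → Fin 3) := by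
    intro i j hij
    fin_cases i <;> fin_cases j <;> simp_all
  exact ⟨Equiv.ofBijective _ (Finite.injective_iff_bijective.1 hinj), rfl, rfl, rfl⟩

theorem exists_others (a : Fin 3) : ∃ b c : Fin 3, a ≠ b ∧ a ≠ c ∧ b ≠ c := by
  revert a; decide

theorem exists_third {a b : Fin 3} (h : a ≠ b) : ∃ c : Fin 3, a ≠ c ∧ b ≠ c := by
  revert a b; decide

theorem eq_or_eq_of_ne {a b c k : Fin 3} (h : a ≠ b) (ha : a ≠ c) (hb : b ≠ c) (hk : k ≠ c) :
    k = a ∨ k = b := by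
  revert a b c k; decide

namespace TriData

variable {n N : ℕ} (F : (Fin n → ℝ) → U → (Fin n → ℝ)) (φ : Fin 3 → (Fin n → ℝ) → ℝ)
  (D R : Fin 3 → ℕ) (σ ρ : Equiv.Perm (Fin 3)) (e : ℕ)

/-- The data for the case that one input has to be prolonged most often. -/
def ofLt : TriData n N where
  F := F
  φ := φ
  D := D
  R := R
  σ := σ
  ρ := ρ
  e := e
  b21 q := fderiv ℝ (outDeriv F φ N (σ 1) (R (σ 1) + e)) q (inputVec n N (ρ 2) (D (ρ 2))) /
    symbolMatrix F φ D R (σ 0) (ρ 2) q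
  b31 q := symbolMatrix F φ D R (σ 2) (ρ 2) q / symbolMatrix F φ D R (σ 0) (ρ 2) q
  b32 _ := 0

/-- The data for the case that two inputs have to be prolonged most often. -/
def ofEq : TriData n N where
  F := F
  φ := φ
  D := D
  R := R
  σ := σ
  ρ := ρ
  e := 0
  b21 _ := 0
  b31 q :=
    (symbolMatrix F φ D R (σ 2) (ρ 1) q * symbolMatrix F φ D R (σ 1) (ρ 2) q -
      symbolMatrix F φ D R (σ 2) (ρ 2) q * symbolMatrix F φ D R (σ 1) (ρ 1) q) /
    (symbolMatrix F φ D R (σ 0) (ρ 1) q * symbolMatrix F φ D R (σ 1) (ρ 2) q -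
      symbolMatrix F φ D R (σ 0) (ρ 2) q * symbolMatrix F φ D R (σ 1) (ρ 1) q)
  b32 q :=
    (symbolMatrix F φ D R (σ 0) (ρ 1) q * symbolMatrix F φ D R (σ 2) (ρ 2) q -
      symbolMatrix F φ D R (σ 0) (ρ 2) q * symbolMatrix F φ D R (σ 2) (ρ 1) q) /
    (symbolMatrix F φ D R (σ 0) (ρ 1) q * symbolMatrix F φ D R (σ 1) (ρ 2) q -
      symbolMatrix F φ D R (σ 0) (ρ 2) q * symbolMatrix F φ D R (σ 1) (ρ 1) q)

variable {F φ D R σ ρ e} {q₀ : Jet n N}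

/-- With d 1 < d 2 only u 2 (d 2) must be eliminated, and the single pivot s 0 2 suffices. The main
point is to control which input derivatives the quotients b21 and b31 contain. -/
theorem triangular_ofLt (C : FlatChart F φ q₀ D R) (h0 : D (ρ 0) = 0) (h12 : D (ρ 1) < D (ρ 2))
    (he : D (ρ 1) + e ≤ D (ρ 2))
    (hy : ∀ l, l < e → FreeNear (outDeriv F φ N (σ 1) (R (σ 1) + l)) q₀ (ρ 2) (D (ρ 2)))
    (hs11 : 0 < e → symbolMatrix F φ D R (σ 1) (ρ 1) q₀ ≠ 0)
    (hs02 : symbolMatrix F φ D R (σ 0) (ρ 2) q₀ ≠ 0)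
    (hs22 : symbolMatrix F φ D R (σ 2) (ρ 2) q₀ ≠ 0)
    (hnum : D (ρ 1) + e < D (ρ 2) → fderiv ℝ (outDeriv F φ N (σ 1) (R (σ 1) + e)) q₀
      (inputVec n N (ρ 2) (D (ρ 2))) ≠ 0) :
    (ofLt F φ D R σ ρ e : TriData n N).Triangular q₀ := by
  have hp : 0 < D (ρ 2) := by omega
  have hsy : SmoothNear (fun q => fderiv ℝ (outDeriv F φ N (σ 1) (R (σ 1) + e)) q
      (inputVec n N (ρ 2) (D (ρ 2)))) q₀ := by
    filter_upwards [smooth_outDeriv C.smoothF C.smoothφ (σ 1) (R (σ 1) + e)] with q hq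
    exact (hq.fderiv_right (m := ∞) (by simp)).clm_apply contDiffAt_const
  have hs : ∀ k l, SmoothNear (symbolMatrix F φ D R (σ k) (ρ l)) q₀ := fun k l =>
    C.smooth_symbolMatrix _ _
  have hne := (hs 0 2).eventually_ne hs02
  have hfree : ∀ k, k ≠ 2 → FreeNear (fun q => fderiv ℝ (outDeriv F φ N (σ 1) (R (σ 1) + e)) q
      (inputVec n N (ρ 2) (D (ρ 2)))) q₀ (ρ k) (D (ρ k) + 1 + e) := fun k _ =>
    FreeNear.fderiv (smooth_outDeriv C.smoothF C.smoothφ _ _) (C.free_top_add (σ 1) (ρ k) e) _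
  have hR := C.L_pos (σ 1)
  have hprev : FreeNear (outDeriv F φ N (σ 1) (R (σ 1) + e - 1)) q₀ (ρ 2) (D (ρ 2)) := by
    rcases Nat.eq_zero_or_pos e with h | h
    · exact C.free_of_lt _ _ (by omega) (by omega)
    · have := hy (e - 1) (by omega)
      rwa [show R (σ 1) + (e - 1) = R (σ 1) + e - 1 by omega] at this
  -- The numerator of b21 is also the coefficient of u 2 (d 2 - 1) in the preceding derivative of
  -- the second output, which does not contain u 2 (d 2).
  have hfree2 : FreeNear (fun q => fderiv ℝ (outDeriv F φ N (σ 1) (R (σ 1) + e)) q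
      (inputVec n N (ρ 2) (D (ρ 2)))) q₀ (ρ 2) (D (ρ 2)) := by
    refine (FreeNear.fderiv (smooth_outDeriv C.smoothF C.smoothφ _ _) hprev
      (inputVec n N (ρ 2) (D (ρ 2) - 1))).congr ?_
    have hlt := C.D_lt (ρ 2)
    have := symbol_outDeriv_add C.smoothF C.smoothφ (σ 1) (ρ 2) (m := R (σ 1) + e - 1)
      (b := D (ρ 2) - 1) 1 (by omega) (hprev.mono (by omega))
    rwa [show R (σ 1) + e - 1 + 1 = R (σ 1) + e by omega,
      show D (ρ 2) - 1 + 1 = D (ρ 2) by omega] at this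
  have hf02 : ∀ k, FreeNear (symbolMatrix F φ D R (σ 0) (ρ 2)) q₀ (ρ k) (D (ρ k)) := fun k =>
    C.free_symbolMatrix _ hp _
  exact
    { d_zero := h0
      d_one_add_le := he
      d_two_pos := hp
      d_lt := fun k => C.D_lt _
      r_pos := fun k => C.L_pos _
      smooth_b21 := hsy.div (hs 0 2) hs02
      smooth_b31 := (hs 2 2).div (hs 0 2) hs02
      smooth_b32 := Filter.Eventually.of_forall fun q => contDiffAt_const
      free_y := hy
      sym_ne := hs11
      b21_eq := fun _ => hne.mono fun q hq => (div_mul_cancel₀ _ hq).symm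
      b21_free0 := fun _ => by
        refine FreeNear.div hsy (hs 0 2) hs02 ((hfree 0 (by decide)).mono ?_) ((hf02 0).mono ?_)
        · change D (ρ 0) + 1 + e ≤ e + 1; omega
        · change D (ρ 0) ≤ e + 1; omega
      b21_free1 := fun _ => by
        refine FreeNear.div hsy (hs 0 2) hs02 ((hfree 1 (by decide)).mono ?_) ((hf02 1).mono ?_)
        · change D (ρ 1) + 1 + e ≤ D (ρ 1) + e + 1; omega
        · change D (ρ 1) ≤ D (ρ 1) + e + 1; omega
      b21_free2 := fun _ => FreeNear.div hsy (hs 0 2) hs02 hfree2 (hf02 2)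
      b31_free := fun k =>
        FreeNear.div (hs 2 2) (hs 0 2) hs02 (C.free_symbolMatrix _ hp _) (hf02 k)
      b32_free := fun k => Filter.Eventually.of_forall fun q α _ => by
        change fderiv ℝ (fun _ => (0 : ℝ)) q _ = 0
        simp
      b32_zero := fun _ _ => rfl
      b3_eq := hne.mono fun q hq => by
        change symbolMatrix F φ D R (σ 2) (ρ 2) q = symbolMatrix F φ D R (σ 2) (ρ 2) q /
          symbolMatrix F φ D R (σ 0) (ρ 2) q * symbolMatrix F φ D R (σ 0) (ρ 2) q + 0 * _
        rw [div_mul_cancel₀ _ hq, zero_mul, add_zero]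
      b3_eq' := fun h => absurd h h12.ne
      s02_ne := fun _ => hs02
      det_ne := fun h => absurd h h12.ne
      b21_ne := fun h => div_ne_zero (hnum h) hs02
      b31_ne := div_ne_zero hs22 hs02 }

/-- Two top derivatives must be eliminated: b31 and b32 are given by Cramer's rule for writing row 2
as a combination of rows 0 and 1 in the columns 1 and 2. The second determinant is the numerator of
b31. -/
theorem triangular_ofEq (C : FlatChart F φ q₀ D R) (h0 : D (ρ 0) = 0) (h12 : D (ρ 1) = D (ρ 2))
    (hp : 0 < D (ρ 2))
    (hdet : symbolMatrix F φ D R (σ 0) (ρ 1) q₀ * symbolMatrix F φ D R (σ 1) (ρ 2) q₀ -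
      symbolMatrix F φ D R (σ 0) (ρ 2) q₀ * symbolMatrix F φ D R (σ 1) (ρ 1) q₀ ≠ 0)
    (hdet' : symbolMatrix F φ D R (σ 2) (ρ 1) q₀ * symbolMatrix F φ D R (σ 1) (ρ 2) q₀ -
      symbolMatrix F φ D R (σ 2) (ρ 2) q₀ * symbolMatrix F φ D R (σ 1) (ρ 1) q₀ ≠ 0) :
    (ofEq F φ D R σ ρ : TriData n N).Triangular q₀ := by
  have hs : ∀ k l, SmoothNear (symbolMatrix F φ D R (σ k) (ρ l)) q₀ := fun k l =>
    C.smooth_symbolMatrix _ _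
  have hsdet := (hs 0 1).mul_sub_mul (hs 1 2) (hs 0 2) (hs 1 1)
  have hs31 := (hs 2 1).mul_sub_mul (hs 1 2) (hs 2 2) (hs 1 1)
  have hs32 := (hs 0 1).mul_sub_mul (hs 2 2) (hs 0 2) (hs 2 1)
  have hf1 : ∀ k m, FreeNear (symbolMatrix F φ D R (σ k) (ρ 1)) q₀ (ρ m) (D (ρ m)) := fun k m =>
    C.free_symbolMatrix _ (by omega) _
  have hf2 : ∀ k m, FreeNear (symbolMatrix F φ D R (σ k) (ρ 2)) q₀ (ρ m) (D (ρ m)) := fun k m =>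
    C.free_symbolMatrix _ hp _
  have hfdet := fun m => FreeNear.mul_sub_mul (hs 0 1) (hs 1 2) (hs 0 2) (hs 1 1) (hf1 0 m) (hf2 1 m)
    (hf2 0 m) (hf1 1 m)
  have hlt : ¬ D (ρ 1) + 0 < D (ρ 2) := by omega
  exact
    { d_zero := h0
      d_one_add_le := h12.le
      d_two_pos := hp
      d_lt := fun k => C.D_lt _
      r_pos := fun k => C.L_pos _
      smooth_b21 := Filter.Eventually.of_forall fun q => contDiffAt_const
      smooth_b31 := hs31.div hsdet hdet
      smooth_b32 := hs32.div hsdet hdet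
      free_y := fun l hl => absurd hl (Nat.not_lt_zero l)
      sym_ne := fun h => absurd h (lt_irrefl 0)
      b21_eq := fun h => absurd h hlt
      b21_free0 := fun h => absurd h hlt
      b21_free1 := fun h => absurd h hlt
      b21_free2 := fun h => absurd h hlt
      b31_free := fun k => FreeNear.div hs31 hsdet hdet (FreeNear.mul_sub_mul (hs 2 1) (hs 1 2)
        (hs 2 2) (hs 1 1) (hf1 2 k) (hf2 1 k) (hf2 2 k) (hf1 1 k)) (hfdet k)
      b32_free := fun k => FreeNear.div hs32 hsdet hdet (FreeNear.mul_sub_mul (hs 0 1) (hs 2 2)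
        (hs 0 2) (hs 2 1) (hf1 0 k) (hf2 2 k) (hf2 0 k) (hf1 2 k)) (hfdet k)
      b32_zero := fun h => absurd h12 (ne_of_lt h)
      b3_eq := by
        filter_upwards [hsdet.eventually_ne hdet] with q hq
        simp only [s, ofEq]
        rw [div_mul_eq_mul_div, div_mul_eq_mul_div, ← add_div, eq_div_iff hq]
        ring
      b3_eq' := fun _ => by
        filter_upwards [hsdet.eventually_ne hdet] with q hq
        simp only [s, ofEq]
        rw [div_mul_eq_mul_div, div_mul_eq_mul_div, ← add_div, eq_div_iff hq]
        ring
      s02_ne := fun h => absurd h12 (ne_of_lt h)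
      det_ne := fun _ => hdet
      b21_ne := fun h => absurd h hlt
      b31_ne := div_ne_zero hdet' hdet }

end TriData

namespace FlatChart

variable {n N : ℕ} {F : (Fin n → ℝ) → U → (Fin n → ℝ)} {φ : Fin 3 → (Fin n → ℝ) → ℝ}
  {q₀ : Jet n N} {D L : Fin 3 → ℕ} (C : FlatChart F φ q₀ D L)
include C

/-- Dichotomy for the coefficients of the inputs that are prolonged most often. -/
theorem symbol_zero_of_max (hrank : HasConstantRanks F φ N q₀ L) {κ : ℕ} (hκ : 0 < κ)
    (hmax : ∀ i, D i ≤ κ) (j : Fin 3) (h0 : ∀ i, D i = κ → symbolMatrix F φ D L j i q₀ = 0) :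
    ∀ i, D i = κ → ∀ᶠ q in 𝓝 q₀, symbolMatrix F φ D L j i q = 0 := by
  intro i hi
  rcases le_or_gt (L j) κ with hL | hL
  · exact C.eventually_symbol_zero j i (by omega)
  have hm : L j - κ < L j := by omega
  -- No input is prolonged more than κ times, so φʲ_[Lʲ-κ] is the first derivative that can contain
  -- inputs, and only uⁱ_[0] with D i = κ, with the coefficients M j i. These vanish at q₀ by
  -- assumption.
  have hfree := C.free_of_rank hrank j hm (fun m' hm' i' => C.free_of_lt j i' (by omega) (by
    have := hmax i'; omega)) (fun i' α => by
      rcases (hmax i').lt_or_eq with h | h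
      · exact (C.free_of_lt j i' (b := 0) hm (by omega)).self_of_nhds α (Nat.zero_le _)
      · rcases Nat.eq_zero_or_pos α with rfl | hα
        · rw [(C.eventually_symbol_eq j i' (m := L j - κ) (b := 0) (by omega)
            (by omega)).self_of_nhds, h0 i' h]
        · exact (C.free_of_lt j i' (b := 1) hm (by omega)).self_of_nhds α hα) i
  filter_upwards [hfree, C.eventually_symbol_eq j i (m := L j - κ) (b := 0) (by omega) (by omega)]
    with q h1 h2
  rw [← h2, h1 0 le_rfl]

theorem symbol_row_ne_zero (j : Fin 3) : ∃ i, symbolMatrix F φ D L j i q₀ ≠ 0 := by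
  by_contra hcon
  push Not at hcon
  have hdet : (Matrix.of fun j i => symbolMatrix F φ D L j i q₀).det = 0 :=
    Matrix.det_eq_zero_of_row_eq_zero j hcon
  obtain ⟨w, hw0, hw⟩ := Matrix.exists_mulVec_eq_zero_iff.2 hdet
  exact hw0 (C.eventually_symbolMatrix_injective.self_of_nhds w fun j => congrFun hw j)

end FlatChart


namespace FlatChart

variable {n N : ℕ} {F : (Fin n → ℝ) → U → (Fin n → ℝ)} {φ : Fin 3 → (Fin n → ℝ) → ℝ}
  {q₀ : Jet n N} {D R : Fin 3 → ℕ} (C : FlatChart F φ q₀ D R)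
  (hmin : ∀ R' : Fin 3 → ℕ, (∀ j, R' j ≤ N) → HasFlatParam F φ N q₀ R' → ∀ j, R j ≤ R' j)
  (hrank : HasConstantRanks F φ N q₀ R)
include C hmin

/-- If all inputs were prolonged, the full matrix M could be used in the minimality argument and R
could be lowered. -/
theorem exists_not_prolonged : ∃ i, D i = 0 := by
  by_contra hcon
  push Not at hcon
  exact C.minimality hmin Finset.univ Finset.univ Finset.univ_nonempty
    (fun i _ => Nat.pos_of_ne_zero (hcon i)) rfl fun j hj => absurd (Finset.mem_univ j) hj

/-- No output is independent of two prolonged inputs. -/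
theorem not_eventually_zero_pair {i i' : Fin 3} (hi : i ≠ i') (h1 : 0 < D i) (h2 : 0 < D i')
    {j : Fin 3} (h3 : ∀ᶠ q in 𝓝 q₀, symbolMatrix F φ D R j i q = 0)
    (h4 : ∀ᶠ q in 𝓝 q₀, symbolMatrix F φ D R j i' q = 0) : False := by
  refine C.minimality hmin {i, i'} (Finset.univ.erase j) ⟨i, by simp⟩ ?_ ?_ ?_
  · intro k hk
    rcases Finset.mem_insert.1 hk with rfl | hk
    · exact h1
    · rwa [Finset.mem_singleton.1 hk]
  · rw [Finset.card_erase_of_mem (Finset.mem_univ _), Finset.card_pair hi]; rfl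
  · intro j' hj' k hk
    have : j' = j := by simpa using hj'
    subst this
    rcases Finset.mem_insert.1 hk with rfl | hk
    · exact h3
    · rwa [Finset.mem_singleton.1 hk]

include hrank

/-- In the two longest columns every row of M is nonzero at q₀, by minimality and constant rank, and
the rows are not all parallel. Among three such plane vectors one is independent of each of the
other two; it belongs to the output placed second. -/
theorem exists_triangular_of_eq {ρ : Equiv.Perm (Fin 3)} (h0 : D (ρ 0) = 0)
    (h12 : D (ρ 1) = D (ρ 2)) (hp : 0 < D (ρ 2)) :
    ∃ σ : Equiv.Perm (Fin 3), (TriData.ofEq F φ D R σ ρ : TriData n N).Triangular q₀ := by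
  have hρ : ρ 1 ≠ ρ 2 := ρ.injective.ne (by decide)
  have hmax : ∀ i, D i ≤ D (ρ 2) := by
    intro i
    obtain ⟨k, rfl⟩ := ρ.surjective i
    revert k
    exact TriData.forall_fin_three.2 ⟨by omega, by omega, le_rfl⟩
  set x : Fin 3 → ℝ := fun j => symbolMatrix F φ D R j (ρ 1) q₀ with hx
  set y : Fin 3 → ℝ := fun j => symbolMatrix F φ D R j (ρ 2) q₀ with hy
  have hrow : ∀ j, x j ≠ 0 ∨ y j ≠ 0 := by
    intro j
    by_contra hcon
    push Not at hcon
    have hz : ∀ i, D i = D (ρ 2) → symbolMatrix F φ D R j i q₀ = 0 := by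
      intro i
      obtain ⟨k, rfl⟩ := ρ.surjective i
      revert k
      exact TriData.forall_fin_three.2 ⟨fun h => by omega, fun _ => hcon.1, fun _ => hcon.2⟩
    have h := C.symbol_zero_of_max hrank hp hmax j hz
    exact C.not_eventually_zero_pair hmin hρ (by omega) hp (h _ h12) (h _ rfl)
  have hpar : ∀ a, ∃ j, x j * y a - y j * x a ≠ 0 := by
    intro a
    by_contra hcon
    push Not at hcon
    -- If all rows were parallel to row a, the vector (y a, -x a) in these two columns would lie in
    -- the kernel of M.
    have hw := C.eventually_symbolMatrix_injective.self_of_nhds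
      (fun i => if i = ρ 1 then y a else if i = ρ 2 then - x a else 0) (fun j => by
        rw [TriData.sum_perm ρ, if_neg (ρ.injective.ne (by decide)),
          if_neg (ρ.injective.ne (by decide)), if_pos rfl, if_neg hρ.symm, if_pos rfl]
        refine Eq.trans ?_ (hcon j)
        simp only [hx, hy]
        ring)
    have h1 := congrFun hw (ρ 1)
    have h2 := congrFun hw (ρ 2)
    simp only [if_true, hρ.symm, if_false, Pi.zero_apply] at h1 h2
    rcases hrow a with h | h
    · exact h (by linarith)
    · exact h h1
  obtain ⟨b, hb⟩ := hpar 0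
  have hb0 : (0 : Fin 3) ≠ b := by rintro rfl; exact hb (by ring)
  obtain ⟨c, hc0, hcb⟩ := exists_third hb0
  -- Rows 0 and b are independent. Row c is either independent of row b, or parallel to it and then
  -- independent of row 0.
  by_cases hbc : x b * y c - y b * x c = 0
  · obtain ⟨σ, h1, h2, h3⟩ := exists_perm hb0.symm hcb hc0
    refine ⟨σ, TriData.triangular_ofEq C h0 h12 hp ?_ ?_⟩
    · rw [h1, h2]; exact hb
    · rw [h2, h3]
      intro h
      change x c * y 0 - y c * x 0 = 0 at h
      rcases hrow c with hc | hc
      · refine (mul_ne_zero hc hb) ?_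
        linear_combination x b * h + x 0 * hbc
      · refine (mul_ne_zero hc hb) ?_
        linear_combination y b * h + y 0 * hbc
  · obtain ⟨σ, h1, h2, h3⟩ := exists_perm hb0 hc0 hcb
    refine ⟨σ, TriData.triangular_ofEq C h0 h12 hp ?_ ?_⟩
    · rw [h1, h2]
      intro h
      change x 0 * y b - y 0 * x b = 0 at h
      exact hb (by linear_combination - h)
    · rw [h2, h3]
      intro h
      change x c * y b - y c * x b = 0 at h
      exact hbc (by linear_combination - h)

/-- By minimality at most one entry of the longest column vanishes at q₀. If none does, e = 0 works
with any order of the outputs. Otherwise the output with the zero entry is placed second and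
differentiated further, until the top derivative of the longest input appears or d² - d¹ further
orders are used. -/
theorem exists_triangular_of_lt (hN : ∑ j, R j ≤ N) {ρ : Equiv.Perm (Fin 3)} (h0 : D (ρ 0) = 0)
    (h12 : D (ρ 1) < D (ρ 2)) :
    ∃ (σ ρ' : Equiv.Perm (Fin 3)) (e : ℕ), (TriData.ofLt F φ D R σ ρ' e : TriData n N).Triangular q₀ := by
  have hp : 0 < D (ρ 2) := by omega
  have hmax : ∀ i, D i ≤ D (ρ 2) := by
    intro i
    obtain ⟨k, rfl⟩ := ρ.surjective i
    revert k
    exact TriData.forall_fin_three.2 ⟨by omega, by omega, le_rfl⟩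
  have hzero : ∀ j, symbolMatrix F φ D R j (ρ 2) q₀ = 0 →
      ∀ᶠ q in 𝓝 q₀, symbolMatrix F φ D R j (ρ 2) q = 0 := by
    intro j hj
    refine C.symbol_zero_of_max hrank hp hmax j (fun i => ?_) _ rfl
    obtain ⟨k, rfl⟩ := ρ.surjective i
    revert k
    exact TriData.forall_fin_three.2 ⟨fun h => by omega, fun h => by omega, fun _ => hj⟩
  have htwo : ∀ j j', j ≠ j' → symbolMatrix F φ D R j (ρ 2) q₀ = 0 →
      symbolMatrix F φ D R j' (ρ 2) q₀ ≠ 0 := by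
    intro j j' hjj hj hj'
    obtain ⟨c, h1, h2⟩ := exists_third hjj
    refine C.minimality hmin {ρ 2} {c} ⟨_, Finset.mem_singleton_self _⟩ (by simpa using hp) rfl ?_
    intro k hk i hi
    rw [Finset.mem_singleton.1 hi]
    have hkc : k ≠ c := by simpa using hk
    rcases eq_or_eq_of_ne hjj h1 h2 hkc with rfl | rfl
    · exact hzero _ hj
    · exact hzero _ hj'
  by_cases hall : ∀ j, symbolMatrix F φ D R j (ρ 2) q₀ ≠ 0
  · exact ⟨1, ρ, 0, TriData.triangular_ofLt C h0 h12 (by omega)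
      (fun l hl => absurd hl (Nat.not_lt_zero l)) (fun h => absurd h (lt_irrefl 0)) (hall _) (hall _)
      fun _ => hall _⟩
  push Not at hall
  obtain ⟨b, hb⟩ := hall
  obtain ⟨a, c, hba, hbc, hac⟩ := exists_others b
  obtain ⟨σ, hσ0, hσ1, hσ2⟩ := exists_perm hba.symm hac hbc
  have hBa := htwo b a hba hb
  have hBc := htwo b c hbc hb
  have hBb := hzero b hb
  -- The pivot of row b in the second column must not vanish. If it does and neither of the first
  -- two inputs is prolonged, exchanging them helps, because row b is nonzero. If the second one is
  -- prolonged, the entry vanishes near q₀ by constant rank, and row b would be zero in two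
  -- prolonged columns.
  obtain ⟨ρ', hρ0, hρ12, hρ2, hC⟩ : ∃ ρ' : Equiv.Perm (Fin 3), D (ρ' 0) = 0 ∧
      D (ρ' 1) < D (ρ' 2) ∧ ρ' 2 = ρ 2 ∧ symbolMatrix F φ D R b (ρ' 1) q₀ ≠ 0 := by
    by_cases hC : symbolMatrix F φ D R b (ρ 1) q₀ = 0
    · rcases Nat.eq_zero_or_pos (D (ρ 1)) with h1 | h1
      · obtain ⟨ρ', e0, e1, e2⟩ := exists_perm (a := ρ 1) (b := ρ 0) (c := ρ 2)
          (ρ.injective.ne (by decide)) (ρ.injective.ne (by decide)) (ρ.injective.ne (by decide))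
        refine ⟨ρ', by rw [e0, h1], by rw [e1, e2, h0]; exact hp, e2, ?_⟩
        rw [e1]
        intro hz
        obtain ⟨i, hi⟩ := C.symbol_row_ne_zero b
        obtain ⟨k, rfl⟩ := ρ.surjective i
        revert k
        exact not_exists.1 (by
          rintro ⟨k, hk⟩
          revert k
          exact TriData.forall_fin_three.2 ⟨fun h => h hz, fun h => h hC, fun h => h hb⟩)
      · exfalso
        refine C.not_eventually_zero_pair hmin (i := ρ 1) (i' := ρ 2)
          (ρ.injective.ne (by decide)) h1 hp (j := b) ?_ hBb
        refine C.symbol_zero_of_rank hrank hba.symm (ρ.injective.ne (by decide)) (fun i => ?_) h1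
          h12 hBa hBb hC
        obtain ⟨k, rfl⟩ := ρ.surjective i
        revert k
        exact TriData.forall_fin_three.2 ⟨fun _ _ => h0, fun h => absurd rfl h,
          fun _ h => absurd rfl h⟩
    · exact ⟨ρ, h0, h12, rfl, hC⟩
  rw [← hρ2] at hBa hBb hBc hp
  clear hzero htwo hmax
  -- This bounds e by R a, so that R b + e ≤ N stays within the truncation.
  have hLa : D (ρ' 2) < R a := by
    by_contra h
    exact hBa (C.eventually_symbol_zero a (ρ' 2) (not_lt.1 h)).self_of_nhds
  have hsum : R a + R b ≤ N := by
    rw [← Equiv.sum_comp σ, Fin.sum_univ_three, hσ0, hσ1] at hN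
    omega
  classical
  -- The integer e is the least l for which φ^b_[R b + l] contains the longest input in an order at
  -- least D (ρ' 2), capped at the value for which z₂ needs no input derivatives.
  have hex : ∃ l, l = D (ρ' 2) - D (ρ' 1) ∨
      ¬ FreeNear (outDeriv F φ N b (R b + l)) q₀ (ρ' 2) (D (ρ' 2)) := ⟨_, Or.inl rfl⟩
  obtain ⟨e, he, hlt⟩ : ∃ e, (e = D (ρ' 2) - D (ρ' 1) ∨
      ¬ FreeNear (outDeriv F φ N b (R b + e)) q₀ (ρ' 2) (D (ρ' 2))) ∧
      ∀ l, l < e → ¬ (l = D (ρ' 2) - D (ρ' 1) ∨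
        ¬ FreeNear (outDeriv F φ N b (R b + l)) q₀ (ρ' 2) (D (ρ' 2))) :=
    ⟨Nat.find hex, Nat.find_spec hex, fun l hl => Nat.find_min hex hl⟩
  have hfree : ∀ l, l < e → FreeNear (outDeriv F φ N b (R b + l)) q₀ (ρ' 2) (D (ρ' 2)) :=
    fun l hl => not_not.1 (not_or.1 (hlt l hl)).2
  have hle : D (ρ' 1) + e ≤ D (ρ' 2) := by
    by_contra hcon
    exact (not_or.1 (hlt (D (ρ' 2) - D (ρ' 1)) (by omega))).1 rfl
  have htop : FreeNear (outDeriv F φ N b (R b + 0)) q₀ (ρ' 2) (D (ρ' 2)) := by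
    filter_upwards [C.free_top_add b (ρ' 2) 0, hBb] with q h1 h2 α hα
    rcases eq_or_lt_of_le hα with rfl | h
    · exact h2
    · exact h1 α (by omega)
  have he0 : 0 < e := by
    rcases Nat.eq_zero_or_pos e with rfl | h
    · rcases he with h | h
      · omega
      · exact absurd htop h
    · exact h
  refine ⟨σ, ρ', e, TriData.triangular_ofLt C hρ0 hρ12 hle ?_ ?_ ?_ ?_ ?_⟩
  · rw [hσ1]; exact hfree
  · rw [hσ1]; exact fun _ => hC
  · rw [hσ0]; exact hBa
  · rw [hσ2]; exact hBc
  · rw [hσ1]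
    intro hlt' hnum
    have hnf := he.resolve_left (by omega)
    apply hnf
    have hF := C.smoothF
    have hφ := C.smoothφ
    have hDN := C.D_lt (ρ' 2)
    rcases le_or_gt (R b + e) (D (ρ' 2)) with h | h
    · exact (free_outDeriv hF hφ b (ρ' 2) (R b + e)).mono h
    -- The coefficient in question equals that of the input itself, in order zero, in φ^b_[m], and
    -- all lower derivatives of φ^b depend on x only. If it vanished at q₀, constant rank would make
    -- φ^b_[m] a function of x, and φ^b_[R b + e] would be free of the top derivative, contrary to
    -- the choice of e.
    set m := R b + e - D (ρ' 2) with hm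
    have hme : m + D (ρ' 2) = R b + e := by omega
    have hone : FreeNear (outDeriv F φ N b m) q₀ (ρ' 2) (0 + 1) := by
      refine free_outDeriv_of_add hF hφ b (ρ' 2) (D (ρ' 2) - 1) (by omega) ?_
      convert hfree (e - 1) (by omega) using 2 <;> omega
    have hfm : FreeNear (outDeriv F φ N b m) q₀ (ρ' 2) 0 := by
      refine C.free_of_rank hrank b (by omega) (fun m' hm' i => ?_) (fun i α => ?_) _
      · obtain ⟨k, rfl⟩ := ρ'.surjective i
        revert k
        refine TriData.forall_fin_three.2 ⟨C.free_of_lt _ _ (by omega) (by omega),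
          C.free_of_lt _ _ (by omega) (by omega), ?_⟩
        rcases lt_or_ge (m' + D (ρ' 2)) (R b) with h1 | h1
        · exact C.free_of_lt _ _ (by omega) (by omega)
        · refine free_outDeriv_of_add hF hφ b (ρ' 2) (D (ρ' 2)) (by omega) ?_
          convert hfree (m' + D (ρ' 2) - R b) (by omega) using 2 <;> omega
      · obtain ⟨k, rfl⟩ := ρ'.surjective i
        revert k
        refine TriData.forall_fin_three.2
          ⟨(C.free_of_lt _ _ (b := 0) (by omega) (by omega)).self_of_nhds α (Nat.zero_le _),
          (C.free_of_lt _ _ (b := 0) (by omega) (by omega)).self_of_nhds α (Nat.zero_le _), ?_⟩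
        rcases Nat.eq_zero_or_pos α with rfl | hα
        · rw [← (symbol_outDeriv_add hF hφ b (ρ' 2) (D (ρ' 2)) (by omega) hone).self_of_nhds, hme,
            zero_add]
          exact hnum
        · exact hone.self_of_nhds α hα
    have := free_outDeriv_add hF hφ b (ρ' 2) (D (ρ' 2)) hfm
    rwa [hme, zero_add] at this

/-- The triangular data, if some input has to be prolonged. -/
theorem exists_triangular (hN : ∑ j, R j ≤ N) (hD : ∃ i, 0 < D i) :
    ∃ T : TriData n N, T.F = F ∧ T.φ = φ ∧ T.D = D ∧ T.R = R ∧ T.Triangular q₀ := by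
  obtain ⟨a, ha⟩ := C.exists_not_prolonged hmin
  obtain ⟨b, c, hab, hac, hbc⟩ := exists_others a
  obtain ⟨ρ, h0, h12⟩ : ∃ ρ : Equiv.Perm (Fin 3), D (ρ 0) = 0 ∧ D (ρ 1) ≤ D (ρ 2) := by
    rcases le_total (D b) (D c) with h | h
    · obtain ⟨ρ, e0, e1, e2⟩ := exists_perm hab hac hbc
      exact ⟨ρ, by rw [e0, ha], by rw [e1, e2]; exact h⟩
    · obtain ⟨ρ, e0, e1, e2⟩ := exists_perm hac hab hbc.symm
      exact ⟨ρ, by rw [e0, ha], by rw [e1, e2]; exact h⟩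
  have hp : 0 < D (ρ 2) := by
    obtain ⟨i, hi⟩ := hD
    obtain ⟨k, rfl⟩ := ρ.surjective i
    revert k
    exact TriData.forall_fin_three.2 ⟨by omega, by omega, id⟩
  rcases h12.lt_or_eq with h | h
  · obtain ⟨σ, ρ', e, hT⟩ := C.exists_triangular_of_lt hmin hrank hN h0 h
    exact ⟨_, rfl, rfl, rfl, rfl, hT⟩
  · obtain ⟨σ, hT⟩ := C.exists_triangular_of_eq hmin hrank h0 h hp
    exact ⟨_, rfl, rfl, rfl, rfl, hT⟩

end FlatChart


/-! ### Input transformations -/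

section
variable {n N : ℕ} (F : (Fin n → ℝ) → U → (Fin n → ℝ))
  (T : OpenPartialHomeomorph ((Fin n → ℝ) × U) ((Fin n → ℝ) × U))

/-- The system written with the new inputs. -/
def hatSystem : (Fin n → ℝ) → U → (Fin n → ℝ) := fun x v => F x (T.symm (x, v)).2

/-- The new inputs as functions on the extended manifold. -/
def hatInput (i : Fin 3) : Jet n N → ℝ := fun q => (T (q.1, fun l => inputCoord q 0 l 0)).2 i

/-- The map `(x, u_[0,N-1]) ↦ (x, û_[0,N-1])`. -/
def hatMap (q : Jet n N) : Jet n N := (q.1, fun i α => timeDeriv F (hatInput T i) α.1 q)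

/-- `T` is an invertible input transformation near the point below `q₀`. -/
structure InputTransform (q₀ : Jet n N) : Prop where
  smoothF : SmoothSystemNear F q₀
  mem : baseMap n N q₀ ∈ T.source
  fst : ∀ q ∈ T.source, (T q).1 = q.1
  smooth : ContDiffOn ℝ ∞ T T.source
  smooth_symm : ContDiffOn ℝ ∞ T.symm T.target
  N_pos : 0 < N

variable {F T}

theorem hatInput_apply (i : Fin 3) (q : Jet n N) : hatInput T i q = (T (baseMap n N q)).2 i := by
  simp only [hatInput, baseMap_apply, inputFun_apply]

theorem inputFun_hatMap (i : Fin 3) {α : ℕ} (hα : α < N) (q : Jet n N) :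
    inputFun n N i α (hatMap F T q) = timeDeriv F (hatInput T i) α q := by
  rw [inputFun_of_lt _ hα]; rfl

namespace InputTransform

variable {q₀ : Jet n N} (h : InputTransform F T q₀)
include h

theorem eventually_mem : ∀ᶠ q in 𝓝 q₀, baseMap n N q ∈ T.source :=
  (baseMap n N).continuous.continuousAt.preimage_mem_nhds (T.open_source.mem_nhds h.mem)

theorem symm_fst {p : (Fin n → ℝ) × U} (hp : p ∈ T.target) : (T.symm p).1 = p.1 := by
  have := h.fst _ (T.map_target hp)
  rw [T.right_inv hp] at this
  exact this.symm

theorem baseMap_hatMap {q : Jet n N} (hq : baseMap n N q ∈ T.source) :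
    baseMap n N (hatMap F T q) = T (baseMap n N q) := by
  refine Prod.ext ?_ (funext fun i => ?_)
  · rw [h.fst _ hq]; rfl
  · change inputFun n N i 0 (hatMap F T q) = _
    rw [inputFun_hatMap i h.N_pos, ← hatInput_apply]; rfl

theorem hasFDerivAt_hatInput (i : Fin 3) {q : Jet n N} (hq : baseMap n N q ∈ T.source) :
    ContDiffAt ℝ ∞ (hatInput T i) q ∧
      ∀ δ, fderiv ℝ (hatInput T i) q δ = (fderiv ℝ T (baseMap n N q) (baseMap n N δ)).2 i := by
  have hs : ContDiffAt ℝ ∞ T (baseMap n N q) := h.smooth.contDiffAt (T.open_source.mem_nhds hq)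
  have heq : (hatInput T i : Jet n N → ℝ) = fun q => (T (baseMap n N q)).2 i :=
    funext fun q => hatInput_apply i q
  have h1 : ContDiffAt ℝ ∞ (fun q => T (baseMap n N q)) q :=
    ContDiffAt.comp q hs (baseMap n N).contDiff.contDiffAt
  have h2 : HasFDerivAt (fun q => T (baseMap n N q))
      ((fderiv ℝ T (baseMap n N q)).comp (baseMap n N)) q :=
    (hs.differentiableAt (by simp)).hasFDerivAt.comp q (baseMap n N).hasFDerivAt
  refine ⟨heq ▸ contDiffAt_pi.1 h1.snd i, fun δ => ?_⟩
  have h3 := hasFDerivAt_pi'.1 h2.snd i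
  rw [heq]
  exact DFunLike.congr_fun h3.fderiv δ

theorem smooth_hatInput (i : Fin 3) : SmoothNear (hatInput T i) q₀ :=
  h.eventually_mem.mono fun _ hq => (h.hasFDerivAt_hatInput i hq).1

theorem free_hatInput (i i' : Fin 3) : FreeNear (hatInput T i) q₀ i' 1 := by
  filter_upwards [h.eventually_mem] with q hq α hα
  rw [(h.hasFDerivAt_hatInput i hq).2]
  have : baseMap n N (inputVec n N i' α) = 0 := by
    rw [baseMap_apply]
    refine Prod.ext rfl ?_
    funext k
    change inputFun n N k 0 (inputVec n N i' α) = 0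
    rcases lt_or_ge α N with h1 | h1
    · rw [inputFun_inputVec _ _ h1, if_neg (by omega)]
    · rw [inputVec_of_ge _ h1, map_zero]
  rw [this, map_zero]; rfl

theorem smooth_timeDeriv (i : Fin 3) (α : ℕ) : SmoothNear (timeDeriv F (hatInput T i) α) q₀ :=
  (h.smooth_hatInput i).timeDeriv h.smoothF α

theorem free_timeDeriv (i i' : Fin 3) (α : ℕ) :
    FreeNear (timeDeriv F (hatInput T i) α) q₀ i' (α + 1) := by
  rw [add_comm]
  exact FreeNear.timeDeriv h.smoothF (h.smooth_hatInput i) (h.free_hatInput i i') α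

theorem symbol_timeDeriv (i i' : Fin 3) {α : ℕ} (hα : α < N) :
    ∀ᶠ q in 𝓝 q₀, fderiv ℝ (timeDeriv F (hatInput T i) α) q (inputVec n N i' α) =
      fderiv ℝ (hatInput T i) q (inputVec n N i' 0) := by
  induction α with
  | zero => exact Filter.Eventually.of_forall fun _ => rfl
  | succ α ih =>
    filter_upwards [ih (by omega), FreeNear.symbol h.smoothF (h.smooth_timeDeriv i α)
      (h.free_timeDeriv i i' α) hα] with q h1 h2
    rw [timeDeriv_succ, h2, h1]

/-- The transformation preserves x, so the injectivity of its differential passes to the block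
∂û/∂u. -/
theorem eventually_hatInput_injective : ∀ᶠ q in 𝓝 q₀, ∀ w : Fin 3 → ℝ,
    (∀ i, ∑ i', fderiv ℝ (hatInput T i) q (inputVec n N i' 0) * w i' = 0) → w = 0 := by
  filter_upwards [h.eventually_mem] with q hq w hw
  set δ : Jet n N := ∑ i, w i • inputVec n N i 0 with hδ
  have hb : baseMap n N δ = (0, w) := by
    rw [baseMap_apply]
    refine Prod.ext ?_ ?_
    · simp [hδ, Prod.fst_sum, inputVec]
    · funext i
      rw [hδ]
      simp only [map_sum, map_smul, inputFun_inputVec _ _ h.N_pos]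
      simp
  have h1 : ∀ i, (fderiv ℝ T (baseMap n N q) (0, w)).2 i = 0 := by
    intro i
    rw [← hb, ← (h.hasFDerivAt_hatInput i hq).2, hδ, map_sum, ← hw i]
    exact Finset.sum_congr rfl fun k _ => by rw [map_smul, smul_eq_mul, mul_comm]
  have h2 : (fderiv ℝ T (baseMap n N q) (0, w)).1 = 0 := by
    have hs : HasFDerivAt T (fderiv ℝ T (baseMap n N q)) (baseMap n N q) :=
      ((h.smooth.contDiffAt (T.open_source.mem_nhds hq)).differentiableAt (by simp)).hasFDerivAt
    have h3 : HasFDerivAt (fun p => (T p).1) (ContinuousLinearMap.fst ℝ (Fin n → ℝ) U)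
        (baseMap n N q) := hasFDerivAt_fst.congr_of_eventuallyEq
      (Filter.mem_of_superset (T.open_source.mem_nhds hq) fun p hp => h.fst p hp)
    exact DFunLike.congr_fun (hs.fst.unique h3) (0, w)
  have h4 : fderiv ℝ T (baseMap n N q) (0, w) = 0 := Prod.ext h2 (funext h1)
  have h5 := fderiv_leftInverse T h.smooth h.smooth_symm hq (0, w)
  rw [h4, map_zero] at h5
  exact (congrArg Prod.snd h5).symm

theorem smooth_hatMap : SmoothNear (hatMap F T) q₀ := by
  filter_upwards [Filter.eventually_all.2 fun i => Filter.eventually_all.2 fun α : Fin N =>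
    h.smooth_timeDeriv i α.1] with q hq
  exact contDiffAt_fst.prodMk (contDiffAt_pi.2 fun i => contDiffAt_pi.2 fun α => hq i α)

theorem eventually_fderiv_hatMap : ∀ᶠ q in 𝓝 q₀, ∀ δ, fderiv ℝ (hatMap F T) q δ =
    (δ.1, fun i α => fderiv ℝ (timeDeriv F (hatInput T i) α.1) q δ) := by
  filter_upwards [Filter.eventually_all.2 fun i => Filter.eventually_all.2 fun α : Fin N =>
    h.smooth_timeDeriv i α.1] with q hq δ
  have h1 : HasFDerivAt (fun q : Jet n N => fun i => fun α : Fin N =>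
      timeDeriv F (hatInput T i) α.1 q) _ q :=
    hasFDerivAt_pi.2 fun i => hasFDerivAt_pi.2 fun α =>
      ((hq i α).differentiableAt (by simp)).hasFDerivAt
  have h2 : HasFDerivAt (hatMap F T) _ q := (hasFDerivAt_fst (p := q)).prodMk h1
  exact DFunLike.congr_fun h2.fderiv δ

/-- The map `hatMap` is triangular. -/
theorem eventually_trunc_iff : ∀ᶠ q in 𝓝 q₀, ∀ k, k ≤ N → ∀ δ,
    stateTrunc (fun _ => k) (fderiv ℝ (hatMap F T) q δ) = 0 ↔ stateTrunc (fun _ => k) δ = 0 := by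
  have hall : ∀ {P : ℕ → Jet n N → Prop}, (∀ l, l < N → ∀ᶠ q in 𝓝 q₀, P l q) →
      ∀ᶠ q in 𝓝 q₀, ∀ l, l < N → P l q := fun {P} hP =>
    (Filter.eventually_all_finite (Set.finite_Iio N)).2 hP
  filter_upwards [h.eventually_fderiv_hatMap, h.eventually_hatInput_injective,
    hall fun l _ => Filter.eventually_all.2 fun i => Filter.eventually_all.2 fun i' =>
      h.free_timeDeriv i i' l,
    hall fun l hl => Filter.eventually_all.2 fun i => Filter.eventually_all.2 fun i' =>
      h.symbol_timeDeriv i i' hl] with q hP hinj hfree hsym k hk δ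
  have hfun : ∀ i, ∀ α, α < N → inputFun n N i α (fderiv ℝ (hatMap F T) q δ) =
      fderiv ℝ (timeDeriv F (hatInput T i) α) q δ := by
    intro i α hα
    rw [inputFun_of_lt _ hα, hP]
  have hx : (fderiv ℝ (hatMap F T) q δ).1 = δ.1 := by rw [hP]
  rw [stateTrunc_eq_zero, stateTrunc_eq_zero, hx]
  refine and_congr_right fun hδ => ⟨fun hδ' => ?_, fun hδ' i α hα => ?_⟩
  -- Once all lower orders vanish, the derivative of û of order α sees only the components of order
  -- α, through the invertible matrix ∂û/∂u.
  · suffices ∀ m, m ≤ k → ∀ i α, α < m → inputFun n N i α δ = 0 from this k le_rfl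
    intro m
    induction m with
    | zero => exact fun _ i α hα => absurd hα (Nat.not_lt_zero _)
    | succ m ih =>
      intro hm i α hα
      rcases Nat.lt_succ_iff_lt_or_eq.1 hα with h1 | rfl
      · exact ih (by omega) i α h1
      refine congrFun (hinj (fun i' => inputFun n N i' α δ) fun i' => ?_) i
      have h2 := hδ' i' α (by omega)
      rw [hfun i' α (by omega), apply_eq_leading _ (fun _ => α) δ
        (fun i'' β hβ => hfree α (by omega) i' i'' β hβ) hδ (ih (by omega))] at h2
      rw [← h2]
      exact Finset.sum_congr rfl fun i'' _ => by rw [hsym α (by omega)]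
  · rw [hfun i α (by omega)]
    exact apply_eq_zero_of_kills _ (fun _ => α + 1) δ
      (fun i' β hβ => hfree α (by omega) i i' β hβ) hδ fun i' β hβ => hδ' i' β (by omega)

theorem smooth_hatSystem : SmoothSystemNear (hatSystem F T) (hatMap F T q₀) := by
  have hb := h.baseMap_hatMap h.mem
  have hF : ∀ᶠ p in 𝓝 (baseMap n N q₀),
      ContDiffAt ℝ ∞ (fun p : (Fin n → ℝ) × U => F p.1 p.2) p := by
    have hs : Function.Surjective (baseMap n N) := fun p =>
      ⟨(p.1, fun i _ => p.2 i), Prod.ext rfl (funext fun i => by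
        rw [baseMap_apply]; exact inputFun_of_lt i h.N_pos _)⟩
    exact ((baseMap n N).isOpenMap hs).nhds_le q₀ (Filter.mem_map.2 h.smoothF)
  have hT : ∀ᶠ p in 𝓝 (T (baseMap n N q₀)), p ∈ T.target :=
    T.open_target.mem_nhds (T.map_source h.mem)
  have hc : Filter.Tendsto T.symm (𝓝 (T (baseMap n N q₀))) (𝓝 (baseMap n N q₀)) := by
    have := T.continuousAt_symm (T.map_source h.mem)
    rwa [ContinuousAt, T.left_inv h.mem] at this
  have key : ∀ᶠ p in 𝓝 (T (baseMap n N q₀)),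
      ContDiffAt ℝ ∞ (fun p : (Fin n → ℝ) × U => hatSystem F T p.1 p.2) p := by
    filter_upwards [hc.eventually hF, hT] with p h1 h2
    have h3 : ContDiffAt ℝ ∞ (fun p => (p.1, (T.symm p).2)) p :=
      contDiffAt_fst.prodMk (h.smooth_symm.contDiffAt (T.open_target.mem_nhds h2)).snd
    have h4 : (p.1, (T.symm p).2) = T.symm p := Prod.ext (h.symm_fst h2).symm rfl
    rw [← h4] at h1
    exact ContDiffAt.comp (g := fun p : (Fin n → ℝ) × U => F p.1 p.2) p h1 h3
  rw [← hb] at key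
  exact (baseMap n N).continuous.continuousAt.eventually key

/-- The velocities correspond to each other, up to the last derivatives of the inputs. -/
theorem eventually_velocity : ∀ᶠ q in 𝓝 q₀,
    stateTrunc (fun _ => N - 1) (fderiv ℝ (hatMap F T) q (jetField F N q)) =
      stateTrunc (fun _ => N - 1) (jetField (hatSystem F T) N (hatMap F T q)) := by
  filter_upwards [h.eventually_fderiv_hatMap, h.eventually_mem] with q hP hq
  rw [hP, stateTrunc_apply, stateTrunc_apply]
  refine Prod.ext ?_ ?_
  · change (jetField F N q).1 = (jetField (hatSystem F T) N (hatMap F T q)).1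
    rw [jetField_eq, jetField_eq]
    change F q.1 _ = F q.1 (T.symm (q.1, fun i => inputFun n N i 0 (hatMap F T q))).2
    rw [show (q.1, fun i => inputFun n N i 0 (hatMap F T q)) = T (baseMap n N q) from
      h.baseMap_hatMap hq, T.left_inv hq]
  · funext i α
    have hα : α.1 < N - 1 := α.2
    change inputFun n N i α.1 _ = inputFun n N i α.1 _
    rw [inputFun_jetField _ _ _ (by omega), inputFun_hatMap i (by omega), timeDeriv_succ,
      inputFun_of_lt _ (by omega)]
    rfl

theorem tendsto_hatMap : Filter.Tendsto (hatMap F T) (𝓝 q₀) (𝓝 (hatMap F T q₀)) :=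
  h.smooth_hatMap.self_of_nhds.continuousAt

variable {φ : Fin 3 → (Fin n → ℝ) → ℝ} (hφ : ∀ j, SmoothNear (φ j) q₀.1)
include hφ

/-- The derivatives of the outputs do not depend on the choice of the inputs. -/
theorem eventually_outDeriv_eq (j : Fin 3) {m : ℕ} (hm : m ≤ N) : ∀ᶠ q in 𝓝 q₀,
    outDeriv F φ N j m q = outDeriv (hatSystem F T) φ N j m (hatMap F T q) := by
  induction m with
  | zero => exact Filter.Eventually.of_forall fun q => rfl
  | succ m ih =>
    have hφ' : ∀ j, SmoothNear (φ j) (hatMap F T q₀).1 := hφ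
    filter_upwards [(ih (by omega)).eventually_nhds, h.eventually_velocity, h.smooth_hatMap,
      h.tendsto_hatMap.eventually (smooth_outDeriv h.smooth_hatSystem hφ' j m),
      h.tendsto_hatMap.eventually (Filter.eventually_all.2 fun i =>
        free_outDeriv h.smooth_hatSystem hφ' j i m)] with q h1 h2 h3 h4 h5
    have h6 : HasFDerivAt (fun q => outDeriv (hatSystem F T) φ N j m (hatMap F T q)) _ q :=
      (h4.differentiableAt (by simp)).hasFDerivAt.comp q
        (h3.differentiableAt (by simp)).hasFDerivAt
    rw [outDeriv_succ, outDeriv_succ, tau, tau, Filter.EventuallyEq.fderiv_eq h1, h6.fderiv]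
    change fderiv ℝ _ (hatMap F T q) (fderiv ℝ (hatMap F T) q (jetField F N q)) = _
    rw [← sub_eq_zero, ← map_sub]
    rw [← sub_eq_zero, ← map_sub, stateTrunc_eq_zero] at h2
    -- The two velocities may differ in the components of order N - 1, because both fields are
    -- truncated; as m ≤ N - 1, these do not enter φ_[m].
    exact apply_eq_zero_of_kills _ (fun _ => N - 1) _ (fun i α hα => h5 i α (by omega)) h2.1 h2.2

end InputTransform

/-- The change from u to û respects each level (x, u_[0,k-1]), so it carries an embedding of the
κ-fold prolongation into one for the transformed system. This is where equal prolongation of all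
inputs matters. -/
theorem JetLiftAt.hat {q₀ : Jet n N} (h : InputTransform F T q₀) {κ : ℕ} (hκ : κ < N)
    {S : Type} [NormedAddCommGroup S] [NormedSpace ℝ S] {G : S → U → S} {ι : S × U → Jet n N}
    {p₀ : S × U} (hι₀ : ι p₀ = q₀) (hι : ∀ᶠ p in 𝓝 p₀, JetLiftAt F κ G ι p) :
    ∀ᶠ p in 𝓝 p₀, JetLiftAt (hatSystem F T) κ G (fun p => hatMap F T (ι p)) p := by
  have hcont : Filter.Tendsto ι (𝓝 p₀) (𝓝 q₀) := by
    rw [← hι₀]; exact hι.self_of_nhds.smooth.continuousAt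
  filter_upwards [hι, hcont.eventually h.smooth_hatMap, hcont.eventually h.eventually_trunc_iff,
    hcont.eventually h.eventually_velocity] with p h1 h2 h3 h4
  have hd : ∀ δ, fderiv ℝ (fun p => hatMap F T (ι p)) p δ =
      fderiv ℝ (hatMap F T) (ι p) (fderiv ℝ ι p δ) := fun δ =>
    DFunLike.congr_fun ((h2.differentiableAt (by simp)).hasFDerivAt.comp p
      (h1.smooth.differentiableAt (by simp)).hasFDerivAt).fderiv δ
  refine ⟨ContDiffAt.comp p h2 h1.smooth, fun δ => ?_, fun δ hδ => ?_, ?_⟩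
  · rw [hd, h3 κ hκ.le, h1.state]
  · rw [hd, h3 (κ + 1) hκ] at hδ
    exact h1.inj δ hδ
  · have h5 : stateTrunc (fun _ => κ) (fderiv ℝ (hatMap F T) (ι p)
        (fderiv ℝ ι p (G p.1 p.2, 0) - jetField F N (ι p))) = 0 := by
      rw [h3 κ hκ.le, map_sub, h1.velocity, sub_self]
    rw [map_sub, map_sub, sub_eq_zero] at h5
    rw [hd, h5]
    rw [← sub_eq_zero, ← map_sub, stateTrunc_eq_zero] at h4 ⊢
    exact ⟨h4.1, fun i α hα => h4.2 i α (by omega)⟩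

end


/-! ### Invariance of parametrizations and ranks under input transformations -/

theorem surjective_of_injective {E : Type*} [NormedAddCommGroup E] [NormedSpace ℝ E]
    [FiniteDimensional ℝ E] {L : E →L[ℝ] E} (hL : ∀ δ, L δ = 0 → δ = 0) : Function.Surjective L := by
  have hinj : Function.Injective (L : E →ₗ[ℝ] E) := by
    rw [← LinearMap.ker_eq_bot, LinearMap.ker_eq_bot']
    exact hL
  exact LinearMap.injective_iff_surjective.1 hinj

section
variable {n N : ℕ} {F : (Fin n → ℝ) → U → (Fin n → ℝ)}
  {T : OpenPartialHomeomorph ((Fin n → ℝ) × U) ((Fin n → ℝ) × U)}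
  {q₀ : Jet n N} (h : InputTransform F T q₀)
  {φ : Fin 3 → (Fin n → ℝ) → ℝ} (hφ : ∀ j, SmoothNear (φ j) q₀.1)
include h

namespace InputTransform

theorem eventually_injective_hatMap : ∀ᶠ q in 𝓝 q₀, ∀ δ, fderiv ℝ (hatMap F T) q δ = 0 → δ = 0 := by
  filter_upwards [h.eventually_trunc_iff] with q hq δ hδ
  have h1 := stateTrunc_eq_zero.1 ((hq N le_rfl δ).1 (by rw [hδ, map_zero]))
  refine Prod.ext h1.1 (funext fun i => funext fun α => ?_)
  rw [← inputFun_of_lt i α.2]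
  exact h1.2 i α.1 α.2

theorem nhds_le_map_hatMap : 𝓝 (hatMap F T q₀) ≤ Filter.map (hatMap F T) (𝓝 q₀) := by
  have h1 := h.smooth_hatMap.self_of_nhds.hasStrictFDerivAt (by simp)
  refine (h1.map_nhds_eq_of_surj ?_).ge
  exact LinearMap.range_eq_top.2 (surjective_of_injective h.eventually_injective_hatMap.self_of_nhds)

include hφ

theorem eventually_outJet_eq {A : Fin 3 → ℕ} (hA : ∀ j, A j ≤ N + 1) : ∀ᶠ q in 𝓝 q₀,
    outJet F φ N A q = outJet (hatSystem F T) φ N A (hatMap F T q) := by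
  have : ∀ᶠ q in 𝓝 q₀, ∀ j, ∀ m : Fin (A j),
      outDeriv F φ N j m.1 q = outDeriv (hatSystem F T) φ N j m.1 (hatMap F T q) :=
    Filter.eventually_all.2 fun j => Filter.eventually_all.2 fun m =>
      h.eventually_outDeriv_eq hφ j (by have := hA j; have := m.2; omega)
  filter_upwards [this] with q hq
  exact funext fun j => funext fun m => hq j m

/-- The parametrizations give x and û, and the inverse of T turns them into u. For this x is
regarded as a function of the longer tuple, whose domain is cut down so that the pair lies in the
target of T. -/
theorem hasFlatParam {R : Fin 3 → ℕ} (hR : ∀ j, R j ≤ N)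
    (hp : HasFlatParam (hatSystem F T) φ N (hatMap F T q₀) R) : HasFlatParam F φ N q₀ R := by
  obtain ⟨Yx, Yu, Fx, Fu, hYx, hYu, hFx, hFu, hev⟩ := hp
  let restr : ((j : Fin 3) → Fin (R j + 1) → ℝ) → ((j : Fin 3) → Fin (R j) → ℝ) :=
    fun y j m => y j m.castSucc
  have hrestr : ContDiff ℝ ∞ restr :=
    contDiff_pi.2 fun j => contDiff_pi.2 fun m => contDiff_eval (A := fun j => R j + 1) j m.castSucc
  set W := Yu ∩ restr ⁻¹' Yx with hW
  have hWo : IsOpen W := hYu.inter (hYx.preimage hrestr.continuous)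
  have hK : ContDiffOn ℝ ∞ (fun y => (Fx (restr y), Fu y)) W :=
    (hFx.comp hrestr.contDiffOn fun y hy => hy.2).prodMk (hFu.mono Set.inter_subset_left)
  refine ⟨Yx, W ∩ (fun y => (Fx (restr y), Fu y)) ⁻¹' T.target, Fx,
    fun y => (T.symm (Fx (restr y), Fu y)).2, hYx,
    hK.continuousOn.isOpen_inter_preimage hWo T.open_target, hFx,
    (h.smooth_symm.comp (hK.mono Set.inter_subset_left) fun y hy => hy.2).snd, ?_⟩
  filter_upwards [h.eventually_outJet_eq hφ (A := R) fun j => by have := hR j; omega,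
    h.eventually_outJet_eq hφ (A := fun j => R j + 1) fun j => by have := hR j; omega,
    h.tendsto_hatMap.eventually hev, h.eventually_mem] with q h1 h2 h3 h4
  obtain ⟨h5, h6, h7, h8⟩ := h3
  have hr : restr (outJet (hatSystem F T) φ N (fun j => R j + 1) (hatMap F T q)) =
      outJet (hatSystem F T) φ N R (hatMap F T q) := rfl
  have hb := h.baseMap_hatMap h4
  have hb' : (Fx (outJet (hatSystem F T) φ N R (hatMap F T q)),
      Fu (outJet (hatSystem F T) φ N (fun j => R j + 1) (hatMap F T q))) = T (baseMap n N q) := by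
    rw [← hb, ← h7, ← h8, baseMap_apply]
    simp only [inputFun_apply]
  rw [h1, h2]
  refine ⟨h5, ⟨⟨h6, by rw [Set.mem_preimage, hr]; exact h5⟩, ?_⟩, h7, ?_⟩
  · rw [Set.mem_preimage, hr, hb']
    exact T.map_source h4
  · simp only [hr, hb', T.left_inv h4]
    simp only [baseMap_apply, inputFun_apply]

/-- The pull-back of covectors along the differential of `hatMap` is injective and matches the
codistributions of the outputs; it preserves ⟨dx⟩ because x is not transformed. -/
theorem hasConstantRanks {R : Fin 3 → ℕ} (hR : ∀ j, R j ≤ N) (hr : HasConstantRanks F φ N q₀ R) :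
    HasConstantRanks (hatSystem F T) φ N (hatMap F T q₀) R := by
  intro A hA
  have hφ' : ∀ j, SmoothNear (φ j) (hatMap F T q₀).1 := hφ
  have hfd : ∀ᶠ q in 𝓝 q₀, ∀ p : (j : Fin 3) × Fin (A j), fderiv ℝ (outDeriv F φ N p.1 p.2.1) q =
      (fderiv ℝ (outDeriv (hatSystem F T) φ N p.1 p.2.1) (hatMap F T q)).comp
        (fderiv ℝ (hatMap F T) q) := by
    refine Filter.eventually_all.2 fun p => ?_
    have hp : p.2.1 ≤ N := by have := p.2.2; have := hA p.1; have := hR p.1; omega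
    filter_upwards [(h.eventually_outDeriv_eq hφ p.1 hp).eventually_nhds, h.smooth_hatMap,
      h.tendsto_hatMap.eventually (smooth_outDeriv h.smooth_hatSystem hφ' p.1 p.2.1)]
      with q h1 h2 h3
    rw [Filter.EventuallyEq.fderiv_eq h1]
    exact ((h3.differentiableAt (by simp)).hasFDerivAt.comp q
      (h2.differentiableAt (by simp)).hasFDerivAt).fderiv
  have key : ∀ᶠ q in 𝓝 q₀, finrank ℝ ↥(outCodist F φ N A q ⊓ stateCodist n N) =
      finrank ℝ ↥(outCodist (hatSystem F T) φ N A (hatMap F T q) ⊓ stateCodist n N) := by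
    filter_upwards [hfd, h.eventually_injective_hatMap, h.eventually_fderiv_hatMap]
      with q h1 h2 h3
    let Q : (Jet n N →L[ℝ] ℝ) →ₗ[ℝ] (Jet n N →L[ℝ] ℝ) :=
      { toFun := fun η => η.comp (fderiv ℝ (hatMap F T) q)
        map_add' := fun _ _ => rfl
        map_smul' := fun _ _ => rfl }
    have hQ : Function.Injective Q := by
      intro η η' hη
      refine ContinuousLinearMap.ext fun δ => ?_
      obtain ⟨δ', rfl⟩ := surjective_of_injective h2 δ
      exact DFunLike.congr_fun hη δ'
    have ho : outCodist F φ N A q = (outCodist (hatSystem F T) φ N A (hatMap F T q)).map Q := by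
      rw [outCodist_eq_span_range, outCodist_eq_span_range, Submodule.map_span, ← Set.range_comp]
      congr 2
      funext p
      exact h1 p
    have hs : stateCodist n N = (stateCodist n N).map Q := by
      conv_rhs => rw [stateCodist, Submodule.map_span, ← Set.range_comp]
      rw [stateCodist]
      congr 2
      funext k
      refine ContinuousLinearMap.ext fun δ => ?_
      change δ.1 k = (fderiv ℝ (hatMap F T) q δ).1 k
      rw [h3]
    conv_lhs => rw [ho, hs, ← Submodule.map_inf Q hQ]
    exact (Submodule.equivMapOfInjective Q hQ _).finrank_eq.symm
  refine h.nhds_le_map_hatMap (Filter.mem_map.2 ?_)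
  filter_upwards [key, hr A hA] with q h1 h2
  change finrank ℝ ↥(outCodist (hatSystem F T) φ N A (hatMap F T q) ⊓ stateCodist n N) = _
  rw [← h1, h2, key.self_of_nhds]

end InputTransform
end

/-! ### The case without prolongations -/

namespace FlatChart

variable {n N : ℕ} {F : (Fin n → ℝ) → U → (Fin n → ℝ)} {φ : Fin 3 → (Fin n → ℝ) → ℝ}
  {q₀ : Jet n N} {R : Fin 3 → ℕ} (C : FlatChart F φ q₀ (fun _ => 0) R)

/-- The shape of three integrator chains. -/
def chainShape (C : FlatChart F φ q₀ (fun _ => 0) R) : GTFShape where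
  k1 := R 0
  k2 := R 1
  k3 := R 2
  p2 := R 1
  p3 := R 2
  r3 := R 2
  δ := 0
  one_le_k1 := C.L_pos 0
  one_le_k2 := C.L_pos 1
  one_le_k3 := C.L_pos 2
  k2_le_p2 := le_rfl
  p3_le_r3 := le_rfl
  p3_sub_k3 := rfl

theorem eventually_chainCoords : ∀ᶠ q in 𝓝 q₀, JetCoordsAt 0 C.chainShape
    (fun q => (fun l => outDeriv F φ N 0 l.1 q, fun l => outDeriv F φ N 1 l.1 q,
      fun l => outDeriv F φ N 2 l.1 q)) (fun q j => outDeriv F φ N j (R j) q)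
    ⟨0, 0, 0, 0, 0⟩ (jetField F N q) q := by
  have hsm : ∀ᶠ q in 𝓝 q₀, ∀ j, ∀ m : Fin (R j + 1), ContDiffAt ℝ ∞ (outDeriv F φ N j m.1) q :=
    Filter.eventually_all.2 fun j => Filter.eventually_all.2 fun m =>
      smooth_outDeriv C.smoothF C.smoothφ j m.1
  filter_upwards [hsm, C.eventually_injective, C.eventually_injective_top,
    C.eventually_fderiv_outDeriv] with q hs hinj hinjt hfd
  have hs' : ∀ j m, m ≤ R j → ContDiffAt ℝ ∞ (outDeriv F φ N j m) q := fun j m hm =>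
    hs j ⟨m, Nat.lt_succ_of_le hm⟩
  set Z : Jet n N → C.chainShape.State := fun q => (fun l => outDeriv F φ N 0 l.1 q,
    fun l => outDeriv F φ N 1 l.1 q, fun l => outDeriv F φ N 2 l.1 q) with hZ
  set V : Jet n N → U := fun q j => outDeriv F φ N j (R j) q with hV
  have hblock : ∀ j, ContDiffAt ℝ ∞ (fun q => (fun l => outDeriv F φ N j l.1 q : Fin (R j) → ℝ)) q :=
    fun j => contDiffAt_pi.2 fun l => hs' j l.1 l.2.le
  have hbd : ∀ j, HasFDerivAt (fun q => (fun l => outDeriv F φ N j l.1 q : Fin (R j) → ℝ))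
      (ContinuousLinearMap.pi fun l => fderiv ℝ (outDeriv F φ N j l.1) q) q := fun j =>
    hasFDerivAt_pi.2 fun l => ((hs' j l.1 l.2.le).differentiableAt (by simp)).hasFDerivAt
  have hZd : ∀ δ, fderiv ℝ Z q δ = (fun l => fderiv ℝ (outDeriv F φ N 0 l.1) q δ,
      fun l => fderiv ℝ (outDeriv F φ N 1 l.1) q δ,
      fun l => fderiv ℝ (outDeriv F φ N 2 l.1) q δ) := fun δ =>
    DFunLike.congr_fun ((hbd 0).prodMk ((hbd 1).prodMk (hbd 2))).fderiv δ
  have hVd : ∀ δ j, fderiv ℝ V q δ j = fderiv ℝ (outDeriv F φ N j (R j)) q δ := fun δ j =>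
    congrFun (DFunLike.congr_fun (hasFDerivAt_pi.2 fun j =>
      ((hs' j (R j) le_rfl).differentiableAt (by simp)).hasFDerivAt).fderiv δ) j
  have htau : ∀ j m, fderiv ℝ (outDeriv F φ N j m) q (jetField F N q) =
      outDeriv F φ N j (m + 1) q := fun j m => by rw [outDeriv_succ]; rfl
  have hrow : ∀ j (l : Fin (R j)), fderiv ℝ (outDeriv F φ N j l.1) q (jetField F N q) =
      if l.1 + 1 < R j then coord (fun l : Fin (R j) => outDeriv F φ N j l.1 q) (l.1 + 2)
      else V q j := by
    intro j l
    rw [htau]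
    split_ifs with h1
    · rw [coord_succ _ h1]
    · rw [show l.1 + 1 = R j by have := l.2; omega]
  -- With k2 = p2 and k3 = p3 = r3 there are no coefficient rows, so the requirements on them range
  -- over empty index sets.
  have hno : ∀ {a b : ℕ} {p : Prop}, a ≤ b → b < a → p := fun h1 h2 => absurd h1 (not_le.2 h2)
  refine
    { smooth_state := (hblock 0).prodMk ((hblock 1).prodMk (hblock 2))
      smooth_input := contDiffAt_pi.2 fun j => hs' j _ le_rfl
      smooth2 := fun l h1 h2 => hno h1 h2
      smooth3 := fun l h1 h2 => hno h1 h2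
      smooth32 := fun l h1 h2 => hno h1 h2
      dynamics := ?_
      dep2 := fun i hi => hno (Nat.le_add_right _ _) hi
      dep3 := fun i hi => hno (Nat.le_add_right _ _) hi
      dep3' := fun l h1 h2 => hno h1 h2
      b21_ne := fun h => absurd h (lt_irrefl _)
      b31_ne := fun h => absurd h (lt_irrefl _)
      reg1 := fun i hi => absurd hi (Nat.not_lt_zero _)
      reg2 := fun i hi => hno (Nat.le_add_right _ _) hi
      reg3 := fun l h1 h2 => hno h1 h2
      state_indep := fun δ hδ => ?_
      state_inj := fun δ hδ => hinj δ ?_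
      input_inj := fun δ hδ hVδ => ?_
      indep2 := fun l h1 h2 => hno h1 h2
      indep3 := fun l h1 h2 => hno h1 h2
      indep32 := fun l h1 h2 => hno h1 h2 }
  · rw [hZd]
    refine Prod.ext ?_ (Prod.ext ?_ ?_)
    · exact funext fun l => hrow 0 l
    · funext l
      refine (hrow 1 l).trans ?_
      simp only [gtfField]
      change _ = if l.1 + 1 < R 1 then _ else if l.1 + 1 < R 1 then _ else _
      split_ifs <;> rfl
    · funext l
      refine (hrow 2 l).trans ?_
      simp only [gtfField]
      change _ = if l.1 + 1 < R 2 then _ else if l.1 + 1 < R 2 then _ else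
        if l.1 + 1 < R 2 then _ else _
      split_ifs <;> rfl
  · have h0 : ∀ j (m : Fin (R j)), fderiv ℝ (outDeriv F φ N j m.1) q δ = 0 := fun j m => by
      rw [hfd, hδ, map_zero]; rfl
    rw [hZd]
    exact Prod.ext (funext fun l => h0 0 l)
      (Prod.ext (funext fun l => h0 1 l) (funext fun l => h0 2 l))
  · rw [hZd] at hδ
    refine TriData.forall_fin_three.2 ⟨fun m hm => ?_, fun m hm => ?_, fun m hm => ?_⟩
    · exact congrFun (congrArg Prod.fst hδ) ⟨m, hm⟩
    · exact congrFun (congrArg (fun z => z.2.1) hδ) ⟨m, hm⟩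
    · exact congrFun (congrArg (fun z => z.2.2) hδ) ⟨m, hm⟩
  · have h1 := hinjt δ hδ fun j => by rw [← hVd, hVδ]; rfl
    refine stateTrunc_eq_zero.2 ⟨(stateTrunc_eq_zero.1 hδ).1, fun i α hα => ?_⟩
    rw [show α = 0 by omega]
    exact congrFun h1 i

/-- A system that is linearized without prolongations is in triangular form. -/
theorem isSFEToGTF3_of_zero (C : FlatChart F φ q₀ (fun _ => 0) R) {S : Type}
    [NormedAddCommGroup S] [NormedSpace ℝ S] [FiniteDimensional ℝ S] {G : S → U → S}
    {Λ : S × U → Jet n N} {s₀ : S} {w₀ : U} (hΛ₀ : Λ (s₀, w₀) = q₀)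
    (hΛ : ∀ᶠ p in 𝓝 (s₀, w₀), JetLiftAt F 0 G Λ p) (hdim : finrank ℝ S = n)
    {hout : Fin 3 → S → ℝ} (hh : ∀ᶠ p in 𝓝 (s₀, w₀), ∀ j, hout j p.1 = φ j (Λ p).1) :
    IsSFEToGTF3 G s₀ w₀ hout := by
  have hcont : Filter.Tendsto Λ (𝓝 (s₀, w₀)) (𝓝 q₀) := by
    rw [← hΛ₀]; exact hΛ.self_of_nhds.smooth.continuousAt
  refine isSFEToGTF3_of_coords (I := C.chainShape) (Zt := fun p => (fun l => outDeriv F φ N 0 l.1 (Λ p),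
    fun l => outDeriv F φ N 1 l.1 (Λ p), fun l => outDeriv F φ N 2 l.1 (Λ p)))
    (Vt := fun p j => outDeriv F φ N j (R j) (Λ p))
    (c := (⟨0, 0, 0, 0, 0⟩ : LiftedCoeff (Jet n N)).comp Λ) ?_ ?_ 1 ?_
  · have h1 := C.T.finrank_eq
    simp only [Ext, Module.finrank_prod, Module.finrank_pi, Module.finrank_pi_fintype,
      Fintype.card_fin, Fin.sum_univ_three] at h1
    change _ = R 0 + R 1 + R 2
    omega
  · filter_upwards [hΛ, hcont.eventually C.eventually_chainCoords] with p h1 h2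
    exact h2.comp h1
  · filter_upwards [hh] with p hp
    rw [hp, hp, hp]
    exact ⟨coord_succ _ (l := 0) (C.L_pos 0), coord_succ _ (l := 0) (C.L_pos 1),
      coord_succ _ (l := 0) (C.L_pos 2)⟩

end FlatChart


/-! ### Embedding a prolonged system into the extended manifold -/

section
variable {n N : ℕ}

/-- The point with the coordinates `(x, u_[0,κ])` given by a state and an input of the `κ`-fold
prolongation, and zero as its other coordinates. -/
def extLin (n N κ : ℕ) : Ext n (fun _ => κ) × U →L[ℝ] Jet n N :=
  LinearMap.toContinuousLinearMap
    { toFun := fun p => (p.1.1, fun i α =>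
        if α.1 ≤ κ then inputCoord p.1 p.2 i α.1 else 0)
      map_add' := fun p p' => by
        refine Prod.ext rfl (funext fun i => funext fun α => ?_)
        simp only [inputCoord, Prod.fst_add, Prod.snd_add, Pi.add_apply]
        split_ifs <;> simp
      map_smul' := fun a p => by
        refine Prod.ext rfl (funext fun i => funext fun α => ?_)
        simp only [inputCoord, Prod.smul_fst, Prod.smul_snd, Pi.smul_apply, RingHom.id_apply]
        split_ifs <;> simp }

theorem inputFun_extLin {κ α : ℕ} (hκ : κ < N) (hα : α ≤ κ) (i : Fin 3)
    (p : Ext n (fun _ => κ) × U) :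
    inputFun n N i α (extLin n N κ p) = inputCoord p.1 p.2 i α := by
  rw [inputFun_of_lt _ (hα.trans_lt hκ)]
  exact if_pos hα

theorem stateTrunc_extLin {κ : ℕ} (hκ : κ < N) (p : Ext n (fun _ => κ) × U) :
    stateTrunc (fun _ => κ) (extLin n N κ p) = p.1 := by
  refine Prod.ext rfl (funext fun i => funext fun α => ?_)
  change inputFun n N i α.1 (extLin n N κ p) = _
  rw [inputFun_extLin hκ α.2.le, inputCoord, dif_pos α.2]

theorem inputTop_extLin {κ : ℕ} (hκ : κ < N) (p : Ext n (fun _ => κ) × U) :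
    inputTop (fun _ => κ) (extLin n N κ p) = p.2 := by
  funext i
  rw [inputTop_apply, inputFun_extLin hκ le_rfl, inputCoord, dif_neg (lt_irrefl _)]

theorem stateTrunc_succ_eq_zero {κ : ℕ} {δ : Jet n N} :
    stateTrunc (fun _ => κ + 1) δ = 0 ↔
      stateTrunc (fun _ => κ) δ = 0 ∧ inputTop (fun _ => κ) δ = 0 := by
  rw [stateTrunc_eq_zero, stateTrunc_eq_zero]
  refine ⟨fun h => ⟨⟨h.1, fun i α hα => h.2 i α (by omega)⟩,
    funext fun i => h.2 i κ (by omega)⟩,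
    fun h => ⟨h.1.1, fun i α hα => ?_⟩⟩
  rcases Nat.lt_succ_iff_lt_or_eq.1 hα with h1 | rfl
  · exact h.1.2 i α h1
  · exact congrFun h.2 i

theorem stateTrunc_sub_extLin {κ : ℕ} (hκ : κ < N) (q : Jet n N) :
    stateTrunc (fun _ => κ + 1)
      (q - extLin n N κ (stateTrunc (fun _ => κ) q, inputTop (fun _ => κ) q)) = 0 := by
  rw [stateTrunc_succ_eq_zero, map_sub, map_sub, stateTrunc_extLin hκ, inputTop_extLin hκ]
  exact ⟨sub_self _, sub_self _⟩

/-- The constant c adds input derivatives of orders above κ. They are invisible to the prolonged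
system but allow the base point to be mapped to q₀ itself, near which all properties are known. -/
theorem jetLiftAt_extLin {F : (Fin n → ℝ) → U → (Fin n → ℝ)} {κ : ℕ} (hκ : κ < N) {S : Type}
    [NormedAddCommGroup S] [NormedSpace ℝ S] {G : S → U → S} {e : S →L[ℝ] Ext n (fun _ => κ)}
    (he : ∀ s, e s = 0 → s = 0) (hG : ∀ s w, prolong F (fun _ => κ) (e s) w = e (G s w))
    {c : Jet n N} (hc : stateTrunc (fun _ => κ + 1) c = 0) (p : S × U) :
    JetLiftAt F κ G (fun p => extLin n N κ (e p.1, p.2) + c) p := by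
  obtain ⟨hc1, hc2⟩ := stateTrunc_succ_eq_zero.1 hc
  set A : S × U →L[ℝ] Jet n N := (extLin n N κ).comp (e.prodMap (ContinuousLinearMap.id ℝ U))
  have hA : ∀ δ, A δ = extLin n N κ (e δ.1, δ.2) := fun δ => rfl
  have hd : ∀ δ, fderiv ℝ (fun p : S × U => extLin n N κ (e p.1, p.2) + c) p δ =
      extLin n N κ (e δ.1, δ.2) := fun δ =>
    DFunLike.congr_fun (A.hasFDerivAt.add_const c).fderiv δ
  have hst : ∀ δ : S × U, stateTrunc (fun _ => κ) (extLin n N κ (e δ.1, δ.2)) = e δ.1 := fun δ =>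
    stateTrunc_extLin hκ _
  refine ⟨A.contDiff.contDiffAt.add contDiffAt_const, fun δ => ?_, fun δ hδ => ?_, ?_⟩
  · rw [hd, hst]
    exact ⟨he _, fun h => by rw [h, map_zero]⟩
  · rw [hd, stateTrunc_succ_eq_zero, hst, inputTop_extLin hκ] at hδ
    exact Prod.ext (he _ hδ.1) hδ.2
  · rw [hd, hst, stateTrunc_jetField F (fun _ => hκ), map_add, map_add, hc1, hc2, add_zero,
      add_zero, hst, inputTop_extLin hκ, hG]

end

/-! ### Consequences of linearizability -/

/-- For n = 0 the outputs would be constant, yet they are coordinates of a chart. Positivity of n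
yields D i < ΣR ≤ N in `exists_flatChart`. -/
theorem IsSFLWithOutput.pos {n : ℕ} {D : Fin 3 → ℕ} {G : Ext n D → U → Ext n D} {s₀ : Ext n D}
    {w₀ : U} {φ : Fin 3 → (Fin n → ℝ) → ℝ} (h : IsSFLWithOutput G s₀ w₀ fun j s => φ j s.1) :
    0 < n := by
  obtain ⟨L, hL, T, htop⟩ := h
  rcases Nat.eq_zero_or_pos n with rfl | hn
  · exfalso
    have hs := T.source_sub _ T.base_mem
    have hd : HasFDerivAt T.Φ (fderiv ℝ T.Φ s₀) s₀ :=
      ((T.smooth_Φ.contDiffAt (T.Φ.open_source.mem_nhds hs)).differentiableAt (by simp)).hasFDerivAt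
    have h1 := hasFDerivAt_pi'.1 (hasFDerivAt_pi'.1 hd 0) ⟨0, hL 0⟩
    have h2 : HasFDerivAt (fun s => T.Φ s 0 ⟨0, hL 0⟩) (0 : Ext 0 D →L[ℝ] ℝ) s₀ :=
      (hasFDerivAt_const (φ 0 0) s₀).congr_of_eventuallyEq
        (Filter.mem_of_superset (T.Φ.open_source.mem_nhds hs) fun s hs' => by
          change T.Φ s 0 ⟨0, hL 0⟩ = φ 0 0
          exact (htop s hs' 0).trans (congrArg (φ 0) (Subsingleton.elim _ _)))
    have h3 := DFunLike.congr_fun (h1.unique h2) (fderiv ℝ T.Φ.symm (T.Φ s₀) fun _ _ => 1)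
    have h4 := congrFun (congrFun
      (fderiv_rightInverse T.Φ T.smooth_Φ T.smooth_Φ_symm hs fun _ _ => 1) 0) ⟨0, hL 0⟩
    exact one_ne_zero (h4.symm.trans h3)
  · exact hn

theorem finrank_ext (n : ℕ) (D : Fin 3 → ℕ) : finrank ℝ (Ext n D) = n + ∑ i, D i := by
  simp [Ext, Module.finrank_prod, Module.finrank_pi_fintype]

theorem LocalSFE.sum_lengths {n : ℕ} {D L : Fin 3 → ℕ} {G : Ext n D → U → Ext n D} {s₀ : Ext n D}
    {w₀ : U} (T : LocalSFE G s₀ w₀ (brunovsky L)) : n + ∑ i, D i = ∑ j, L j := by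
  have h := T.finrank_eq
  rw [finrank_ext] at h
  simpa [Module.finrank_pi_fintype] using h

theorem SmoothNear.of_contDiffOn {E E' : Type*} [NormedAddCommGroup E] [NormedSpace ℝ E]
    [NormedAddCommGroup E'] [NormedSpace ℝ E'] {h : E → E'} {X : Set E} (hX : IsOpen X)
    (hh : ContDiffOn ℝ ∞ h X) {p : E} (hp : p ∈ X) : SmoothNear h p :=
  Filter.mem_of_superset (hX.mem_nhds hp) fun _ hq => hh.contDiffAt (hX.mem_nhds hq)

theorem smoothSystemNear_affineSystem {n N : ℕ} {X : Set (Fin n → ℝ)} (hX : IsOpen X)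
    {f : (Fin n → ℝ) → (Fin n → ℝ)} {g : Fin 3 → (Fin n → ℝ) → (Fin n → ℝ)}
    (hf : ContDiffOn ℝ ∞ f X) (hg : ∀ i, ContDiffOn ℝ ∞ (g i) X) {q₀ : Jet n N} (hq₀ : q₀.1 ∈ X) :
    SmoothSystemNear (affineSystem f g) q₀ := by
  filter_upwards [continuous_fst.continuousAt.preimage_mem_nhds (hX.mem_nhds hq₀)] with q hq
  have hX' : X ∈ 𝓝 q.1 := hX.mem_nhds hq
  have comp : ∀ {h : (Fin n → ℝ) → (Fin n → ℝ)}, ContDiffOn ℝ ∞ h X →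
      ContDiffAt ℝ ∞ (fun p : (Fin n → ℝ) × U => h p.1) (q.1, fun i => inputFun n N i 0 q) :=
    fun hh => ContDiffAt.comp _ (hh.contDiffAt hX') contDiffAt_fst
  exact (comp hf).add (ContDiffAt.sum fun i _ =>
    (contDiffAt_pi.1 contDiffAt_snd i).smul (comp (hg i)))

/-- In the case of an `x`-flat output, a linearization via minimal prolongations has chains of the
lengths given by the multi-index of the flat output. -/
theorem exists_flatChart {n N : ℕ} {F : (Fin n → ℝ) → U → (Fin n → ℝ)}
    {φ : Fin 3 → (Fin n → ℝ) → ℝ} {q₀ : Jet n N} {R : Fin 3 → ℕ} (hF : SmoothSystemNear F q₀)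
    (hφ : ∀ j, SmoothNear (φ j) q₀.1) (hN : ∑ j, R j ≤ N) (hflat : IsXFlatOutput F φ N q₀ R)
    (hsfl : IsSFLViaMinimalProlongations F φ N q₀ R) :
    ∃ (T : OpenPartialHomeomorph ((Fin n → ℝ) × U) ((Fin n → ℝ) × U)) (D : Fin 3 → ℕ),
      InputTransform F T q₀ ∧ (∑ i, (D i : ℤ)) = diffDifference n R ∧
      Nonempty (FlatChart (hatSystem F T) φ (hatMap F T q₀) D R) := by
  obtain ⟨T, D, hmem, hfst, hsm, hsymm, hsum, hlin⟩ := hsfl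
  have hn := hlin.pos
  obtain ⟨L, hL, E, htop⟩ := hlin
  have hsL := E.sum_lengths
  have hsR : n + ∑ i, D i = ∑ j, R j := by
    unfold diffDifference at hsum
    zify
    linarith
  have hDlt : ∀ i, D i < N := fun i => by
    have := Finset.single_le_sum (f := D) (fun _ _ => Nat.zero_le _) (Finset.mem_univ i)
    omega
  have hLle : ∀ j, L j ≤ N := fun j => by
    have := Finset.single_le_sum (f := L) (fun _ _ => Nat.zero_le _) (Finset.mem_univ j)
    omega
  have h : InputTransform F T q₀ := ⟨hF, by simpa only [baseMap_apply, inputFun_apply] using hmem,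
    hfst, hsm, hsymm, by have := hDlt 0; omega⟩
  have e1 : stateTrunc D (hatMap F T q₀) =
      (q₀.1, fun i α => timeDeriv F (hatInput T i) α.1 q₀) := by
    refine Prod.ext rfl (funext fun i => funext fun α => ?_)
    exact inputFun_hatMap i (α.2.trans (hDlt i)) q₀
  have e2 : inputTop D (hatMap F T q₀) = fun i => timeDeriv F (hatInput T i) (D i) q₀ :=
    funext fun i => inputFun_hatMap i (hDlt i) q₀
  obtain ⟨E', htop'⟩ : ∃ E' : LocalSFE (prolong (hatSystem F T) D) (stateTrunc D (hatMap F T q₀))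
      (inputTop D (hatMap F T q₀)) (brunovsky L),
      ∀ s ∈ E'.Φ.source, ∀ j, E'.Φ s j ⟨0, hL j⟩ = φ j s.1 := by
    rw [e1, e2]
    exact ⟨E, htop⟩
  have C : FlatChart (hatSystem F T) φ (hatMap F T q₀) D L :=
    ⟨E', h.smooth_hatSystem, hφ, hDlt, hL, hLle, htop'⟩
  have hRL := hflat.2 L hLle (h.hasFlatParam hφ hLle C.hasFlatParam_self)
  have hLR : L = R := by
    have := (Finset.sum_eq_sum_iff_of_le fun j _ => hRL j).1 (hsR.symm.trans hsL)
    exact funext fun j => (this j (Finset.mem_univ j)).symm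
  subst hLR
  exact ⟨T, D, h, hsum, ⟨C⟩⟩

/-- A system that is linearized by static feedback without prolongations is in triangular form. -/
theorem FlatChart.isSFEToGTF3_of_zero_hat {n N : ℕ} {F : (Fin n → ℝ) → U → (Fin n → ℝ)}
    {φ : Fin 3 → (Fin n → ℝ) → ℝ} {q₀ : Jet n N} {R : Fin 3 → ℕ}
    {T : OpenPartialHomeomorph ((Fin n → ℝ) × U) ((Fin n → ℝ) × U)} (h : InputTransform F T q₀)
    (C : FlatChart (hatSystem F T) φ (hatMap F T q₀) (fun _ => 0) R) :
    IsSFEToGTF3 F q₀.1 (fun i => inputCoord q₀ 0 i 0) φ := by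
  let e : (Fin n → ℝ) →L[ℝ] Ext n (fun _ => 0) := ContinuousLinearMap.inl ℝ _ _
  let c := q₀ - extLin n N 0 (stateTrunc (fun _ => 0) q₀, inputTop (fun _ => 0) q₀)
  have hι₀ : extLin n N 0 (e q₀.1, fun i => inputCoord q₀ 0 i 0) + c = q₀ := by
    have h1 : stateTrunc (fun _ => 0) q₀ = e q₀.1 :=
      Prod.ext rfl (funext fun i => funext fun α => α.elim0)
    have h2 : inputTop (fun _ => 0) q₀ = fun i => inputCoord q₀ 0 i 0 :=
      funext fun i => inputFun_apply i 0 q₀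
    simp only [c, h1, h2]
    abel
  have hι : ∀ p, JetLiftAt F 0 F (fun p => extLin n N 0 (e p.1, p.2) + c) p :=
    jetLiftAt_extLin h.N_pos (fun s hs => congrArg Prod.fst hs)
      (fun s w => Prod.ext rfl (funext fun i => funext fun α => α.elim0))
      (stateTrunc_sub_extLin h.N_pos q₀)
  refine C.isSFEToGTF3_of_zero (congrArg (hatMap F T) hι₀)
    (JetLiftAt.hat h h.N_pos hι₀ (Filter.Eventually.of_forall hι)) (by simp)
    (Filter.Eventually.of_forall fun p j => congrArg (φ j) ?_)
  change p.1 = p.1 + (q₀.1 - q₀.1)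
  rw [sub_self, add_zero]

/-- Prolonging every input as often as the new input that is prolonged most leads to the triangular
form. -/
theorem TriData.Triangular.isSFEToGTF3_prolong {n N : ℕ} {F : (Fin n → ℝ) → U → (Fin n → ℝ)}
    {q₀ : Jet n N} {T : OpenPartialHomeomorph ((Fin n → ℝ) × U) ((Fin n → ℝ) × U)}
    (h : InputTransform F T q₀) {A : TriData n N} (hA : A.F = hatSystem F T)
    (hT : A.Triangular (hatMap F T q₀)) (C : FlatChart A.F A.φ (hatMap F T q₀) A.D A.R) :
    IsSFEToGTF3 (prolong F (fun _ => A.d 2)) (q₀.1, fun i α => inputCoord q₀ 0 i α.1)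
      (fun i => inputCoord q₀ 0 i (A.d 2)) (fun j s => A.φ j s.1) := by
  set κ := A.d 2 with hκ
  have hκN : κ < N := hT.d_lt 2
  let c := q₀ - extLin n N κ (stateTrunc (fun _ => κ) q₀, inputTop (fun _ => κ) q₀)
  have hι₀ : extLin n N κ ((q₀.1, fun i α => inputCoord q₀ 0 i α.1),
      fun i => inputCoord q₀ 0 i κ) + c = q₀ := by
    have h1 : stateTrunc (fun _ => κ) q₀ = (q₀.1, fun i α => inputCoord q₀ 0 i α.1) :=
      Prod.ext rfl (funext fun i => funext fun α => inputFun_apply i α.1 q₀)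
    have h2 : inputTop (fun _ => κ) q₀ = fun i => inputCoord q₀ 0 i κ :=
      funext fun i => inputFun_apply i κ q₀
    simp only [c, h1, h2]
    abel
  have hι : ∀ p, JetLiftAt F κ (prolong F (fun _ => κ)) (fun p => extLin n N κ (p.1, p.2) + c) p :=
    jetLiftAt_extLin (e := ContinuousLinearMap.id ℝ _) hκN (fun s hs => hs) (fun s w => rfl)
      (stateTrunc_sub_extLin hκN q₀)
  have hl := JetLiftAt.hat h hκN (p₀ := ((q₀.1, fun i α => inputCoord q₀ 0 i α.1),
    fun i => inputCoord q₀ 0 i κ)) hι₀ (Filter.Eventually.of_forall hι)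
  rw [← hA] at hl
  refine hT.isSFEToGTF3 C (congrArg (hatMap F T) hι₀) hl (by rw [finrank_ext]; simp [← hκ])
    (Filter.Eventually.of_forall fun p j => congrArg (A.φ j) ?_)
  change p.1.1 = p.1.1 + (q₀.1 - q₀.1)
  rw [sub_self, add_zero]

end FlatGTF

end

/-! ### Proof of the corollary -/

open scoped ContDiff Topology in
open FlatGTF in
theorem corollary1 {n : ℕ} (X : Set (Fin n → ℝ)) (hX : IsOpen X)
    (f : (Fin n → ℝ) → (Fin n → ℝ)) (g : Fin 3 → (Fin n → ℝ) → (Fin n → ℝ))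
    (φ : Fin 3 → (Fin n → ℝ) → ℝ)
    (hf : ContDiffOn ℝ ∞ f X) (hg : ∀ i, ContDiffOn ℝ ∞ (g i) X)
    (hφ : ∀ j, ContDiffOn ℝ ∞ (φ j) X)
    (R : Fin 3 → ℕ) (N : ℕ) (hN : ∑ j, R j ≤ N)
    (q₀ : Jet n N) (hq₀ : q₀.1 ∈ X)
    (hflat : IsXFlatOutput (affineSystem f g) φ N q₀ R)
    (hrank : HasConstantRanks (affineSystem f g) φ N q₀ R)
    (hnot : ¬ IsSFEToGTF3 (affineSystem f g) q₀.1 (fun i => inputCoord q₀ 0 i 0) φ)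
    (hsfl : IsSFLViaMinimalProlongations (affineSystem f g) φ N q₀ R) :
    ∃ κ : ℕ, 1 ≤ κ ∧ (κ : ℤ) ≤ diffDifference n R ∧
      IsSFEToGTF3 (prolong (affineSystem f g) (fun _ => κ))
        (q₀.1, fun i α => inputCoord q₀ 0 i α.1) (fun i => inputCoord q₀ 0 i κ)
        (fun j s => φ j s.1) := by
  have hφ' : ∀ j, SmoothNear (φ j) q₀.1 := fun j => .of_contDiffOn hX (hφ j) hq₀
  obtain ⟨T, D, h, hsum, ⟨C⟩⟩ :=
    exists_flatChart (smoothSystemNear_affineSystem hX hf hg hq₀) hφ' hN hflat hsfl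
  have hR : ∀ j, R j ≤ N := fun j =>
    (Finset.single_le_sum (f := R) (fun _ _ => Nat.zero_le _) (Finset.mem_univ j)).trans hN
  -- If some new input is prolonged, κ is the largest entry of D, which is at most ΣD, the
  -- differential difference. If none is, the system is already in triangular form, which `hnot`
  -- excludes.
  by_cases hD : ∃ i, 0 < D i
  · obtain ⟨A, hAF, rfl, rfl, rfl, hA⟩ := C.exists_triangular
      (fun R' hR' hp => hflat.2 R' hR' (h.hasFlatParam hφ' hR' hp))
      (h.hasConstantRanks hφ' hR hrank) hN hD
    refine ⟨A.d 2, hA.d_two_pos, ?_, hA.isSFEToGTF3_prolong h hAF (hAF ▸ C)⟩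
    rw [← hsum]
    exact_mod_cast Finset.single_le_sum (f := A.D) (fun _ _ => Nat.zero_le _)
      (Finset.mem_univ (A.ρ 2))
  · obtain rfl : D = fun _ => 0 := funext fun i => Nat.eq_zero_of_not_pos fun hi => hD ⟨i, hi⟩
    exact absurd (C.isSFEToGTF3_of_zero_hat h) hnot
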